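/- Let $d\ge 1$, let $|\cdot|$ be the $1$-norm on $\mathbb{Z}^d$, and for integers $L\ge 1$ let $\Lambda_L=[-L,L]^d\cap\mathbb{Z}^d$. Let $m_x$, $k_x$ ($x\in\mathbb{Z}^d$) and $\lambda_{x,y}=\lambda_{y,x}$ ($|x-y|=1$) be real random variables on a probability space $(\Omega,\mathbb{P})$. Assume that there are (non-random) numbers $m_{\min},m_{\max},k_{\max},\lambda_{\max}$ with $m_{\min}>0$ such that almost surely $m_{\min}\le m_x\le m_{\max}$, $0\le k_x\le k_{\max}$ and $0\le\lambda_{x,y}\le\lambda_{\max}$ for all $x$ and all nearest neighbours $x,y$. Let $$H_L=\sum_{x\in\Lambda_L}\Big(\frac{1}{2m_x}p_x^2+\frac{k_x}{2}q_x^2\Big)+\sum_{\{x,y\}\subset\Lambda_L,\ |x-y|=1}\lambda_{x,y}(q_x-q_y)^2$$ be the self-adjoint closure in $L^2(\mathbb{R}^{\Lambda_L},dq)$ of this operator on the Schwartz space, where $q_x$ is multiplication by the coordinate $q_x$ and $p_x=-i\,\partial/\partial q_x$. Let $h_{0,L}$ be the real symmetric matrix, indexed by $\Lambda_L$, with entries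 $\frac{k_x}{2}+\sum_{u\in\Lambda_L,\,|u-x|=1}\lambda_{x,u}$ at $(x,x)$, $-\lambda_{x,y}$ at $(x,y)$ if $|x-y|=1$, and $0$ otherwise; assume that almost surely $h_{0,L}$ is positive definite for all $L\ge1$. Put $h_L=\mu^{1/2}h_{0,L}\,\mu^{1/2}$ with $\mu=\operatorname{diag}(1/(2m_x))$. Let $\Omega_L$ be the normalized ground state of $H_L$ (unique up to a phase), let $\langle A\rangle=\langle\Omega_L,A\,\Omega_L\rangle$ and $\tau_t(A)=e^{itH_L}Ae^{-itH_L}$ for bounded operators $A$, and for $f:\Lambda_L\to\mathbb{C}$ let $W(f)=\exp\big[i\sum_{x}(\operatorname{Re}f(x)\,q_x+\operatorname{Im}f(x)\,p_x)\big]$ be the Weyl operator. For $f,g:\Lambda_L\to\mathbb{C}$ and $t\in\mathbb{R}$ put $$C(f,g;t)=\langle\tau_t(W(f))\,W(g)\rangle-\langle W(f)\rangle\langle W(g)\rangle .$$ Let $r\in(0,1]$ and suppose that $h_L$ has exponentially decaying $(-\frac12,r)$-eigenfunction correlators, i.e. there are $C<\infty$ and $\nu>0$ such that $$\mathbb{E}\Big(\sup_{|u|\le1}\big|\langle\delta_x,h_L^{-1/2}u(h_L)\delta_y\rangle\big|^r\Big)\le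 C\,e^{-\nu|x-y|}$$ for all $L\ge1$ and $x,y\in\Lambda_L$, the supremum being over all functions $u:\mathbb{R}\to\mathbb{C}$ with $|u|\le1$ pointwise. Then there exist $C'<\infty$ and $\mu'>0$ such that $$\mathbb{E}\Big(\sup_{t\in\mathbb{R}}|C(f,g;t)|\Big)\le C'\sum_{x,y\in\Lambda_L}|f(x)|^r\,|g(y)|^r\,e^{-\mu'|x-y|}$$ for all $L\ge1$ and all $f,g:\Lambda_L\to\mathbb{C}$. -/

import Mathlib

open MeasureTheory
open scoped SchwartzMap ENNReal

noncomputable section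

namespace Oscillator

/-! ### Self-adjoint operators in a Hilbert space: unitary groups and ground states -/

section Abstract

variable {E : Type*} [NormedAddCommGroup E] [InnerProductSpace ℂ E] [CompleteSpace E]

/-- `U` is the strongly continuous one-parameter unitary group `t ↦ e^{itA}`: its infinitesimal
generator is exactly `iA`, i.e. `t ↦ U t ψ` is differentiable at `0` if and only if `ψ ∈ D(A)`, and
then its derivative is `i A ψ`. By Stone's theorem a self-adjoint `A` has exactly one such group. -/
structure IsUnitaryGroupOf (A : E →ₗ.[ℂ] E) (U : ℝ → E →L[ℂ] E) : Prop where
  unitary : ∀ t, U t ∈ unitary (E →L[ℂ] E)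
  add : ∀ s t, U (s + t) = U s * U t
  continuous : ∀ ψ, Continuous fun t => U t ψ
  generator : ∀ ψ φ : E, HasDerivAt (fun t => U t ψ) (Complex.I • φ) 0 ↔
    ∃ hψ : ψ ∈ A.domain, A ⟨ψ, hψ⟩ = φ

open Classical in
/-- The unitary operators `e^{itA}`, `t ∈ ℝ`, of a self-adjoint operator `A`
(the identity for an operator that does not generate a unitary group). -/
def expI (A : E →ₗ.[ℂ] E) : ℝ → E →L[ℂ] E :=
  if h : ∃ U, IsUnitaryGroupOf A U then h.choose else fun _ => 1

/-- `Φ` is a normalized ground state of `A`: a unit eigenvector whose eigenvalue `e` is the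
minimal energy, `e ‖ψ‖² ≤ ⟨ψ, A ψ⟩` for all `ψ ∈ D(A)`. -/
def IsGroundState (A : E →ₗ.[ℂ] E) (Φ : E) : Prop :=
  ‖Φ‖ = 1 ∧ ∃ e : ℝ, (∃ hΦ : Φ ∈ A.domain, A ⟨Φ, hΦ⟩ = (e : ℂ) • Φ) ∧
    ∀ ψ : A.domain, e * ‖(ψ : E)‖ ^ 2 ≤ (inner ℂ (ψ : E) (A ψ)).re

open Classical in
/-- The normalized ground state of `A`, a choice of phase being made
(zero if there is no ground state). -/
def groundState (A : E →ₗ.[ℂ] E) : E :=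
  if h : ∃ Φ, IsGroundState A Φ then h.choose else 0

/-- The Heisenberg dynamics `τ_t(B) = e^{itA} B e^{-itA}`. -/
def heisenberg (A : E →ₗ.[ℂ] E) (t : ℝ) (B : E →L[ℂ] E) : E →L[ℂ] E :=
  expI A t * B * expI A (-t)

/-- The ground state expectation `⟨B⟩ = ⟨Φ, B Φ⟩`. -/
def groundExpectation (A : E →ₗ.[ℂ] E) (B : E →L[ℂ] E) : ℂ :=
  inner ℂ (groundState A) (B (groundState A))

end Abstract

/-! ### Positions and momenta on `L²(ℝ^Λ)` -/

section Schrodinger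

variable {Λ : Type*} [Fintype Λ]

/-- The Hilbert space `L²(ℝ^Λ, dq)`. -/
abbrev HilbertL2 (Λ : Type*) [Fintype Λ] : Type _ :=
  Lp ℂ 2 (volume : Measure (EuclideanSpace ℝ Λ))

/-- Operators on the Schwartz space of `ℝ^Λ`. -/
abbrev SchwartzOp (Λ : Type*) [Fintype Λ] : Type _ :=
  𝓢(EuclideanSpace ℝ Λ, ℂ) →L[ℂ] 𝓢(EuclideanSpace ℝ Λ, ℂ)

/-- The position operator `q_x`: multiplication by the coordinate `q_x`. -/
def position (x : Λ) : SchwartzOp Λ :=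
  SchwartzMap.smulLeftCLM ℂ fun q : EuclideanSpace ℝ Λ => ((q x : ℝ) : ℂ)

theorem position_apply (x : Λ) (ψ : 𝓢(EuclideanSpace ℝ Λ, ℂ)) (q : EuclideanSpace ℝ Λ) :
    position x ψ q = ((q x : ℝ) : ℂ) * ψ q := by
  have h : (fun q : EuclideanSpace ℝ Λ => ((q x : ℝ) : ℂ)).HasTemperateGrowth :=
    (Complex.ofRealCLM ∘L EuclideanSpace.proj (𝕜 := ℝ) x).hasTemperateGrowth
  simp [position, h]

/-- The momentum operator `p_x = -i ∂/∂q_x`. -/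
def momentum [DecidableEq Λ] (x : Λ) : SchwartzOp Λ :=
  (-Complex.I) • LineDeriv.lineDerivOpCLM ℂ 𝓢(EuclideanSpace ℝ Λ, ℂ)
    (EuclideanSpace.single x (1 : ℝ))

/-- The inclusion of the Schwartz space into `L²(ℝ^Λ)`. -/
def schwartzToL2 (Λ : Type*) [Fintype Λ] : 𝓢(EuclideanSpace ℝ Λ, ℂ) →ₗ[ℂ] HilbertL2 Λ :=
  (SchwartzMap.toLpCLM ℂ ℂ 2 (volume : Measure (EuclideanSpace ℝ Λ))).toLinearMap

theorem schwartzToL2_injective : Function.Injective (schwartzToL2 Λ) :=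
  SchwartzMap.injective_toLp 2 volume

/-- The operator in `L²(ℝ^Λ)` with domain the Schwartz space given by `T`. -/
def onSchwartz (T : SchwartzOp Λ) : HilbertL2 Λ →ₗ.[ℂ] HilbertL2 Λ where
  domain := LinearMap.range (schwartzToL2 Λ)
  toFun := schwartzToL2 Λ ∘ₗ T.toLinearMap ∘ₗ
    (LinearEquiv.ofInjective (schwartzToL2 Λ) schwartzToL2_injective).symm.toLinearMap

/-- The closure in `L²(ℝ^Λ)` of the operator `T` on the Schwartz space. -/
def closedOp (T : SchwartzOp Λ) : HilbertL2 Λ →ₗ.[ℂ] HilbertL2 Λ :=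
  (onSchwartz T).closure

/-- The Weyl operator `W(f) = exp[i ∑_x (Re f(x) q_x + Im f(x) p_x)]`. -/
def weyl [DecidableEq Λ] (f : Λ → ℂ) : HilbertL2 Λ →L[ℂ] HilbertL2 Λ :=
  expI (closedOp (∑ x, (((f x).re : ℂ) • position x + ((f x).im : ℂ) • momentum x))) 1

end Schrodinger

/-! ### The oscillator model -/

/-- The `1`-norm distance `|x - y|` on `ℤ^d`. -/
def dist1 {d : ℕ} (x y : Fin d → ℤ) : ℤ := ∑ i, |x i - y i|

/-- The cube `Λ_L = [-L, L]^d ∩ ℤ^d`. -/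
abbrev Box (d L : ℕ) : Type :=
  ↥(Finset.Icc (fun _ : Fin d => -(L : ℤ)) (fun _ => (L : ℤ)))

/-- Masses `m_x`, spring constants `k_x` and couplings `λ_{x,y}`, the latter indexed by unordered
pairs; only those of nearest neighbours are ever used. -/
structure Params (d : ℕ) where
  mass : (Fin d → ℤ) → ℝ
  spring : (Fin d → ℤ) → ℝ
  coupling : Sym2 (Fin d → ℤ) → ℝ

namespace Params

variable {d : ℕ} (p : Params d) (L : ℕ)

/-- The bounds on masses, spring constants and nearest neighbour couplings. -/
structure Bounded (mmin mmax kmax lmax : ℝ) : Prop where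
  mass : ∀ x, mmin ≤ p.mass x ∧ p.mass x ≤ mmax
  spring : ∀ x, 0 ≤ p.spring x ∧ p.spring x ≤ kmax
  coupling : ∀ x y, dist1 x y = 1 → 0 ≤ p.coupling s(x, y) ∧ p.coupling s(x, y) ≤ lmax

/-- The harmonic Hamiltonian on Schwartz functions; each undirected edge occurs
twice in the double sum, whence the factor `1/2`. -/
def hamiltonianSchwartz : SchwartzOp (Box d L) :=
  ∑ x : Box d L, (((1 / (2 * p.mass x) : ℝ) : ℂ) • momentum x ^ 2 +
      ((p.spring x / 2 : ℝ) : ℂ) • position x ^ 2) +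
    (1 / 2 : ℂ) • ∑ x : Box d L, ∑ y : Box d L,
      if dist1 (x : Fin d → ℤ) y = 1 then
        ((p.coupling s((x : Fin d → ℤ), (y : Fin d → ℤ)) : ℝ) : ℂ) • (position x - position y) ^ 2
      else 0

/-- The self-adjoint harmonic Hamiltonian `H_L`. -/
def hamiltonian : HilbertL2 (Box d L) →ₗ.[ℂ] HilbertL2 (Box d L) :=
  closedOp (p.hamiltonianSchwartz L)

/-- The matrix `h_{0,L}` of the potential energy. -/
def h0 : Matrix (Box d L) (Box d L) ℝ := Matrix.of fun x y =>
  if x = y then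
    p.spring x / 2 + ∑ u : Box d L,
      if dist1 (x : Fin d → ℤ) u = 1 then p.coupling s((x : Fin d → ℤ), (u : Fin d → ℤ)) else 0
  else if dist1 (x : Fin d → ℤ) y = 1 then -p.coupling s((x : Fin d → ℤ), (y : Fin d → ℤ))
  else 0

/-- The diagonal matrix `μ^{1/2}`, where `μ = diag(1/(2 m_x))`. -/
def sqrtMu : Matrix (Box d L) (Box d L) ℝ :=
  Matrix.diagonal fun x => Real.sqrt (1 / (2 * p.mass x))

/-- The effective one-particle Hamiltonian `h_L = μ^{1/2} h_{0,L} μ^{1/2}`. -/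
def h : Matrix (Box d L) (Box d L) ℝ := p.sqrtMu L * p.h0 L * p.sqrtMu L

theorem h0_isHermitian : (p.h0 L).IsHermitian := by
  refine Matrix.IsHermitian.ext fun x y => ?_
  have hd : dist1 (y : Fin d → ℤ) x = dist1 (x : Fin d → ℤ) y := by
    simp [dist1, abs_sub_comm]
  by_cases hxy : x = y
  · subst hxy; rfl
  · simp [h0, hxy, Ne.symm hxy, hd, Sym2.eq_swap]

theorem h_isHermitian : (p.h L).IsHermitian := by
  have hs : (p.sqrtMu L).conjTranspose = p.sqrtMu L := by
    simp [sqrtMu]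
  have := Matrix.isHermitian_conjTranspose_mul_mul (p.sqrtMu L) (p.h0_isHermitian L)
  rwa [hs] at this

end Params

/-- The functional calculus `φ(A)` of a real symmetric matrix, by eigenfunction expansion:
`⟨δ_x, φ(A) δ_y⟩ = ∑_k φ(λ_k) v_k(x) v_k(y)` with an orthonormal basis of real eigenvectors `v_k`. -/
def matrixFun {n : Type*} [Fintype n] [DecidableEq n] {A : Matrix n n ℝ} (hA : A.IsHermitian)
    (φ : ℝ → ℂ) : Matrix n n ℂ := Matrix.of fun x y =>
  ∑ k, φ (hA.eigenvalues k) * ((hA.eigenvectorBasis k x : ℝ) : ℂ) *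
    ((hA.eigenvectorBasis k y : ℝ) : ℂ)

/-- `sup_{|u| ≤ 1} |⟨δ_x, h_L^α u(h_L) δ_y⟩|^r`, over all functions `u : ℝ → ℂ` bounded by `1`. -/
def correlator {d : ℕ} (p : Params d) (L : ℕ) (α r : ℝ) (x y : Box d L) : ℝ≥0∞ :=
  ⨆ (u : ℝ → ℂ) (_ : ∀ s, ‖u s‖ ≤ 1),
    ENNReal.ofReal
      (‖matrixFun (p.h_isHermitian L) (fun s => ((s ^ α : ℝ) : ℂ) * u s) x y‖ ^ r)

/-- `h_L` has exponentially decaying `(α, r)`-eigenfunction correlators. -/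
def HasDecayingCorrelators {d : ℕ} {Ω : Type*} [MeasurableSpace Ω] (P : Measure Ω)
    (p : Ω → Params d) (α r : ℝ) : Prop :=
  ∃ C μ : ℝ, 0 ≤ C ∧ 0 < μ ∧ ∀ L : ℕ, 1 ≤ L → ∀ x y : Box d L,
    ∫⁻ ω, correlator (p ω) L α r x y ∂P ≤
      ENNReal.ofReal (C * Real.exp (-μ * (dist1 (x : Fin d → ℤ) y : ℝ)))

/-- The dynamic ground state correlation
`C(f,g;t) = ⟨τ_t(W(f)) W(g)⟩ - ⟨W(f)⟩ ⟨W(g)⟩` of Weyl operators. -/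
def weylCorrelation {d : ℕ} (p : Params d) (L : ℕ) (f g : Box d L → ℂ) (t : ℝ) : ℂ :=
  groundExpectation (p.hamiltonian L) (heisenberg (p.hamiltonian L) t (weyl f) * weyl g) -
    groundExpectation (p.hamiltonian L) (weyl f) * groundExpectation (p.hamiltonian L) (weyl g)

end Oscillator

end

open MeasureTheory
open scoped SchwartzMap ENNReal

noncomputable section

/-! In normal coordinates the Hamiltonian is a sum of uncoupled oscillators `Pₖ² + ωₖ² Qₖ²`, where
the `ωₖ²` are the eigenvalues of `h_L`. Its ground state is Gaussian and its dynamics rotates phase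
space, so Weyl operators evolve into Weyl operators. This gives the exact formula `C(f,g;t) =
⟨W(f)⟩⟨W(g)⟩ (exp(-c(t)) - 1)`, where `c(t)` is real-bilinear in `f` and `g`. Both exponentials that
are subtracted have exponents with nonpositive real part, so `|C| ≤ min(2, |c(t)|) ≤ 2 |c(t)|^r`.

In position space `c(t)` is a double sum over sites of coefficients of size at most a constant times
`|f(x)||g(y)|`, multiplied by kernels of `h_L^α e^{-2it√h_L}` with `α = -1/2, 0, 1/2`. The spectrum
of `h_L` lies in `(0, M]` with `M` independent of `L` and of the disorder. Each such kernel is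
therefore `M` times a kernel of `h_L^{-1/2} u(h_L)` with `|u| ≤ 1`, uniformly in `t`, and its `r`-th
moment is covered by the hypothesis. Subadditivity of `s ↦ s^r` for `r ≤ 1` takes the power inside
the sums.

The quantum part avoids explicit Gaussians and Stone's theorem. A ground state is known only as a
graph-norm limit of Schwartz functions `ψₙ`. Minimality of the energy makes the lowering operators
annihilate it asymptotically (`tendsto_lowerOp`), and a scalar differential equation then gives all
expectations of Weyl operators (`tendsto_inner_V`). Comparing `e^{itH}` with the classical flow on
`ψₙ` costs at most `|t| ‖(H - e)ψₙ‖`, which tends to `0` (`norm_apply_V_flow_sub_le`). Neither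
essential self-adjointness nor existence of a ground state has to be proved: where the definitions
fall back on default values, the bound holds as well (`norm_weylCorrelation_le`). -/

namespace Oscillator

/-! ### Abstract Weyl systems and derivatives of Weyl operators along curves in phase space. -/

section WeylSystems

variable {S E K : Type*} [AddCommGroup S] [Module ℂ S] [NormedAddCommGroup E]
  [InnerProductSpace ℂ E] [Fintype K]

/-- The field operator `∑ₖ (aₖ Qₖ + bₖ Pₖ)`. -/
def fieldOp (Q P : K → S →ₗ[ℂ] S) (a b : K → ℝ) : S →ₗ[ℂ] S :=
  ∑ k, ((a k : ℂ) • Q k + (b k : ℂ) • P k)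

theorem fieldOp_apply (Q P : K → S →ₗ[ℂ] S) (a b : K → ℝ) (ψ : S) :
    fieldOp Q P a b ψ = ∑ k, ((a k : ℂ) • Q k ψ + (b k : ℂ) • P k ψ) := by
  simp [fieldOp]

/-- The symplectic form on phase space. -/
def symp (a b a' b' : K → ℝ) : ℝ := ∑ k, (a k * b' k - b k * a' k)

theorem norm_fieldOp_le (ι : S →ₗ[ℂ] E) (Q P : K → S →ₗ[ℂ] S) (a b : K → ℝ) (ψ : S) :
    ‖ι (fieldOp Q P a b ψ)‖ ≤ ‖(a, b)‖ * ∑ k, (‖ι (Q k ψ)‖ + ‖ι (P k ψ)‖) := by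
  rw [fieldOp_apply, map_sum, Finset.mul_sum]
  refine (norm_sum_le _ _).trans (Finset.sum_le_sum fun k _ => ?_)
  rw [map_add, map_smul, map_smul, mul_add]
  refine (norm_add_le _ _).trans (add_le_add ?_ ?_) <;> rw [norm_smul, Complex.norm_real]
  · exact mul_le_mul_of_nonneg_right ((norm_le_pi_norm a k).trans (norm_fst_le (a, b)))
      (norm_nonneg _)
  · exact mul_le_mul_of_nonneg_right ((norm_le_pi_norm b k).trans (norm_snd_le (a, b)))
      (norm_nonneg _)

/-- Applying the field twice is quadratic in its coefficients. For fixed `ψ` this controls the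
second-order Taylor remainder uniformly in the direction. -/
theorem exists_norm_fieldOp_sq_le (ι : S →ₗ[ℂ] E) (Q P : K → S →ₗ[ℂ] S) (ψ : S) :
    ∃ C, ∀ a b : K → ℝ, ‖ι (fieldOp Q P a b (fieldOp Q P a b ψ))‖ ≤ C * ‖(a, b)‖ ^ 2 := by
  refine ⟨∑ k, (∑ j, (‖ι (Q j (Q k ψ))‖ + ‖ι (P j (Q k ψ))‖) +
    ∑ j, (‖ι (Q j (P k ψ))‖ + ‖ι (P j (P k ψ))‖)), fun a b => ?_⟩
  conv_lhs => rw [fieldOp_apply _ _ _ _ ψ, map_sum, map_sum]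
  rw [Finset.sum_mul]
  refine (norm_sum_le _ _).trans (Finset.sum_le_sum fun k _ => ?_)
  rw [map_add, map_add, map_smul, map_smul, map_smul, map_smul, add_mul]
  refine (norm_add_le _ _).trans (add_le_add ?_ ?_) <;>
    rw [norm_smul, Complex.norm_real, mul_comm _ (‖(a, b)‖ ^ 2), pow_two, mul_assoc]
  · exact mul_le_mul ((norm_le_pi_norm a k).trans (norm_fst_le (a, b))) (norm_fieldOp_le ι Q P a b _)
      (norm_nonneg _) (norm_nonneg _)
  · exact mul_le_mul ((norm_le_pi_norm b k).trans (norm_snd_le (a, b))) (norm_fieldOp_le ι Q P a b _)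
      (norm_nonneg _) (norm_nonneg _)

/-- Canonical pairs `Qₖ, Pₖ` on a space `S` embedded in a Hilbert space by `ι`, together with
their Weyl operators `V a b = exp[i ∑ₖ (aₖ Qₖ + bₖ Pₖ)]`. -/
structure WeylSystem [DecidableEq K] (ι : S →ₗ[ℂ] E) (Q P : K → S →ₗ[ℂ] S)
    (V : (K → ℝ) → (K → ℝ) → S →ₗ[ℂ] S) : Prop where
  Q_symm : ∀ k ψ χ, inner ℂ (ι (Q k ψ)) (ι χ) = inner ℂ (ι ψ) (ι (Q k χ))
  P_symm : ∀ k ψ χ, inner ℂ (ι (P k ψ)) (ι χ) = inner ℂ (ι ψ) (ι (P k χ))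
  comm_QQ : ∀ j k ψ, Q j (Q k ψ) = Q k (Q j ψ)
  comm_PP : ∀ j k ψ, P j (P k ψ) = P k (P j ψ)
  comm_QP : ∀ j k ψ, Q j (P k ψ) = P k (Q j ψ) + (if j = k then Complex.I else 0) • ψ
  norm_V : ∀ a b ψ, ‖ι (V a b ψ)‖ = ‖ι ψ‖
  V_mul : ∀ a b a' b' ψ, V a b (V a' b' ψ) =
    Complex.exp (-(Complex.I / 2) * (symp a b a' b' : ℝ)) • V (a + a') (b + b') ψ
  V_zero : ∀ ψ, V 0 0 ψ = ψ
  Q_V : ∀ k a b ψ, Q k (V a b ψ) = V a b (Q k ψ - (b k : ℂ) • ψ)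
  P_V : ∀ k a b ψ, P k (V a b ψ) = V a b (P k ψ + (a k : ℂ) • ψ)
  hasDerivAt_V : ∀ a b ψ, HasDerivAt (fun s : ℝ => ι (V (s • a) (s • b) ψ))
    (Complex.I • ι (fieldOp Q P a b ψ)) 0

namespace WeylSystem

variable [DecidableEq K] {ι : S →ₗ[ℂ] E} {Q P : K → S →ₗ[ℂ] S}
  {V : (K → ℝ) → (K → ℝ) → S →ₗ[ℂ] S}

theorem V_neg_V (h : WeylSystem ι Q P V) (a b : K → ℝ) (ψ : S) :
    V (-a) (-b) (V a b ψ) = ψ := by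
  rw [h.V_mul]
  simp [symp, h.V_zero, mul_comm]

theorem V_Q (h : WeylSystem ι Q P V) (k : K) (a b : K → ℝ) (ψ : S) :
    V a b (Q k ψ) = Q k (V a b ψ) + (b k : ℂ) • V a b ψ := by
  rw [h.Q_V]; simp

theorem V_P (h : WeylSystem ι Q P V) (k : K) (a b : K → ℝ) (ψ : S) :
    V a b (P k ψ) = P k (V a b ψ) - (a k : ℂ) • V a b ψ := by
  rw [h.P_V]; simp

/-- The Weyl operator shifts each `Qₖ` by a multiple of `bₖ` and each `Pₖ` by the same multiple of
`-aₖ`; in the field with coefficients `a, b` the shifts cancel. -/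
theorem fieldOp_V_smul (h : WeylSystem ι Q P V) (a b : K → ℝ) (ψ : S) (s : ℝ) :
    fieldOp Q P a b (V (s • a) (s • b) ψ) = V (s • a) (s • b) (fieldOp Q P a b ψ) := by
  simp only [fieldOp_apply, map_sum]
  refine Finset.sum_congr rfl fun k _ => ?_
  rw [h.Q_V, h.P_V]
  simp only [map_add, map_sub, map_smul, smul_add, smul_sub, Pi.smul_apply, smul_eq_mul,
    Complex.ofReal_mul]
  module

/-- The derivative of the one-parameter group `s ↦ V(s a, s b)` at any time. -/
theorem hasDerivAt_V_smul (h : WeylSystem ι Q P V) (a b : K → ℝ) (ψ : S) (s : ℝ) :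
    HasDerivAt (fun s : ℝ => ι (V (s • a) (s • b) ψ))
      (Complex.I • ι (V (s • a) (s • b) (fieldOp Q P a b ψ))) s := by
  have hmul : ∀ s' : ℝ, V (s' • a) (s' • b) ψ =
      V ((s' - s) • a) ((s' - s) • b) (V (s • a) (s • b) ψ) := by
    intro s'
    rw [h.V_mul, ← add_smul, ← add_smul, sub_add_cancel]
    have : symp ((s' - s) • a) ((s' - s) • b) (s • a) (s • b) = 0 := by
      simp only [symp, Pi.smul_apply, smul_eq_mul]
      exact Finset.sum_eq_zero fun k _ => by ring
    simp [this]
  have h0 := h.hasDerivAt_V a b (V (s • a) (s • b) ψ)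
  rw [h.fieldOp_V_smul] at h0
  have h0' : HasDerivAt (fun r : ℝ => ι (V (r • a) (r • b) (V (s • a) (s • b) ψ)))
      (Complex.I • ι (V (s • a) (s • b) (fieldOp Q P a b ψ))) (s - s) := by rwa [sub_self]
  have h1 := h0'.comp_sub_const s s
  simp only [← hmul] at h1
  exact h1

theorem norm_V_sub_le (h : WeylSystem ι Q P V) (a b : K → ℝ) (ψ : S) {s : ℝ}
    (hs : s ∈ Set.Icc (0 : ℝ) 1) :
    ‖ι (V (s • a) (s • b) ψ) - ι ψ‖ ≤ ‖ι (fieldOp Q P a b ψ)‖ := by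
  have := (convex_Icc (0 : ℝ) 1).norm_image_sub_le_of_norm_hasDerivWithin_le
    (f := fun s : ℝ => ι (V (s • a) (s • b) ψ)) (C := ‖ι (fieldOp Q P a b ψ)‖)
    (fun r _ => (h.hasDerivAt_V_smul a b ψ r).hasDerivWithinAt)
    (fun r _ => by rw [norm_smul, h.norm_V]; simp) (Set.left_mem_Icc.2 zero_le_one) hs
  simp only [zero_smul, h.V_zero, sub_zero] at this
  refine this.trans ?_
  rw [Real.norm_of_nonneg hs.1]
  exact mul_le_of_le_one_right (norm_nonneg _) hs.2

/-- Second-order Taylor estimate by two uses of the mean value inequality. The axioms give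
derivatives along lines only; this uniform remainder is what allows curves. -/
theorem norm_V_sub_sub_le (h : WeylSystem ι Q P V) (a b : K → ℝ) (ψ : S) :
    ‖ι (V a b ψ) - ι ψ - Complex.I • ι (fieldOp Q P a b ψ)‖ ≤
      ‖ι (fieldOp Q P a b (fieldOp Q P a b ψ))‖ := by
  have hd : ∀ r : ℝ, HasDerivAt
      (fun s : ℝ => ι (V (s • a) (s • b) ψ) - (s : ℂ) • (Complex.I • ι (fieldOp Q P a b ψ)))
      (Complex.I • ι (V (r • a) (r • b) (fieldOp Q P a b ψ)) -
        Complex.I • ι (fieldOp Q P a b ψ)) r := by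
    intro r
    refine (h.hasDerivAt_V_smul a b ψ r).sub ?_
    simpa using (Complex.ofRealCLM.hasDerivAt (x := r)).smul_const
      (Complex.I • ι (fieldOp Q P a b ψ))
  have := (convex_Icc (0 : ℝ) 1).norm_image_sub_le_of_norm_hasDerivWithin_le
    (C := ‖ι (fieldOp Q P a b (fieldOp Q P a b ψ))‖)
    (fun r _ => (hd r).hasDerivWithinAt)
    (fun r hr => by
      rw [← smul_sub, norm_smul, Complex.norm_I, one_mul]
      exact h.norm_V_sub_le a b _ hr) (Set.left_mem_Icc.2 zero_le_one)
      (Set.right_mem_Icc.2 zero_le_one)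
  simp only [zero_smul, one_smul, h.V_zero, sub_zero, norm_one, mul_one, Complex.ofReal_zero,
    Complex.ofReal_one] at this
  rwa [sub_right_comm] at this

/-- The derivative at the origin of phase space of the Weyl operators along a curve. -/
theorem hasDerivAt_V_curve_zero (h : WeylSystem ι Q P V) {a b : ℝ → K → ℝ} {a' b' : K → ℝ} {t : ℝ}
    (ha : HasDerivAt a a' t) (hb : HasDerivAt b b' t) (ha0 : a t = 0) (hb0 : b t = 0) (ψ : S) :
    HasDerivAt (fun s => ι (V (a s) (b s) ψ)) (Complex.I • ι (fieldOp Q P a' b' ψ)) t := by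
  obtain ⟨C, hC⟩ := exists_norm_fieldOp_sq_le ι Q P ψ
  have hlin : HasDerivAt (fun s => Complex.I • ι (fieldOp Q P (a s) (b s) ψ))
      (Complex.I • ι (fieldOp Q P a' b' ψ)) t := by
    refine HasDerivAt.const_smul _ ?_
    simp only [fieldOp_apply, map_sum, map_add, map_smul]
    refine HasDerivAt.fun_sum fun k _ => HasDerivAt.add ?_ ?_
    · exact ((hasDerivAt_pi.1 ha k).ofReal_comp).smul_const _
    · exact ((hasDerivAt_pi.1 hb k).ofReal_comp).smul_const _
  have hrem : HasDerivAt (fun s => ι (V (a s) (b s) ψ) - ι ψ -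
      Complex.I • ι (fieldOp Q P (a s) (b s) ψ)) 0 t := by
    rw [hasDerivAt_iff_isLittleO]
    have hab := (ha.prodMk hb).isBigO_sub
    have hab0 : (a t, b t) = 0 := by simp [ha0, hb0]
    simp only [hab0, sub_zero] at hab
    have h0 : fieldOp Q P (0 : K → ℝ) 0 ψ = 0 := by simp [fieldOp_apply]
    simp only [ha0, hb0, h.V_zero, h0, map_zero, smul_zero, sub_zero, sub_self]
    have h2 : (fun s => ‖(a s, b s)‖ ^ 2) =o[nhds t] fun s => s - t := by
      have hsq : (fun s => ‖(a s, b s)‖ ^ 2) =O[nhds t] fun s => (s - t) ^ 2 := hab.norm_left.pow 2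
      refine hsq.trans_isLittleO ?_
      have := (Asymptotics.isLittleO_pow_id (𝕜 := ℝ) one_lt_two)
      refine this.comp_tendsto (k := fun s : ℝ => s - t) (l' := nhds t) ?_
      have : Filter.Tendsto (fun s : ℝ => s - t) (nhds t) (nhds (t - t)) :=
        (continuous_id.sub continuous_const).tendsto t
      rwa [sub_self] at this
    refine Asymptotics.IsBigO.trans_isLittleO ?_ h2
    refine Asymptotics.IsBigO.of_bound C (Filter.Eventually.of_forall fun s => ?_)
    rw [norm_pow, norm_norm]
    exact (h.norm_V_sub_sub_le (a s) (b s) ψ).trans (hC _ _)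
  have := (hrem.add hlin).add_const (ι ψ)
  rw [zero_add] at this
  convert this using 1
  funext s
  simp

/-- The derivative of the Weyl operators along a curve in phase space. -/
theorem hasDerivAt_V_curve (h : WeylSystem ι Q P V) {a b : ℝ → K → ℝ} {a' b' : K → ℝ} {t : ℝ}
    (ha : HasDerivAt a a' t) (hb : HasDerivAt b b' t) (ψ : S) :
    HasDerivAt (fun s => ι (V (a s) (b s) ψ))
      (Complex.I • ι (fieldOp Q P a' b' (V (a t) (b t) ψ)) +
        (Complex.I / 2 * (symp a' b' (a t) (b t) : ℝ)) • ι (V (a t) (b t) ψ)) t := by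
  -- Translating back by the point at time `t` reduces to a curve through the origin. The Weyl
  -- relation contributes a phase, whose derivative is the symplectic term.
  have hmul : ∀ s, ι (V (a s) (b s) ψ) =
      Complex.exp (Complex.I / 2 * (symp (a s - a t) (b s - b t) (a t) (b t) : ℝ)) •
        ι (V (a s - a t) (b s - b t) (V (a t) (b t) ψ)) := by
    intro s
    rw [h.V_mul, sub_add_cancel, sub_add_cancel, map_smul, smul_smul, ← Complex.exp_add]
    simp
  have hσ : HasDerivAt (fun s => symp (a s - a t) (b s - b t) (a t) (b t))
      (symp a' b' (a t) (b t)) t := by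
    unfold symp
    refine HasDerivAt.fun_sum fun k _ => ?_
    exact (((hasDerivAt_pi.1 ha k).sub_const _).mul_const _).sub
      (((hasDerivAt_pi.1 hb k).sub_const _).mul_const _)
  have hV := h.hasDerivAt_V_curve_zero (ha.sub_const (a t)) (hb.sub_const (b t)) (sub_self _)
    (sub_self _) (V (a t) (b t) ψ)
  have he := ((hσ.ofReal_comp.const_mul (Complex.I / 2)).cexp).smul hV
  have h00 : symp (0 : K → ℝ) 0 (a t) (b t) = 0 := by simp [symp]
  simp only [sub_self, h.V_zero, h00, Complex.ofReal_zero, mul_zero, Complex.exp_zero, one_mul,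
    one_smul] at he
  convert he using 1
  funext s
  exact hmul s

end WeylSystem

end WeylSystems

/-! ### Ladder operators and the asymptotic annihilation of ground states. -/

section Ladder

variable {S E K : Type*} [AddCommGroup S] [Module ℂ S] [NormedAddCommGroup E]
  [InnerProductSpace ℂ E]

/-- The energy `∑ₖ (Pₖ² + ωₖ² Qₖ²)` of uncoupled oscillators. -/
def modeEnergy [Fintype K] (Q P : K → S →ₗ[ℂ] S) (ω : K → ℝ) : S →ₗ[ℂ] S :=
  ∑ k, (P k ∘ₗ P k + ((ω k : ℂ) ^ 2) • (Q k ∘ₗ Q k))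

theorem modeEnergy_apply [Fintype K] (Q P : K → S →ₗ[ℂ] S) (ω : K → ℝ) (ψ : S) :
    modeEnergy Q P ω ψ = ∑ k, (P k (P k ψ) + ((ω k : ℂ) ^ 2) • Q k (Q k ψ)) := by
  simp [modeEnergy]

/-- The (unnormalized) annihilation operator `ωₖ Qₖ + i Pₖ`. -/
def lowerOp (Q P : K → S →ₗ[ℂ] S) (ω : K → ℝ) (k : K) : S →ₗ[ℂ] S :=
  (ω k : ℂ) • Q k + Complex.I • P k

/-- The (unnormalized) creation operator `ωₖ Qₖ - i Pₖ`. -/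
def raiseOp (Q P : K → S →ₗ[ℂ] S) (ω : K → ℝ) (k : K) : S →ₗ[ℂ] S :=
  (ω k : ℂ) • Q k - Complex.I • P k

theorem lowerOp_apply (Q P : K → S →ₗ[ℂ] S) (ω : K → ℝ) (k : K) (ψ : S) :
    lowerOp Q P ω k ψ = (ω k : ℂ) • Q k ψ + Complex.I • P k ψ := rfl

theorem raiseOp_apply (Q P : K → S →ₗ[ℂ] S) (ω : K → ℝ) (k : K) (ψ : S) :
    raiseOp Q P ω k ψ = (ω k : ℂ) • Q k ψ - Complex.I • P k ψ := rfl

namespace WeylSystem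

variable [Fintype K] [DecidableEq K] {ι : S →ₗ[ℂ] E} {Q P : K → S →ₗ[ℂ] S}
  {V : (K → ℝ) → (K → ℝ) → S →ₗ[ℂ] S}

theorem inner_lowerOp (h : WeylSystem ι Q P V) (ω : K → ℝ) (k : K) (ψ χ : S) :
    inner ℂ (ι (lowerOp Q P ω k ψ)) (ι χ) = inner ℂ (ι ψ) (ι (raiseOp Q P ω k χ)) := by
  simp only [lowerOp_apply, raiseOp_apply, map_add, map_sub, map_smul, inner_add_left,
    inner_sub_right, inner_smul_left, inner_smul_right, h.Q_symm, h.P_symm, Complex.conj_I,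
    Complex.conj_ofReal]
  ring

theorem lowerOp_lowerOp (h : WeylSystem ι Q P V) (ω : K → ℝ) (j k : K) (ψ : S) :
    lowerOp Q P ω j (lowerOp Q P ω k ψ) = lowerOp Q P ω k (lowerOp Q P ω j ψ) := by
  simp only [lowerOp_apply, map_add, map_smul, h.comm_QP, h.comm_QQ j k, h.comm_PP j k]
  by_cases hjk : j = k
  · subst hjk; simp
  · simp only [if_neg hjk, if_neg (Ne.symm hjk), zero_smul, add_zero]
    module

theorem lowerOp_raiseOp (h : WeylSystem ι Q P V) (ω : K → ℝ) (j k : K) (ψ : S) :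
    lowerOp Q P ω j (raiseOp Q P ω k ψ) =
      raiseOp Q P ω k (lowerOp Q P ω j ψ) + (if j = k then (2 * ω k : ℂ) else 0) • ψ := by
  simp only [lowerOp_apply, raiseOp_apply, map_add, map_sub, map_smul, h.comm_QP,
    h.comm_QQ j k, h.comm_PP j k]
  by_cases hjk : j = k
  · subst hjk
    simp only [if_true]
    match_scalars <;>
      first | ring1 | linear_combination (- 2 * ω j : ℂ) * Complex.I_mul_I
  · simp only [if_neg hjk, if_neg (Ne.symm hjk), zero_smul, add_zero]
    module

theorem modeEnergy_eq (h : WeylSystem ι Q P V) (ω : K → ℝ) (ψ : S) :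
    modeEnergy Q P ω ψ =
      ∑ k, raiseOp Q P ω k (lowerOp Q P ω k ψ) + ((∑ k, ω k : ℝ) : ℂ) • ψ := by
  rw [modeEnergy_apply, Complex.ofReal_sum, Finset.sum_smul, ← Finset.sum_add_distrib]
  refine Finset.sum_congr rfl fun k _ => ?_
  simp only [lowerOp_apply, raiseOp_apply, map_add, map_smul, h.comm_QP, if_true]
  match_scalars
  · linear_combination Complex.I_mul_I
  · ring
  · ring
  · linear_combination (-ω k : ℂ) * Complex.I_mul_I

/-- The energy has no factor `1/2`, so a quantum of mode `k` costs `2 ωₖ`; the same doubling appears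
in the classical flow. -/
theorem modeEnergy_lowerOp (h : WeylSystem ι Q P V) (ω : K → ℝ) (k : K) (ψ : S) :
    modeEnergy Q P ω (lowerOp Q P ω k ψ) =
      lowerOp Q P ω k (modeEnergy Q P ω ψ) - (2 * ω k : ℂ) • lowerOp Q P ω k ψ := by
  rw [h.modeEnergy_eq, h.modeEnergy_eq, map_add, map_smul, map_sum]
  have : ∀ j, lowerOp Q P ω k (raiseOp Q P ω j (lowerOp Q P ω j ψ)) =
      raiseOp Q P ω j (lowerOp Q P ω j (lowerOp Q P ω k ψ)) +
        (if k = j then (2 * ω j : ℂ) else 0) • lowerOp Q P ω j ψ := by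
    intro j
    rw [h.lowerOp_raiseOp, h.lowerOp_lowerOp]
  simp only [this, Finset.sum_add_distrib, ite_smul, zero_smul, Finset.sum_ite_eq,
    Finset.mem_univ, if_true]
  abel

/-- The operators `aₖ* aₖ` are positive and commute. Hence for `j ≠ k` the inner product of `aₖ* aₖ
ψ` and `aⱼ* aⱼ ψ` is `‖aⱼ aₖ ψ‖² ≥ 0`, and the norm of a single term is at most that of the sum. -/
theorem norm_raiseOp_lowerOp_le (h : WeylSystem ι Q P V) (ω : K → ℝ) (k : K) (ψ : S) :
    ‖ι (raiseOp Q P ω k (lowerOp Q P ω k ψ))‖ ≤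
      ‖ι (modeEnergy Q P ω ψ) - ((∑ k, ω k : ℝ) : ℂ) • ι ψ‖ := by
  set w : K → E := fun j => ι (raiseOp Q P ω j (lowerOp Q P ω j ψ)) with hw
  have hsum : ι (modeEnergy Q P ω ψ) - ((∑ k, ω k : ℝ) : ℂ) • ι ψ = ∑ j, w j := by
    rw [h.modeEnergy_eq]; simp [hw]
  have hpos : ∀ j, j ≠ k → 0 ≤ (inner ℂ (w k) (w j)).re := by
    intro j hj
    have : inner ℂ (w k) (w j) = inner ℂ (ι (lowerOp Q P ω j (lowerOp Q P ω k ψ)))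
        (ι (lowerOp Q P ω j (lowerOp Q P ω k ψ))) := by
      rw [hw]
      simp only []
      rw [← h.inner_lowerOp, h.lowerOp_raiseOp, if_neg hj, zero_smul, add_zero,
        ← inner_conj_symm, ← h.inner_lowerOp, inner_conj_symm, h.lowerOp_lowerOp ω k j]
    rw [this]
    exact inner_self_nonneg (𝕜 := ℂ)
  have hle : ‖w k‖ ^ 2 ≤ ‖w k‖ * ‖∑ j, w j‖ := by
    calc ‖w k‖ ^ 2 = (inner ℂ (w k) (w k)).re := by
            rw [← inner_self_eq_norm_sq (𝕜 := ℂ)]; rfl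
      _ ≤ ∑ j, (inner ℂ (w k) (w j)).re :=
            Finset.single_le_sum (f := fun j => (inner ℂ (w k) (w j)).re) (fun j _ => by
              by_cases hj : j = k
              · subst hj; exact inner_self_nonneg (𝕜 := ℂ)
              · exact hpos j hj) (Finset.mem_univ k)
      _ = (inner ℂ (w k) (∑ j, w j)).re := by rw [inner_sum, Complex.re_sum]
      _ ≤ ‖w k‖ * ‖∑ j, w j‖ := (Complex.re_le_norm _).trans (norm_inner_le_norm _ _)
  rw [hsum]
  rcases (norm_nonneg (w k)).eq_or_lt with h0 | h0
  · show ‖w k‖ ≤ _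
    rw [← h0]; exact norm_nonneg _
  · exact le_of_mul_le_mul_left (by rwa [pow_two] at hle) h0

/-- If `e` is a lower bound of the energy, then almost eigenvectors for `e` are almost
annihilated by the lowering operators. -/
theorem norm_lowerOp_sq_le (h : WeylSystem ι Q P V) (ω : K → ℝ) {e : ℝ}
    (he : ∀ χ, e * ‖ι χ‖ ^ 2 ≤ (inner ℂ (ι χ) (ι (modeEnergy Q P ω χ))).re) (k : K) (ψ : S) :
    2 * ω k * ‖ι (lowerOp Q P ω k ψ)‖ ^ 2 ≤
      ‖ι (modeEnergy Q P ω ψ) - ((∑ k, ω k : ℝ) : ℂ) • ι ψ‖ *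
        ‖ι (modeEnergy Q P ω ψ) - (e : ℂ) • ι ψ‖ := by
  -- With `a` the lowering operator, energy `≥ e` on `aψ` and the commutator give `2ω‖aψ‖² ≤ Re ⟨aψ,
  -- a(H - e)ψ⟩ = Re ⟨a*aψ, (H - e)ψ⟩`. Cauchy–Schwarz and `norm_raiseOp_lowerOp_le` finish.
  have h1 := he (lowerOp Q P ω k ψ)
  rw [h.modeEnergy_lowerOp, map_sub, map_smul, inner_sub_right, inner_smul_right,
    inner_self_eq_norm_sq_to_K] at h1
  have h2 : (e : ℂ) * ((‖ι (lowerOp Q P ω k ψ)‖ : ℂ)) ^ 2 =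
      inner ℂ (ι (lowerOp Q P ω k ψ)) (ι (lowerOp Q P ω k ((e : ℂ) • ψ))) := by
    rw [map_smul, map_smul, inner_smul_right, inner_self_eq_norm_sq_to_K]; rfl
  have h3 : (inner ℂ (ι (lowerOp Q P ω k ψ))
      (ι (lowerOp Q P ω k (modeEnergy Q P ω ψ - (e : ℂ) • ψ)))).re ≤
      ‖ι (raiseOp Q P ω k (lowerOp Q P ω k ψ))‖ * ‖ι (modeEnergy Q P ω ψ) - (e : ℂ) • ι ψ‖ := by
    rw [← inner_conj_symm, h.inner_lowerOp, inner_conj_symm, ← map_smul ι, ← map_sub ι]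
    exact (Complex.re_le_norm _).trans (norm_inner_le_norm _ _)
  rw [map_sub, map_sub, inner_sub_right, ← h2] at h3
  have h4 : ((e : ℂ) * ((‖ι (lowerOp Q P ω k ψ)‖ : ℂ)) ^ 2).re =
      e * ‖ι (lowerOp Q P ω k ψ)‖ ^ 2 := by
    rw [← Complex.ofReal_pow, ← Complex.ofReal_mul, Complex.ofReal_re]
  have h5 : ((2 * ω k : ℂ) * ((‖ι (lowerOp Q P ω k ψ)‖ : ℂ)) ^ 2).re =
      2 * ω k * ‖ι (lowerOp Q P ω k ψ)‖ ^ 2 := by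
    rw [← Complex.ofReal_pow, ← Complex.ofReal_ofNat, ← Complex.ofReal_mul, ← Complex.ofReal_mul,
      Complex.ofReal_re]
  have h6 := mul_le_mul_of_nonneg_right (h.norm_raiseOp_lowerOp_le ω k ψ)
    (norm_nonneg (ι (modeEnergy Q P ω ψ) - (e : ℂ) • ι ψ))
  rw [Complex.sub_re, h4] at h3
  rw [Complex.sub_re] at h1
  erw [h5] at h1
  linarith

/-- Approximating sequences of a ground state are asymptotically annihilated by the
lowering operators. -/
theorem tendsto_lowerOp (h : WeylSystem ι Q P V) {ω : K → ℝ} (hω : ∀ k, 0 < ω k) {e : ℝ}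
    (he : ∀ χ, e * ‖ι χ‖ ^ 2 ≤ (inner ℂ (ι χ) (ι (modeEnergy Q P ω χ))).re)
    {ψ : ℕ → S} {Φ : E} (hψ : Filter.Tendsto (fun n => ι (ψ n)) Filter.atTop (nhds Φ))
    (hHψ : Filter.Tendsto (fun n => ι (modeEnergy Q P ω (ψ n))) Filter.atTop
      (nhds ((e : ℂ) • Φ))) (k : K) :
    Filter.Tendsto (fun n => ‖ι (lowerOp Q P ω k (ψ n))‖) Filter.atTop (nhds 0) := by
  have h1 := (hHψ.sub (hψ.const_smul ((∑ k, ω k : ℝ) : ℂ))).norm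
  have h2 := (hHψ.sub (hψ.const_smul (e : ℂ))).norm
  have h3 := ((h1.mul h2).const_mul (2 * ω k)⁻¹).sqrt
  rw [sub_self, norm_zero, mul_zero, mul_zero, Real.sqrt_zero] at h3
  refine squeeze_zero (fun n => norm_nonneg _) (fun n => ?_) h3
  refine Real.le_sqrt_of_sq_le ?_
  have hk := hω k
  rw [← div_eq_inv_mul, le_div_iff₀ (by positivity)]
  have := h.norm_lowerOp_sq_le ω he k (ψ n)
  linarith

/-- The variance of the field operator in the ground state, as a quadratic form. -/
def groundVar (ω A B : K → ℝ) : ℝ := ∑ k, (A k ^ 2 / ω k + ω k * B k ^ 2) / 2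

end WeylSystem

end Ladder

/-! ### Gaussian expectations of Weyl operators in a ground state. -/

section GroundState

variable {S E K : Type*} [AddCommGroup S] [Module ℂ S] [NormedAddCommGroup E]
  [InnerProductSpace ℂ E] [Fintype K] [DecidableEq K] {ι : S →ₗ[ℂ] E} {Q P : K → S →ₗ[ℂ] S}
  {V : (K → ℝ) → (K → ℝ) → S →ₗ[ℂ] S}

namespace WeylSystem

/-- A Weyl operator applied to a field, with the creation part moved to the left. -/
theorem V_fieldOp (h : WeylSystem ι Q P V) {ω : K → ℝ} (hω : ∀ k, 0 < ω k) (A B : K → ℝ) (s : ℝ)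
    (ψ : S) :
    V (s • A) (s • B) (fieldOp Q P A B ψ) =
      ∑ k, ((A k / (2 * ω k) - Complex.I * B k / 2 : ℂ) •
          V (s • A) (s • B) (lowerOp Q P ω k ψ) +
        (A k / (2 * ω k) + Complex.I * B k / 2 : ℂ) •
          raiseOp Q P ω k (V (s • A) (s • B) ψ)) +
      (Complex.I * s * groundVar ω A B) • V (s • A) (s • B) ψ := by
  rw [fieldOp_apply, map_sum, groundVar, Complex.ofReal_sum, Finset.mul_sum, Finset.sum_smul,
    ← Finset.sum_add_distrib]
  refine Finset.sum_congr rfl fun k _ => ?_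
  have hk : (ω k : ℂ) ≠ 0 := Complex.ofReal_ne_zero.2 (hω k).ne'
  simp only [lowerOp_apply, raiseOp_apply, map_add, map_smul, h.V_Q, h.V_P, Pi.smul_apply,
    smul_eq_mul]
  push_cast
  match_scalars
  · field_simp
    ring
  · field_simp
    linear_combination (-(A k * B k * s * ω k : ℂ)) * Complex.I_sq
  · field_simp
    linear_combination (2 * B k * ω k : ℂ) * Complex.I_sq

/-- By the normal ordering in `V_fieldOp`, `F(s) = ⟨ψ, V(sA, sB)ψ⟩` satisfies `F' = -sκF` up to
terms containing `aₖψ`, where `κ` is the variance. The integrating factor `exp(κs²/2)` leaves only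
those errors, and integrating over `[0, 1]` bounds them. -/
theorem norm_inner_V_sub_le (h : WeylSystem ι Q P V) {ω : K → ℝ} (hω : ∀ k, 0 < ω k)
    (A B : K → ℝ) (ψ : S) :
    ‖Complex.exp ((groundVar ω A B / 2 : ℝ)) * inner ℂ (ι ψ) (ι (V A B ψ)) -
        inner ℂ (ι ψ) (ι ψ)‖ ≤
      Real.exp (groundVar ω A B / 2) * ∑ k, (‖(A k / (2 * ω k) - Complex.I * B k / 2 : ℂ)‖ +
        ‖(A k / (2 * ω k) + Complex.I * B k / 2 : ℂ)‖) *
          (‖ι ψ‖ * ‖ι (lowerOp Q P ω k ψ)‖) := by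
  set κ := groundVar ω A B with hκ
  have hκ0 : 0 ≤ κ := Finset.sum_nonneg fun k _ => by have := hω k; positivity
  set err : ℝ → ℂ := fun s => ∑ k, ((A k / (2 * ω k) - Complex.I * B k / 2 : ℂ) *
          inner ℂ (ι ψ) (ι (V (s • A) (s • B) (lowerOp Q P ω k ψ))) +
        (A k / (2 * ω k) + Complex.I * B k / 2 : ℂ) *
          inner ℂ (ι (lowerOp Q P ω k ψ)) (ι (V (s • A) (s • B) ψ))) with herr
  have hF : ∀ s : ℝ, HasDerivAt (fun s : ℝ => inner ℂ (ι ψ) (ι (V (s • A) (s • B) ψ)))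
      (Complex.I * err s - s * κ * inner ℂ (ι ψ) (ι (V (s • A) (s • B) ψ))) s := by
    intro s
    have h1 := (innerSL ℂ (ι ψ)).hasFDerivAt.restrictScalars ℝ |>.comp_hasDerivAt s
      (h.hasDerivAt_V_smul A B ψ s)
    refine h1.congr_deriv ?_
    simp only [ContinuousLinearMap.coe_restrictScalars', innerSL_apply_apply,
      h.V_fieldOp hω, map_add, map_sum, map_smul, smul_eq_mul, ← h.inner_lowerOp, herr, ← hκ]
    linear_combination (s * κ * inner ℂ (ι ψ) (ι (V (s • A) (s • B) ψ)) : ℂ) * Complex.I_mul_I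
  have hG : ∀ s : ℝ, HasDerivAt (fun s : ℝ => Complex.exp ((κ / 2 * s ^ 2 : ℝ)) *
      inner ℂ (ι ψ) (ι (V (s • A) (s • B) ψ)))
      (Complex.exp ((κ / 2 * s ^ 2 : ℝ)) * (Complex.I * err s)) s := by
    intro s
    have he : HasDerivAt (fun s : ℝ => κ / 2 * s ^ 2) (κ * s) s := by
      refine ((hasDerivAt_pow 2 s).const_mul (κ / 2)).congr_deriv ?_
      norm_num; ring
    refine ((he.ofReal_comp.cexp).mul (hF s)).congr_deriv ?_
    push_cast
    ring
  have hbound : ∀ s ∈ Set.Icc (0 : ℝ) 1,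
      ‖Complex.exp ((κ / 2 * s ^ 2 : ℝ)) * (Complex.I * err s)‖ ≤
      Real.exp (κ / 2) * ∑ k, (‖(A k / (2 * ω k) - Complex.I * B k / 2 : ℂ)‖ +
        ‖(A k / (2 * ω k) + Complex.I * B k / 2 : ℂ)‖) *
          (‖ι ψ‖ * ‖ι (lowerOp Q P ω k ψ)‖) := by
    intro s hs
    rw [norm_mul, norm_mul, Complex.norm_I, one_mul, Complex.norm_exp, Complex.ofReal_re]
    refine mul_le_mul (Real.exp_le_exp.2 ?_) ?_ (norm_nonneg _) (Real.exp_pos _).le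
    · exact mul_le_of_le_one_right (by positivity) (pow_le_one₀ hs.1 hs.2)
    · refine (norm_sum_le _ _).trans (Finset.sum_le_sum fun k _ => ?_)
      refine (norm_add_le _ _).trans ?_
      rw [norm_mul, norm_mul, add_mul]
      refine add_le_add (mul_le_mul_of_nonneg_left ?_ (norm_nonneg _))
        (mul_le_mul_of_nonneg_left ?_ (norm_nonneg _))
      · exact (norm_inner_le_norm _ _).trans_eq (by rw [h.norm_V])
      · exact (norm_inner_le_norm _ _).trans_eq (by rw [h.norm_V, mul_comm])
  have := (convex_Icc (0 : ℝ) 1).norm_image_sub_le_of_norm_hasDerivWithin_le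
    (fun r _ => (hG r).hasDerivWithinAt) hbound (Set.left_mem_Icc.2 zero_le_one)
      (Set.right_mem_Icc.2 zero_le_one)
  simpa [h.V_zero] using this

/-- The ground state expectation of the Weyl operators. -/
theorem tendsto_inner_V (h : WeylSystem ι Q P V) {ω : K → ℝ} (hω : ∀ k, 0 < ω k) {e : ℝ}
    (he : ∀ χ, e * ‖ι χ‖ ^ 2 ≤ (inner ℂ (ι χ) (ι (modeEnergy Q P ω χ))).re)
    {ψ : ℕ → S} {Φ : E} (hψ : Filter.Tendsto (fun n => ι (ψ n)) Filter.atTop (nhds Φ))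
    (hHψ : Filter.Tendsto (fun n => ι (modeEnergy Q P ω (ψ n))) Filter.atTop
      (nhds ((e : ℂ) • Φ))) (A B : K → ℝ) :
    Filter.Tendsto (fun n => inner ℂ (ι (ψ n)) (ι (V A B (ψ n)))) Filter.atTop
      (nhds (Complex.exp (-(groundVar ω A B / 2 : ℝ)) * inner ℂ Φ Φ)) := by
  have h1 : Filter.Tendsto (fun n =>
      Complex.exp ((groundVar ω A B / 2 : ℝ)) * inner ℂ (ι (ψ n)) (ι (V A B (ψ n))) -
        inner ℂ (ι (ψ n)) (ι (ψ n))) Filter.atTop (nhds 0) := by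
    refine squeeze_zero_norm (fun n => h.norm_inner_V_sub_le hω A B (ψ n)) ?_
    have h2 : ∀ k, Filter.Tendsto (fun n => (‖(A k / (2 * ω k) - Complex.I * B k / 2 : ℂ)‖ +
        ‖(A k / (2 * ω k) + Complex.I * B k / 2 : ℂ)‖) *
          (‖ι (ψ n)‖ * ‖ι (lowerOp Q P ω k (ψ n))‖)) Filter.atTop (nhds 0) := by
      intro k
      have := (hψ.norm.mul (h.tendsto_lowerOp hω he hψ hHψ k)).const_mul
        (‖(A k / (2 * ω k) - Complex.I * B k / 2 : ℂ)‖ +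
        ‖(A k / (2 * ω k) + Complex.I * B k / 2 : ℂ)‖)
      simpa using this
    simpa using (tendsto_finsetSum Finset.univ fun k _ => h2 k).const_mul
      (Real.exp (groundVar ω A B / 2))
  have h2 := (h1.add (hψ.inner hψ)).const_mul (Complex.exp (-(groundVar ω A B / 2 : ℝ)))
  simp only [sub_add_cancel, zero_add, ← mul_assoc, ← Complex.exp_add, neg_add_cancel,
    Complex.exp_zero, one_mul] at h2
  exact h2

end WeylSystem

end GroundState

/-! ### Differentiation along unitary groups. -/

section UnitaryGroups

variable {E : Type*} [NormedAddCommGroup E] [InnerProductSpace ℂ E] [CompleteSpace E]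

namespace IsUnitaryGroupOf

variable {A : E →ₗ.[ℂ] E} {U : ℝ → E →L[ℂ] E}

theorem norm_apply (hU : IsUnitaryGroupOf A U) (t : ℝ) (ψ : E) : ‖U t ψ‖ = ‖ψ‖ :=
  ContinuousLinearMap.norm_map_of_mem_unitary (hU.unitary t) ψ

theorem apply_zero (hU : IsUnitaryGroupOf A U) : U 0 = 1 := by
  have h := hU.add 0 0
  rw [add_zero] at h
  have h1 := (Unitary.mem_iff.1 (hU.unitary 0)).1
  calc U 0 = star (U 0) * U 0 * U 0 := by rw [h1, one_mul]
    _ = 1 := by rw [mul_assoc, ← h, h1]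

theorem neg_apply_apply (hU : IsUnitaryGroupOf A U) (t : ℝ) (ψ : E) : U (-t) (U t ψ) = ψ := by
  have := hU.add (-t) t
  rw [neg_add_cancel, hU.apply_zero] at this
  rw [← mul_apply_eq_comp, ← this]; rfl

theorem inner_apply (hU : IsUnitaryGroupOf A U) (t : ℝ) (ψ φ : E) :
    inner ℂ ψ (U t φ) = inner ℂ (U (-t) ψ) φ := by
  have h1 : inner ℂ (U t (U (-t) ψ)) (U t φ) = inner ℂ (U (-t) ψ) φ :=
    ContinuousLinearMap.inner_map_map_of_mem_unitary (hU.unitary t) _ _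
  rw [← h1]
  have := hU.neg_apply_apply (-t) ψ
  rw [neg_neg] at this
  rw [this]

/-- The product rule for `s ↦ e^{isA} y(s)`. -/
theorem hasDerivAt_apply (hU : IsUnitaryGroupOf A U) {y : ℝ → E} {y' z : E} {t : ℝ}
    (hy : HasDerivAt y y' t) (hz : ∃ h : y t ∈ A.domain, A ⟨y t, h⟩ = z) :
    HasDerivAt (fun s => U s (y s)) (U t (y' + Complex.I • z)) t := by
  -- Only `y t` has to lie in the domain: the first summand uses the generator, the second only
  -- isometry and strong continuity.
  have hfac : ∀ s, U s (y s) = U t (U (s - t) (y t) + U (s - t) (y s - y t)) := by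
    intro s
    rw [← map_add, add_sub_cancel, ← mul_apply_eq_comp, ← hU.add, add_sub_cancel]
  have h1 : HasDerivAt (fun s => U (s - t) (y t)) (Complex.I • z) t := by
    have := (hU.generator (y t) z).2 hz
    rw [← sub_self t] at this
    exact this.comp_sub_const t t
  have h2 : HasDerivAt (fun s => U (s - t) (y s - y t)) y' t := by
    rw [hasDerivAt_iff_tendsto_slope] at hy ⊢
    have hc : Filter.Tendsto (fun s => U (s - t) y' - y') (nhdsWithin t {t}ᶜ) (nhds 0) := by
      have hcont : Continuous fun s => U (s - t) y' - y' :=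
        ((hU.continuous y').comp (continuous_id.sub continuous_const)).sub continuous_const
      have := hcont.tendsto t
      simp only [sub_self, hU.apply_zero, one_apply_eq_self] at this
      exact this.mono_left nhdsWithin_le_nhds
    have hd : Filter.Tendsto (fun s => U (s - t) (slope y t s - y')) (nhdsWithin t {t}ᶜ)
        (nhds 0) := by
      rw [tendsto_zero_iff_norm_tendsto_zero]
      simp only [hU.norm_apply]
      rw [← tendsto_zero_iff_norm_tendsto_zero]
      simpa using hy.sub_const y'
    have := (hd.add hc).add_const y'
    simp only [zero_add] at this
    refine this.congr fun s => ?_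
    simp only [slope, vsub_eq_sub, sub_self, map_zero, sub_zero, map_sub,
      ContinuousLinearMap.map_smul_of_tower,
      smul_sub]
    abel
  have h3 := ((U t).restrictScalars ℝ).hasFDerivAt.comp_hasDerivAt t (h1.add h2)
  simp only [ContinuousLinearMap.coe_restrictScalars'] at h3
  refine (h3.congr_of_eventuallyEq (Filter.Eventually.of_forall fun s => ?_)).congr_deriv
    (by rw [add_comm])
  simp only [Function.comp, Pi.add_apply, hfac s]

/-- Duhamel estimate: if `y` solves `y' = -iAy` up to an error `C`, then `e^{itA} y(t)` drifts from
`y(0)` at speed at most `C`. With `C = 0` it replaces the uniqueness part of Stone's theorem. -/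
theorem norm_apply_sub_le (hU : IsUnitaryGroupOf A U) {y y' z : ℝ → E} {C : ℝ}
    (hy : ∀ t, HasDerivAt y (y' t) t) (hz : ∀ t, ∃ h : y t ∈ A.domain, A ⟨y t, h⟩ = z t)
    (hC : ∀ t, ‖y' t + Complex.I • z t‖ ≤ C) (t : ℝ) : ‖U t (y t) - y 0‖ ≤ C * |t| := by
  have := convex_univ.norm_image_sub_le_of_norm_hasDerivWithin_le
    (fun r _ => (hU.hasDerivAt_apply (hy r) (hz r)).hasDerivWithinAt)
    (fun r _ => by rw [hU.norm_apply]; exact hC r) (Set.mem_univ 0) (Set.mem_univ t)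
  simpa [hU.apply_zero] using this

end IsUnitaryGroupOf

end UnitaryGroups

/-! ### Classical flow and evolution of coherent states. -/

section Dynamics

variable {S E K : Type*} [AddCommGroup S] [Module ℂ S] [NormedAddCommGroup E]
  [InnerProductSpace ℂ E] [Fintype K] [DecidableEq K] {ι : S →ₗ[ℂ] E}
  {Q P : K → S →ₗ[ℂ] S} {V : (K → ℝ) → (K → ℝ) → S →ₗ[ℂ] S}

/-- The classical evolution of the coefficients of the positions. -/
def flowQ {K : Type*} (ω A B : K → ℝ) (t : ℝ) (k : K) : ℝ :=
  A k * Real.cos (2 * ω k * t) + B k * ω k * Real.sin (2 * ω k * t)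

/-- The classical evolution of the coefficients of the momenta. -/
def flowP {K : Type*} (ω A B : K → ℝ) (t : ℝ) (k : K) : ℝ :=
  B k * Real.cos (2 * ω k * t) - A k / ω k * Real.sin (2 * ω k * t)

theorem hasDerivAt_flowQ {K : Type*} [Finite K] {ω : K → ℝ} (hω : ∀ k, 0 < ω k) (A B : K → ℝ) (t : ℝ) :
    HasDerivAt (flowQ ω A B) (fun k => 2 * ω k ^ 2 * flowP ω A B t k) t := by
  refine hasDerivAt_pi.2 fun k => ?_
  have hk := (hω k).ne'
  have hl : HasDerivAt (fun t => 2 * ω k * t) (2 * ω k) t := by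
    simpa using (hasDerivAt_id t).const_mul (2 * ω k)
  refine ((hl.cos.const_mul (A k)).add (hl.sin.const_mul (B k * ω k))).congr_deriv ?_
  simp only [flowP]
  field_simp
  ring

theorem hasDerivAt_flowP {K : Type*} [Finite K] {ω : K → ℝ} (hω : ∀ k, 0 < ω k) (A B : K → ℝ) (t : ℝ) :
    HasDerivAt (flowP ω A B) (fun k => -2 * flowQ ω A B t k) t := by
  refine hasDerivAt_pi.2 fun k => ?_
  have hk := (hω k).ne'
  have hl : HasDerivAt (fun t => 2 * ω k * t) (2 * ω k) t := by
    simpa using (hasDerivAt_id t).const_mul (2 * ω k)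
  refine ((hl.cos.const_mul (B k)).sub (hl.sin.const_mul (A k / ω k))).congr_deriv ?_
  simp only [flowQ]
  field_simp
  ring

namespace WeylSystem

/-- The Weyl operators along the classical flow solve the Heisenberg equation. -/
theorem hasDerivAt_V_flow (h : WeylSystem ι Q P V) {ω : K → ℝ} (hω : ∀ k, 0 < ω k)
    (A B : K → ℝ) (ψ : S) (t : ℝ) :
    HasDerivAt (fun t => ι (V (flowQ ω A B t) (flowP ω A B t) ψ))
      (-Complex.I • (ι (modeEnergy Q P ω (V (flowQ ω A B t) (flowP ω A B t) ψ)) -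
        ι (V (flowQ ω A B t) (flowP ω A B t) (modeEnergy Q P ω ψ)))) t := by
  refine (h.hasDerivAt_V_curve (hasDerivAt_flowQ hω A B t) (hasDerivAt_flowP hω A B t)
    ψ).congr_deriv ?_
  rw [← map_smul ι, ← map_smul ι, ← map_add ι, ← map_sub ι, ← map_smul ι]
  congr 1
  generalize flowQ ω A B t = a
  generalize flowP ω A B t = b
  simp only [modeEnergy_apply, fieldOp_apply, map_sum, symp, map_add, map_smul, h.V_Q, h.V_P,
    Complex.ofReal_sum, ← Finset.sum_sub_distrib, Finset.smul_sum, Finset.mul_sum,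
    Finset.sum_smul, ← Finset.sum_add_distrib, map_sub]
  refine Finset.sum_congr rfl fun k _ => ?_
  push_cast
  module

variable [CompleteSpace E]

/-- A coherent state built on an approximate eigenvector approximately follows the classical
flow. -/
theorem norm_apply_V_flow_sub_le (h : WeylSystem ι Q P V) {ω : K → ℝ} (hω : ∀ k, 0 < ω k)
    {H : E →ₗ.[ℂ] E} {U : ℝ → E →L[ℂ] E} (hU : IsUnitaryGroupOf H U)
    (hH : ∀ ψ : S, ∃ hψ : ι ψ ∈ H.domain, H ⟨ι ψ, hψ⟩ = ι (modeEnergy Q P ω ψ))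
    (e : ℝ) (A B : K → ℝ) (ψ : S) (t : ℝ) :
    ‖U t (Complex.exp (-Complex.I * e * t) • ι (V (flowQ ω A B t) (flowP ω A B t) ψ)) -
      ι (V A B ψ)‖ ≤ ‖ι (modeEnergy Q P ω ψ) - (e : ℂ) • ι ψ‖ * |t| := by
  have hexp : ∀ t : ℝ, HasDerivAt (fun t : ℝ => Complex.exp (-Complex.I * e * t))
      (Complex.exp (-Complex.I * e * t) * (-Complex.I * e)) t := by
    intro t
    have : HasDerivAt (fun t : ℝ => -Complex.I * e * (t : ℂ)) (-Complex.I * e) t := by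
      simpa using (Complex.ofRealCLM.hasDerivAt (x := t)).const_mul (-Complex.I * e)
    exact this.cexp
  have h0 : flowQ ω A B 0 = A := by funext k; simp [flowQ]
  have h0' : flowP ω A B 0 = B := by funext k; simp [flowP]
  have := hU.norm_apply_sub_le
    (fun t => (hexp t).smul (h.hasDerivAt_V_flow hω A B ψ t))
    (z := fun t => Complex.exp (-Complex.I * e * t) •
      ι (modeEnergy Q P ω (V (flowQ ω A B t) (flowP ω A B t) ψ)))
    (fun t => by
      obtain ⟨h1, h2⟩ := hH (V (flowQ ω A B t) (flowP ω A B t) ψ)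
      refine ⟨H.domain.smul_mem _ h1, ?_⟩
      rw [← h2, ← H.map_smul]; rfl)
    (C := ‖ι (modeEnergy Q P ω ψ) - (e : ℂ) • ι ψ‖)
    (fun t => by
      have hn : ‖Complex.exp (-Complex.I * e * t)‖ = 1 := by
        rw [Complex.norm_exp]; simp
      -- In `y' + iHy` the terms `HVψ` cancel and what remains is `i e^{-iet} V(H - e)ψ`. Since `V`
      -- is isometric, its norm is independent of `t`.
      have hV : ‖ι (modeEnergy Q P ω ψ) - (e : ℂ) • ι ψ‖ =
          ‖ι (V (flowQ ω A B t) (flowP ω A B t) (modeEnergy Q P ω ψ)) -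
            (e : ℂ) • ι (V (flowQ ω A B t) (flowP ω A B t) ψ)‖ := by
        rw [← map_smul ι, ← map_sub ι, ← h.norm_V (flowQ ω A B t) (flowP ω A B t), map_sub (V _ _),
          map_smul (V _ _), map_sub ι, map_smul ι]
      refine le_of_eq ?_
      trans ‖Complex.exp (-Complex.I * e * t) • Complex.I •
          (ι (V (flowQ ω A B t) (flowP ω A B t) (modeEnergy Q P ω ψ)) -
            (e : ℂ) • ι (V (flowQ ω A B t) (flowP ω A B t) ψ))‖
      · congr 1
        module
      · rw [norm_smul, norm_smul, hn, Complex.norm_I, one_mul, one_mul, hV]) t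
  simpa [h0, h0', h.V_zero] using this

end WeylSystem

end Dynamics

/-! ### Explicit Weyl operators on Schwartz functions. -/

section SchwartzWeyl

theorem hasTemperateGrowth_cexp_I_mul :
    (fun s : ℝ => Complex.exp (Complex.I * s)).HasTemperateGrowth := by
  have hd : ∀ n : ℕ, iteratedDeriv n (fun s : ℝ => Complex.exp (Complex.I * s)) =
      fun s : ℝ => Complex.I ^ n * Complex.exp (Complex.I * s) := by
    intro n
    induction n with
    | zero => simp
    | succ n ih =>
      rw [iteratedDeriv_succ, ih]
      funext s
      have h1 : HasDerivAt (fun s : ℝ => Complex.I * (s : ℂ)) Complex.I s := by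
        simpa using (Complex.ofRealCLM.hasDerivAt (x := s)).const_mul Complex.I
      rw [(h1.cexp.const_mul (Complex.I ^ n)).deriv]
      ring
  refine ⟨?_, fun n => ⟨0, 1, fun s => ?_⟩⟩
  · exact Complex.contDiff_exp.comp (contDiff_const.mul Complex.ofRealCLM.contDiff)
  · rw [norm_iteratedFDeriv_eq_norm_iteratedDeriv, hd]
    simp [Complex.norm_exp]

variable {Λ : Type*} [Fintype Λ]

/-- The plane wave `q ↦ exp(i ∑ₓ aₓ qₓ)`. -/
def planeWave (a : Λ → ℝ) (q : EuclideanSpace ℝ Λ) : ℂ :=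
  Complex.exp (Complex.I * ((∑ x, a x * q x : ℝ) : ℂ))

theorem hasTemperateGrowth_planeWave (a : Λ → ℝ) : (planeWave a).HasTemperateGrowth := by
  have h : planeWave a = (fun s : ℝ => Complex.exp (Complex.I * s)) ∘
      (∑ x, a x • EuclideanSpace.proj (𝕜 := ℝ) x : EuclideanSpace ℝ Λ →L[ℝ] ℝ) := by
    funext q
    simp [planeWave]
  rw [h]
  exact hasTemperateGrowth_cexp_I_mul.comp (ContinuousLinearMap.hasTemperateGrowth _)

/-- The Weyl operator `exp[i ∑ₓ (aₓ qₓ + bₓ pₓ)]` on Schwartz functions: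
a translation by `b` followed by multiplication with a plane wave. -/
def schwartzWeyl (a b : Λ → ℝ) : 𝓢(EuclideanSpace ℝ Λ, ℂ) →ₗ[ℂ] 𝓢(EuclideanSpace ℝ Λ, ℂ) :=
  -- This constant phase is the Baker–Campbell–Hausdorff correction for splitting the exponential of
  -- the field into a plane wave and a translation.
  Complex.exp (Complex.I / 2 * ((∑ x, a x * b x : ℝ) : ℂ)) •
    (SchwartzMap.smulLeftCLM ℂ (planeWave a) ∘L
      SchwartzMap.compSubConstCLM ℂ (-(WithLp.toLp 2 b : EuclideanSpace ℝ Λ))).toLinearMap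

theorem schwartzWeyl_apply (a b : Λ → ℝ) (ψ : 𝓢(EuclideanSpace ℝ Λ, ℂ))
    (q : EuclideanSpace ℝ Λ) :
    schwartzWeyl a b ψ q = Complex.exp (Complex.I * ((∑ x, a x * q x : ℝ) : ℂ) +
      Complex.I / 2 * ((∑ x, a x * b x : ℝ) : ℂ)) * ψ (q + WithLp.toLp 2 b) := by
  simp only [schwartzWeyl, LinearMap.smul_apply, smul_apply,
    ContinuousLinearMap.coe_coe, ContinuousLinearMap.comp_apply,
    SchwartzMap.smulLeftCLM_apply_apply (hasTemperateGrowth_planeWave a),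
    SchwartzMap.compSubConstCLM_apply, sub_neg_eq_add, smul_eq_mul, planeWave, Complex.exp_add]
  ring

theorem norm_schwartzWeyl_apply (a b : Λ → ℝ) (ψ : 𝓢(EuclideanSpace ℝ Λ, ℂ))
    (q : EuclideanSpace ℝ Λ) : ‖schwartzWeyl a b ψ q‖ = ‖ψ (q + WithLp.toLp 2 b)‖ := by
  rw [schwartzWeyl_apply, norm_mul, Complex.norm_exp]
  simp

theorem norm_schwartzToL2_schwartzWeyl (a b : Λ → ℝ) (ψ : 𝓢(EuclideanSpace ℝ Λ, ℂ)) :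
    ‖schwartzToL2 Λ (schwartzWeyl a b ψ)‖ = ‖schwartzToL2 Λ ψ‖ := by
  show ‖SchwartzMap.toLp (schwartzWeyl a b ψ) 2 volume‖ = ‖SchwartzMap.toLp ψ 2 volume‖
  rw [SchwartzMap.norm_toLp' (by simp) (by simp), SchwartzMap.norm_toLp' (by simp) (by simp)]
  simp only [norm_schwartzWeyl_apply]
  rw [integral_add_right_eq_self (fun x => ‖ψ x‖ ^ (2 : ℝ≥0∞).toReal)]

theorem inner_schwartzToL2 (ψ χ : 𝓢(EuclideanSpace ℝ Λ, ℂ)) :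
    inner ℂ (schwartzToL2 Λ ψ) (schwartzToL2 Λ χ) = ∫ q, inner ℂ (ψ q) (χ q) :=
  SchwartzMap.inner_toL2_toL2_eq ψ χ volume

theorem inner_position (x : Λ) (ψ χ : 𝓢(EuclideanSpace ℝ Λ, ℂ)) :
    inner ℂ (schwartzToL2 Λ (position x ψ)) (schwartzToL2 Λ χ) =
      inner ℂ (schwartzToL2 Λ ψ) (schwartzToL2 Λ (position x χ)) := by
  rw [inner_schwartzToL2, inner_schwartzToL2]
  congr 1
  funext q
  simp only [position_apply, RCLike.inner_apply, map_mul, Complex.conj_ofReal]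
  ring

/-- For `k` large the weight `(1 + ‖q‖)^(-k)` is square integrable, so `L²` estimates reduce to
pointwise ones with polynomial decay. -/
theorem exists_norm_schwartzToL2_le (Λ : Type*) [Fintype Λ] :
    ∃ (k : ℕ) (N : ℝ), ∀ (f : 𝓢(EuclideanSpace ℝ Λ, ℂ)) (c : ℝ), 0 ≤ c →
      (∀ q, ‖f q‖ ≤ c * (1 + ‖q‖) ^ (-k : ℝ)) → ‖schwartzToL2 Λ f‖ ≤ c * N := by
  obtain ⟨k, hk⟩ := Measure.HasTemperateGrowth.exists_eLpNorm_lt_top 2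
    (μ := (volume : Measure (EuclideanSpace ℝ Λ))) inferInstance
  refine ⟨k, (eLpNorm (fun q : EuclideanSpace ℝ Λ => (1 + ‖q‖) ^ (-k : ℝ)) 2 volume).toReal,
    fun f c hc hf => ?_⟩
  show ‖SchwartzMap.toLp f 2 volume‖ ≤ _
  rw [SchwartzMap.norm_toLp]
  have h1 : eLpNorm f 2 volume ≤
      eLpNorm (c • fun q : EuclideanSpace ℝ Λ => (1 + ‖q‖) ^ (-k : ℝ)) 2 volume := by
    refine eLpNorm_mono fun q => (hf q).trans (le_abs_self _)
  rw [eLpNorm_const_smul] at h1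
  have h2 := ENNReal.toReal_mono (ENNReal.mul_ne_top enorm_ne_top hk.ne) h1
  rw [ENNReal.toReal_mul, toReal_enorm, Real.norm_of_nonneg hc] at h2
  exact h2

/-- Schwartz functions decay uniformly along bounded translations. -/
theorem exists_norm_translate_le (k : ℕ) (χ : 𝓢(EuclideanSpace ℝ Λ, ℂ))
    (b : EuclideanSpace ℝ Λ) :
    ∃ C, 0 ≤ C ∧ ∀ s : ℝ, |s| ≤ 1 → ∀ q, ‖χ (q + s • b)‖ ≤ C * (1 + ‖q‖) ^ (-k : ℝ) := by
  set C₀ := 2 ^ k * (Finset.Iic (k, 0)).sup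
    (fun m => SchwartzMap.seminorm ℝ m.1 m.2 (E := EuclideanSpace ℝ Λ) (F := ℂ)) χ
  have hC : ∀ q, (1 + ‖q‖) ^ k * ‖χ q‖ ≤ C₀ := by
    intro q
    simpa using SchwartzMap.one_add_le_sup_seminorm_apply (𝕜 := ℝ) (m := (k, 0)) (k := k) (n := 0)
      le_rfl le_rfl χ q
  have hC0 : 0 ≤ C₀ := le_trans (by positivity) (hC 0)
  refine ⟨C₀ * (1 + ‖b‖) ^ k, by positivity, fun s hs q => ?_⟩
  rw [Real.rpow_neg (by positivity), Real.rpow_natCast, ← div_eq_mul_inv,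
    le_div_iff₀ (by positivity)]
  have h1 : 1 + ‖q‖ ≤ (1 + ‖q + s • b‖) * (1 + ‖b‖) := by
    have h2 : ‖q‖ ≤ ‖q + s • b‖ + ‖b‖ := by
      calc ‖q‖ = ‖(q + s • b) - s • b‖ := by rw [add_sub_cancel_right]
        _ ≤ ‖q + s • b‖ + ‖s • b‖ := norm_sub_le _ _
        _ ≤ ‖q + s • b‖ + ‖b‖ := by
          rw [norm_smul, Real.norm_eq_abs]
          exact add_le_add le_rfl (mul_le_of_le_one_left (norm_nonneg _) hs)
    nlinarith [norm_nonneg (q + s • b), norm_nonneg b]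
  calc ‖χ (q + s • b)‖ * (1 + ‖q‖) ^ k
      ≤ ‖χ (q + s • b)‖ * ((1 + ‖q + s • b‖) * (1 + ‖b‖)) ^ k := by gcongr
    _ = ((1 + ‖q + s • b‖) ^ k * ‖χ (q + s • b)‖) * (1 + ‖b‖) ^ k := by rw [mul_pow]; ring
    _ ≤ C₀ * (1 + ‖b‖) ^ k := mul_le_mul_of_nonneg_right (hC _) (by positivity)

theorem fderiv_schwartzWeyl (a b v : Λ → ℝ) (ψ : 𝓢(EuclideanSpace ℝ Λ, ℂ))
    (q : EuclideanSpace ℝ Λ) :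
    fderiv ℝ (schwartzWeyl a b ψ) q (WithLp.toLp 2 v) =
      Complex.exp (Complex.I * ((∑ x, a x * q x : ℝ) : ℂ) +
      Complex.I / 2 * ((∑ x, a x * b x : ℝ) : ℂ)) *
      (fderiv ℝ ψ (q + WithLp.toLp 2 b) (WithLp.toLp 2 v) +
        Complex.I * ((∑ x, a x * v x : ℝ) : ℂ) * ψ (q + WithLp.toLp 2 b)) := by
  have hl : HasFDerivAt (fun q : EuclideanSpace ℝ Λ => ∑ x, a x * q x)
      (∑ x, a x • EuclideanSpace.proj (𝕜 := ℝ) x : EuclideanSpace ℝ Λ →L[ℝ] ℝ) q := by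
    have := (∑ x, a x • EuclideanSpace.proj (𝕜 := ℝ) x : EuclideanSpace ℝ Λ →L[ℝ] ℝ).hasFDerivAt
      (x := q)
    convert this using 1
    funext q
    simp
  have h1 := ((Complex.ofRealCLM.hasFDerivAt.comp q hl).const_mul Complex.I).add_const
    (Complex.I / 2 * ((∑ x, a x * b x : ℝ) : ℂ))
  have h2 : HasFDerivAt (fun q : EuclideanSpace ℝ Λ => ψ (q + WithLp.toLp 2 b))
      (fderiv ℝ ψ (q + WithLp.toLp 2 b)) q :=
    (hasFDerivAt_comp_add_right _).2 (ψ.hasFDerivAt _)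
  have h3 := h1.cexp.mul h2
  have h4 : (schwartzWeyl a b ψ : EuclideanSpace ℝ Λ → ℂ) = fun q =>
      Complex.exp (Complex.I * ((∑ x, a x * q x : ℝ) : ℂ) +
      Complex.I / 2 * ((∑ x, a x * b x : ℝ) : ℂ)) * ψ (q + WithLp.toLp 2 b) := by
    funext q; exact schwartzWeyl_apply a b ψ q
  rw [h4]
  erw [h3.fderiv]
  simp
  ring

variable [DecidableEq Λ]

theorem momentum_apply (x : Λ) (ψ : 𝓢(EuclideanSpace ℝ Λ, ℂ)) (q : EuclideanSpace ℝ Λ) :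
    momentum x ψ q = -Complex.I * fderiv ℝ ψ q (EuclideanSpace.single x 1) := by
  simp only [momentum, smul_apply, smul_eq_mul]
  exact congrArg (-Complex.I * ·) <|
    SchwartzMap.lineDerivOp_apply_eq_fderiv _ _ _

theorem inner_momentum (x : Λ) (ψ χ : 𝓢(EuclideanSpace ℝ Λ, ℂ)) :
    inner ℂ (schwartzToL2 Λ (momentum x ψ)) (schwartzToL2 Λ χ) =
      inner ℂ (schwartzToL2 Λ ψ) (schwartzToL2 Λ (momentum x χ)) := by
  have h := SchwartzMap.integral_bilinear_lineDerivOp_right_eq_neg_left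
    (μ := (volume : Measure (EuclideanSpace ℝ Λ))) ψ χ
    ((ContinuousLinearMap.mul ℝ ℂ).comp (Complex.conjCLE : ℂ →L[ℝ] ℂ))
    (EuclideanSpace.single x 1)
  simp only [SchwartzMap.lineDerivOp_apply_eq_fderiv, ContinuousLinearMap.comp_apply,
    ContinuousLinearMap.mul_apply', ContinuousLinearEquiv.coe_coe, Complex.conjCLE_apply] at h
  rw [inner_schwartzToL2, inner_schwartzToL2]
  simp only [momentum_apply, RCLike.inner_apply, map_mul, map_neg, Complex.conj_I, neg_neg]
  have e1 : ∀ q, χ q * (Complex.I * (starRingEnd ℂ) (fderiv ℝ ψ q (EuclideanSpace.single x 1))) =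
      Complex.I * ((starRingEnd ℂ) (fderiv ℝ ψ q (EuclideanSpace.single x 1)) * χ q) :=
    fun q => by ring
  have e2 : ∀ q, -Complex.I * fderiv ℝ χ q (EuclideanSpace.single x 1) * (starRingEnd ℂ) (ψ q) =
      -Complex.I * ((starRingEnd ℂ) (ψ q) * fderiv ℝ χ q (EuclideanSpace.single x 1)) :=
    fun q => by ring
  simp only [e1, e2, integral_const_mul]
  rw [h]
  ring

theorem fderiv_apply_eq_sum (ψ : 𝓢(EuclideanSpace ℝ Λ, ℂ)) (q : EuclideanSpace ℝ Λ)
    (b : Λ → ℝ) : fderiv ℝ ψ q (WithLp.toLp 2 b) =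
      ∑ x, (b x : ℂ) * fderiv ℝ ψ q (EuclideanSpace.single x 1) := by
  have hb : (WithLp.toLp 2 b : EuclideanSpace ℝ Λ) =
      ∑ x, b x • EuclideanSpace.single x (1 : ℝ) := by
    ext y
    simp [Finset.sum_apply, Pi.single_apply]
  rw [hb, map_sum]
  refine Finset.sum_congr rfl fun x _ => ?_
  rw [map_smul, Complex.real_smul]

/-- The field operator `∑ₓ (aₓ qₓ + bₓ pₓ)` on Schwartz functions. -/
def schwartzField (a b : Λ → ℝ) : 𝓢(EuclideanSpace ℝ Λ, ℂ) →ₗ[ℂ] 𝓢(EuclideanSpace ℝ Λ, ℂ) :=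
  fieldOp (fun x => (position x).toLinearMap) (fun x => (momentum x).toLinearMap) a b

theorem schwartzField_apply (a b : Λ → ℝ) (ψ : 𝓢(EuclideanSpace ℝ Λ, ℂ))
    (q : EuclideanSpace ℝ Λ) :
    schwartzField a b ψ q = ((∑ x, a x * q x : ℝ) : ℂ) * ψ q -
      Complex.I * fderiv ℝ ψ q (WithLp.toLp 2 b) := by
  rw [schwartzField, fieldOp_apply, fderiv_apply_eq_sum]
  rw [sum_apply, Complex.ofReal_sum, Finset.sum_mul, Finset.mul_sum, ← Finset.sum_sub_distrib]
  refine Finset.sum_congr rfl fun x _ => ?_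
  simp only [add_apply, smul_apply, ContinuousLinearMap.coe_coe,
    position_apply, momentum_apply, smul_eq_mul, Complex.ofReal_mul]
  ring

theorem hasDerivAt_schwartzWeyl_apply (a b : Λ → ℝ) (ψ : 𝓢(EuclideanSpace ℝ Λ, ℂ))
    (q : EuclideanSpace ℝ Λ) (s : ℝ) :
    HasDerivAt (fun s : ℝ => schwartzWeyl (s • a) (s • b) ψ q)
      (Complex.I * schwartzWeyl (s • a) (s • b) (schwartzField a b ψ) q) s := by
  set α : ℝ := ∑ x, a x * q x with hα
  set β : ℝ := ∑ x, a x * b x with hβ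
  have e1 : ∀ s : ℝ, ∑ x, (s • a) x * q x = s * α := fun s => by
    simp [hα, Finset.mul_sum, mul_assoc]
  have e2 : ∀ s : ℝ, ∑ x, (s • a) x * (s • b) x = s ^ 2 * β := fun s => by
    simp only [hβ, Finset.mul_sum, Pi.smul_apply, smul_eq_mul]
    exact Finset.sum_congr rfl fun x _ => by ring
  have e3 : ∀ s : ℝ, (WithLp.toLp 2 (s • b) : EuclideanSpace ℝ Λ) = s • WithLp.toLp 2 b :=
    fun s => rfl
  have e4 : ∑ x, a x * (q + s • (WithLp.toLp 2 b : EuclideanSpace ℝ Λ)) x = α + s * β := by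
    simp only [PiLp.add_apply, PiLp.smul_apply, smul_eq_mul, mul_add, Finset.sum_add_distrib, hα,
      hβ, Finset.mul_sum]
    congr 1
    exact Finset.sum_congr rfl fun x _ => by ring
  simp only [schwartzWeyl_apply, schwartzField_apply, e1, e2, e3, e4]
  have hexp : HasDerivAt (fun s : ℝ => Complex.I * ((s * α : ℝ) : ℂ) +
      Complex.I / 2 * ((s ^ 2 * β : ℝ) : ℂ)) (Complex.I * (α + s * β : ℝ)) s := by
    have h1 : HasDerivAt (fun s : ℝ => s * α) α s := by
      simpa using (hasDerivAt_id s).mul_const α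
    have h2 : HasDerivAt (fun s : ℝ => s ^ 2 * β) (2 * s * β) s := by
      simpa using (hasDerivAt_pow 2 s).mul_const β
    refine ((h1.ofReal_comp.const_mul Complex.I).add
      (h2.ofReal_comp.const_mul (Complex.I / 2))).congr_deriv ?_
    push_cast
    ring
  have hlin : HasDerivAt (fun s : ℝ => q + s • (WithLp.toLp 2 b : EuclideanSpace ℝ Λ))
      (WithLp.toLp 2 b) s := by
    simpa using ((hasDerivAt_id s).smul_const (WithLp.toLp 2 b : EuclideanSpace ℝ Λ)).const_add q
  have hψ := (ψ.hasFDerivAt (q + s • (WithLp.toLp 2 b : EuclideanSpace ℝ Λ))).comp_hasDerivAt s hlin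
  refine (hexp.cexp.mul hψ).congr_deriv ?_
  simp only [Function.comp]
  linear_combination (Complex.exp (Complex.I * ((s * α : ℝ) : ℂ) +
    Complex.I / 2 * ((s ^ 2 * β : ℝ) : ℂ)) *
    fderiv ℝ ψ (q + s • (WithLp.toLp 2 b : EuclideanSpace ℝ Λ)) (WithLp.toLp 2 b)) *
    Complex.I_mul_I

/-- Pointwise second-order Taylor estimate at fixed `q`. The bound `C` may depend on `q`, so that
the decay of Schwartz functions can be inserted afterwards. -/
theorem norm_schwartzWeyl_sub_sub_le (a b : Λ → ℝ) (ψ : 𝓢(EuclideanSpace ℝ Λ, ℂ))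
    (q : EuclideanSpace ℝ Λ) {s C : ℝ}
    (hC : ∀ r : ℝ, |r| ≤ |s| → ‖schwartzField a b (schwartzField a b ψ)
      (q + r • WithLp.toLp 2 b)‖ ≤ C) :
    ‖schwartzWeyl (s • a) (s • b) ψ q - ψ q - s * (Complex.I * schwartzField a b ψ q)‖ ≤
      C * |s| ^ 2 := by
  have h0 : ∀ χ : 𝓢(EuclideanSpace ℝ Λ, ℂ), schwartzWeyl ((0 : ℝ) • a) ((0 : ℝ) • b) χ q = χ q := by
    intro χ; simp [schwartzWeyl_apply]
  have hs0 : (0 : ℝ) ∈ Set.Icc (-|s|) |s| := ⟨by simp, abs_nonneg s⟩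
  have hss : s ∈ Set.Icc (-|s|) |s| := ⟨neg_abs_le s, le_abs_self s⟩
  have hC0 : 0 ≤ C := (norm_nonneg _).trans (hC 0 (by simp))
  have h1 : ∀ r ∈ Set.Icc (-|s|) |s|,
      ‖schwartzWeyl (r • a) (r • b) (schwartzField a b ψ) q - schwartzField a b ψ q‖ ≤ C * |s| := by
    intro r hr
    have := (convex_Icc (-|s|) |s|).norm_image_sub_le_of_norm_hasDerivWithin_le (C := C)
      (fun r _ => (hasDerivAt_schwartzWeyl_apply a b (schwartzField a b ψ) q r).hasDerivWithinAt)
      (fun r hr => by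
        rw [norm_mul, Complex.norm_I, one_mul, norm_schwartzWeyl_apply]
        exact hC r (abs_le.2 hr)) hs0 hr
    rw [h0, sub_zero, Real.norm_eq_abs] at this
    exact this.trans (mul_le_mul_of_nonneg_left (abs_le.2 hr) hC0)
  have h2 := (convex_Icc (-|s|) |s|).norm_image_sub_le_of_norm_hasDerivWithin_le (C := C * |s|)
      (f := fun r : ℝ => schwartzWeyl (r • a) (r • b) ψ q -
        (r : ℂ) * (Complex.I * schwartzField a b ψ q))
      (f' := fun r : ℝ => Complex.I * schwartzWeyl (r • a) (r • b) (schwartzField a b ψ) q -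
        Complex.I * schwartzField a b ψ q)
      (fun r _ => by
        refine ((hasDerivAt_schwartzWeyl_apply a b ψ q r).sub ?_).hasDerivWithinAt
        simpa using (Complex.ofRealCLM.hasDerivAt (x := r)).mul_const
          (Complex.I * schwartzField a b ψ q))
      (fun r hr => by
        rw [← mul_sub, norm_mul, Complex.norm_I, one_mul]
        exact h1 r hr) hs0 hss
  simp only [h0, Complex.ofReal_zero, zero_mul, sub_zero, Real.norm_eq_abs] at h2
  rw [sub_right_comm, pow_two, ← mul_assoc C]
  exact h2

/-- The pointwise remainder is `O(s²)` times a square integrable weight, hence `O(s²)` in `L²`. -/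
theorem hasDerivAt_schwartzToL2_schwartzWeyl (a b : Λ → ℝ) (ψ : 𝓢(EuclideanSpace ℝ Λ, ℂ)) :
    HasDerivAt (fun s : ℝ => schwartzToL2 Λ (schwartzWeyl (s • a) (s • b) ψ))
      (Complex.I • schwartzToL2 Λ (schwartzField a b ψ)) 0 := by
  obtain ⟨k, N, hN⟩ := exists_norm_schwartzToL2_le Λ
  obtain ⟨C, hC0, hC⟩ := exists_norm_translate_le k (schwartzField a b (schwartzField a b ψ))
    (WithLp.toLp 2 b)
  have h0 : schwartzWeyl ((0 : ℝ) • a) ((0 : ℝ) • b) ψ = ψ := by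
    ext q; simp [schwartzWeyl_apply]
  rw [hasDerivAt_iff_isLittleO]
  have h2 : (fun s : ℝ => s ^ 2) =o[nhds 0] fun s => s - 0 := by
    simpa using Asymptotics.isLittleO_pow_id (𝕜 := ℝ) one_lt_two
  refine Asymptotics.IsBigO.trans_isLittleO ?_ h2
  refine Asymptotics.IsBigO.of_bound (C * N) ?_
  filter_upwards [Metric.ball_mem_nhds (0 : ℝ) one_pos] with s hs
  rw [Metric.mem_ball, dist_zero_right, Real.norm_eq_abs] at hs
  have h3 : schwartzToL2 Λ (schwartzWeyl (s • a) (s • b) ψ) -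
      schwartzToL2 Λ (schwartzWeyl ((0 : ℝ) • a) ((0 : ℝ) • b) ψ) -
      (s - 0) • Complex.I • schwartzToL2 Λ (schwartzField a b ψ) =
      schwartzToL2 Λ (schwartzWeyl (s • a) (s • b) ψ - ψ -
        (s : ℂ) • Complex.I • schwartzField a b ψ) := by
    rw [h0, map_sub, map_sub, map_smul, map_smul, sub_zero]
    rfl
  rw [h3, norm_pow, Real.norm_eq_abs]
  refine (hN _ (C * |s| ^ 2) (by positivity) fun q => ?_).trans_eq (by ring)
  refine (norm_schwartzWeyl_sub_sub_le a b ψ q (s := s)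
    (C := C * (1 + ‖q‖) ^ (-k : ℝ)) fun r hr => hC r (hr.trans hs.le) q).trans_eq (by ring)

end SchwartzWeyl

/-! ### Linear canonical transformations of Weyl systems. -/

section Transform

variable {S E K K' : Type*} [AddCommGroup S] [Module ℂ S] [NormedAddCommGroup E]
  [InnerProductSpace ℂ E] [Fintype K] [DecidableEq K] [Fintype K'] [DecidableEq K']
  {ι : S →ₗ[ℂ] E} {Q P : K → S →ₗ[ℂ] S} {V : (K → ℝ) → (K → ℝ) → S →ₗ[ℂ] S}

/-- A linear canonical transformation of a Weyl system. -/
theorem WeylSystem.transform (h : WeylSystem ι Q P V) (N M : K' → K → ℝ)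
    (hNM : ∀ k l, ∑ x, N k x * M l x = if k = l then 1 else 0) :
    WeylSystem ι (fun k => ∑ x, (N k x : ℂ) • Q x) (fun k => ∑ x, (M k x : ℂ) • P x)
      (fun A B => V (fun x => ∑ k, A k * N k x) (fun x => ∑ k, B k * M k x)) := by
  -- Duality of `N` and `M` preserves the pairing of position with momentum coefficients, hence the
  -- symplectic form.
  have hpair : ∀ A B : K' → ℝ, ∑ x, (∑ k, A k * N k x) * (∑ l, B l * M l x) = ∑ k, A k * B k := by
    intro A B
    calc ∑ x, (∑ k, A k * N k x) * (∑ l, B l * M l x)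
        = ∑ x, ∑ k, ∑ l, A k * B l * (N k x * M l x) := by
          refine Finset.sum_congr rfl fun x _ => ?_
          rw [Finset.sum_mul_sum]
          exact Finset.sum_congr rfl fun k _ => Finset.sum_congr rfl fun l _ => by ring
      _ = ∑ k, ∑ l, A k * B l * ∑ x, N k x * M l x := by
          rw [Finset.sum_comm]
          refine Finset.sum_congr rfl fun k _ => ?_
          rw [Finset.sum_comm]
          exact Finset.sum_congr rfl fun l _ => by rw [Finset.mul_sum]
      _ = ∑ k, A k * B k := by simp [hNM]
  have hN : ∀ (B : K' → ℝ) k, ∑ x, N k x * ∑ l, B l * M l x = B k := by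
    intro B k
    have := hpair (Pi.single k 1) B
    simpa [Pi.single_apply] using this
  have hM : ∀ (A : K' → ℝ) k, ∑ x, M k x * ∑ l, A l * N l x = A k := by
    intro A k
    have := hpair A (Pi.single k 1)
    simpa [Pi.single_apply, mul_comm] using this
  have hfield : ∀ (A B : K' → ℝ) (ψ : S),
      fieldOp (fun k => ∑ x, (N k x : ℂ) • Q x) (fun k => ∑ x, (M k x : ℂ) • P x) A B ψ =
      fieldOp Q P (fun x => ∑ k, A k * N k x) (fun x => ∑ k, B k * M k x) ψ := by
    intro A B ψ
    simp only [fieldOp_apply, LinearMap.sum_apply, LinearMap.smul_apply, Finset.smul_sum,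
      smul_smul, Complex.ofReal_sum, Finset.sum_smul, Finset.sum_add_distrib, Complex.ofReal_mul]
    rw [Finset.sum_comm]
    congr 1
    rw [Finset.sum_comm]
  refine ⟨?_, ?_, ?_, ?_, ?_, ?_, ?_, ?_, ?_, ?_, ?_⟩
  · intro k ψ χ
    simp only [LinearMap.sum_apply, LinearMap.smul_apply, map_sum, map_smul, sum_inner, inner_sum,
      inner_smul_left, inner_smul_right, h.Q_symm, Complex.conj_ofReal]
  · intro k ψ χ
    simp only [LinearMap.sum_apply, LinearMap.smul_apply, map_sum, map_smul, sum_inner, inner_sum,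
      inner_smul_left, inner_smul_right, h.P_symm, Complex.conj_ofReal]
  · intro j k ψ
    simp only [LinearMap.sum_apply, LinearMap.smul_apply, map_sum, map_smul, Finset.smul_sum]
    rw [Finset.sum_comm]
    refine Finset.sum_congr rfl fun x _ => Finset.sum_congr rfl fun y _ => ?_
    rw [h.comm_QQ, smul_comm]
  · intro j k ψ
    simp only [LinearMap.sum_apply, LinearMap.smul_apply, map_sum, map_smul, Finset.smul_sum]
    rw [Finset.sum_comm]
    refine Finset.sum_congr rfl fun x _ => Finset.sum_congr rfl fun y _ => ?_
    rw [h.comm_PP, smul_comm]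
  · intro j k ψ
    simp only [LinearMap.sum_apply, LinearMap.smul_apply, map_sum, map_smul, Finset.smul_sum,
      h.comm_QP, smul_add, Finset.sum_add_distrib]
    congr 1
    · rw [Finset.sum_comm]
      exact Finset.sum_congr rfl fun x _ => Finset.sum_congr rfl fun y _ => smul_comm _ _ _
    · simp only [ite_smul, zero_smul, smul_ite, smul_zero, Finset.sum_ite_eq',
        Finset.mem_univ, if_true, smul_smul, ← Finset.sum_smul]
      rw [← ite_zero_smul]
      congr 1
      have := congrArg (fun r : ℝ => (r : ℂ) * Complex.I) (hNM j k)
      simp only [Complex.ofReal_sum, Complex.ofReal_mul, Finset.sum_mul] at this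
      rw [show (if j = k then Complex.I else 0) = ((if j = k then (1 : ℝ) else 0 : ℝ) : ℂ) *
        Complex.I by split_ifs <;> simp, ← this]
      exact Finset.sum_congr rfl fun x _ => by ring
  · intro a b ψ
    exact h.norm_V _ _ _
  · intro a b a' b' ψ
    simp only [h.V_mul]
    congr 2
    · congr 2
      simp only [symp, Finset.sum_sub_distrib]
      rw [hpair, show ∑ x, (∑ k, b k * M k x) * ∑ k, a' k * N k x =
        ∑ x, (∑ k, a' k * N k x) * ∑ k, b k * M k x from
        Finset.sum_congr rfl fun x _ => mul_comm _ _, hpair]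
      simp only [mul_comm]
    · congr 1 <;> (funext x; simp [add_mul, Finset.sum_add_distrib])
  · intro ψ
    have h0 : (fun x : K => ∑ k, (0 : K' → ℝ) k * N k x) = 0 := by funext x; simp
    have h1 : (fun x : K => ∑ k, (0 : K' → ℝ) k * M k x) = 0 := by funext x; simp
    simp only [h0, h1, h.V_zero]
  · intro k a b ψ
    simp only [LinearMap.sum_apply, LinearMap.smul_apply, h.Q_V, map_sub, map_smul, smul_sub,
      Finset.sum_sub_distrib, map_sum, smul_smul, ← Finset.sum_smul]
    congr 2
    have := congrArg (fun r : ℝ => (r : ℂ)) (hN b k)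
    simp only [Complex.ofReal_sum, Complex.ofReal_mul] at this ⊢
    exact this
  · intro k a b ψ
    simp only [LinearMap.sum_apply, LinearMap.smul_apply, h.P_V, map_add, map_smul, smul_add,
      Finset.sum_add_distrib, map_sum, smul_smul, ← Finset.sum_smul]
    congr 2
    have := congrArg (fun r : ℝ => (r : ℂ)) (hM a k)
    simp only [Complex.ofReal_sum, Complex.ofReal_mul] at this ⊢
    exact this
  · intro a b ψ
    rw [hfield]
    have := h.hasDerivAt_V (fun x => ∑ k, a k * N k x) (fun x => ∑ k, b k * M k x) ψ
    convert this using 5 <;> (funext x; simp [Finset.mul_sum, mul_assoc])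

end Transform

/-! ### Positions and momenta on Schwartz space form a Weyl system. -/

section SchwartzSystem

variable {Λ : Type*} [Fintype Λ] [DecidableEq Λ]

theorem momentum_comm (x y : Λ) (ψ : 𝓢(EuclideanSpace ℝ Λ, ℂ)) :
    momentum x (momentum y ψ) = momentum y (momentum x ψ) := by
  have hd : ∀ (x y : Λ) (q : EuclideanSpace ℝ Λ), momentum x (momentum y ψ) q =
      -(fderiv ℝ (fderiv ℝ ψ) q (EuclideanSpace.single x 1) (EuclideanSpace.single y 1)) := by
    intro x y q
    rw [momentum_apply]
    have h1 : (momentum y ψ : EuclideanSpace ℝ Λ → ℂ) =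
        fun q => -Complex.I * fderiv ℝ ψ q (EuclideanSpace.single y 1) := by
      funext q; exact momentum_apply y ψ q
    have h2 : HasFDerivAt (fderiv ℝ ψ) (fderiv ℝ (fderiv ℝ ψ) q) q :=
      ((ψ.smooth 2).fderiv_right (m := 1) (by norm_num)).differentiable (by norm_num) q
        |>.hasFDerivAt
    have h3 := ((h2.clm_apply (hasFDerivAt_const (EuclideanSpace.single y (1 : ℝ)) q)).const_mul
      (-Complex.I))
    rw [h1, h3.fderiv]
    simp [← mul_assoc]
  ext q
  rw [hd, hd]
  congr 1
  exact ((ψ.contDiffAt 2).isSymmSndFDerivAt (by simp)).eq _ _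

theorem position_momentum (x y : Λ) (ψ : 𝓢(EuclideanSpace ℝ Λ, ℂ)) :
    position x (momentum y ψ) =
      momentum y (position x ψ) + (if x = y then Complex.I else 0) • ψ := by
  ext q
  have h1 : (position x ψ : EuclideanSpace ℝ Λ → ℂ) = fun q => ((q x : ℝ) : ℂ) * ψ q := by
    funext q; exact position_apply x ψ q
  have h2 : HasFDerivAt (fun q : EuclideanSpace ℝ Λ => ((q x : ℝ) : ℂ))
      (Complex.ofRealCLM ∘L EuclideanSpace.proj (𝕜 := ℝ) x) q :=
    (Complex.ofRealCLM ∘L EuclideanSpace.proj (𝕜 := ℝ) x :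
      EuclideanSpace ℝ Λ →L[ℝ] ℂ).hasFDerivAt
  have h3 := h2.mul (ψ.hasFDerivAt q)
  rw [position_apply, momentum_apply, add_apply, momentum_apply, h1, smul_apply]
  erw [h3.fderiv]
  by_cases hxy : x = y
  · subst hxy; simp; ring
  · simp [hxy]; ring

theorem weylSystem_schwartz (Λ : Type*) [Fintype Λ] [DecidableEq Λ] :
    WeylSystem (schwartzToL2 Λ) (fun x => (position x).toLinearMap)
      (fun x => (momentum x).toLinearMap) schwartzWeyl := by
  refine ⟨inner_position, inner_momentum, ?_, momentum_comm, position_momentum,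
    norm_schwartzToL2_schwartzWeyl, ?_, ?_, ?_, ?_, hasDerivAt_schwartzToL2_schwartzWeyl⟩
  · intro x y ψ
    ext q
    simp only [ContinuousLinearMap.coe_coe, position_apply]
    ring
  · intro a b a' b' ψ
    ext q
    rw [smul_apply, schwartzWeyl_apply, schwartzWeyl_apply, schwartzWeyl_apply,
      smul_eq_mul, ← mul_assoc, ← mul_assoc, ← Complex.exp_add, ← Complex.exp_add]
    congr 2
    · simp only [symp, PiLp.add_apply, Pi.add_apply, add_mul, mul_add, Finset.sum_add_distrib,
        Finset.sum_sub_distrib, Complex.ofReal_add, Complex.ofReal_sub]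
      rw [show ∑ x, b x * a' x = ∑ x, a' x * b x from
        Finset.sum_congr rfl fun x _ => mul_comm _ _]
      ring
    · rw [add_assoc]; rfl
  · intro ψ
    ext q
    simp [schwartzWeyl_apply]
  · intro x a b ψ
    ext q
    simp only [ContinuousLinearMap.coe_coe, position_apply, schwartzWeyl_apply, sub_apply,
      smul_apply, smul_eq_mul, PiLp.add_apply, Complex.ofReal_add]
    ring
  · intro x a b ψ
    ext q
    simp only [ContinuousLinearMap.coe_coe, momentum_apply]
    rw [show (EuclideanSpace.single x (1 : ℝ)) = WithLp.toLp 2 (Pi.single x 1) from rfl,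
      fderiv_schwartzWeyl, schwartzWeyl_apply, add_apply, momentum_apply]
    rw [show (EuclideanSpace.single x (1 : ℝ)) = WithLp.toLp 2 (Pi.single x 1) from rfl]
    simp only [smul_apply, smul_eq_mul, Pi.single_apply, mul_ite, mul_one, mul_zero,
      Finset.sum_ite_eq', Finset.mem_univ, if_true]
    linear_combination (-(Complex.exp (Complex.I * ((∑ x, a x * q x : ℝ) : ℂ) +
      Complex.I / 2 * ((∑ x, a x * b x : ℝ) : ℂ)) * a x * ψ (q + WithLp.toLp 2 b))) *
      Complex.I_mul_I

end SchwartzSystem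

/-! ### Closures of operators on Schwartz space and the Weyl operators on `L²`. -/

section Closures

variable {Λ : Type*} [Fintype Λ]

theorem onSchwartz_apply (T : SchwartzOp Λ) (ψ : 𝓢(EuclideanSpace ℝ Λ, ℂ)) :
    onSchwartz T ⟨schwartzToL2 Λ ψ, LinearMap.mem_range_self _ ψ⟩ = schwartzToL2 Λ (T ψ) := by
  show schwartzToL2 Λ (T ((LinearEquiv.ofInjective (schwartzToL2 Λ) schwartzToL2_injective).symm
    ⟨schwartzToL2 Λ ψ, LinearMap.mem_range_self _ ψ⟩)) = _
  congr 2
  exact (LinearEquiv.symm_apply_eq _).2 rfl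

theorem closedOp_schwartz (T : SchwartzOp Λ) (ψ : 𝓢(EuclideanSpace ℝ Λ, ℂ)) :
    ∃ h : schwartzToL2 Λ ψ ∈ (closedOp T).domain,
      closedOp T ⟨schwartzToL2 Λ ψ, h⟩ = schwartzToL2 Λ (T ψ) := by
  have hle := (onSchwartz T).le_closure
  refine ⟨hle.1 (LinearMap.mem_range_self _ ψ), ?_⟩
  rw [← onSchwartz_apply T ψ]
  exact (hle.2 rfl).symm

/-- Vectors in the domain of the closure are approximated by Schwartz functions in the
graph norm. -/
theorem exists_schwartz_approx (T : SchwartzOp Λ) (Φ : (closedOp T).domain) :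
    ∃ ψ : ℕ → 𝓢(EuclideanSpace ℝ Λ, ℂ),
      Filter.Tendsto (fun n => schwartzToL2 Λ (ψ n)) Filter.atTop (nhds (Φ : HilbertL2 Λ)) ∧
      Filter.Tendsto (fun n => schwartzToL2 Λ (T (ψ n))) Filter.atTop (nhds (closedOp T Φ)) := by
  have hmem : ((Φ : HilbertL2 Λ), closedOp T Φ) ∈ closure ((onSchwartz T).graph :
      Set (HilbertL2 Λ × HilbertL2 Λ)) := by
    have hg : ((Φ : HilbertL2 Λ), closedOp T Φ) ∈ (closedOp T).graph := (closedOp T).mem_graph Φ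
    -- For a non-closable operator `LinearPMap.closure` returns the operator itself, and the
    -- approximation is then trivial; closability need not be proved.
    by_cases hc : (onSchwartz T).IsClosable
    · have hcl : (closedOp T).graph = (onSchwartz T).graph.topologicalClosure :=
        hc.graph_closure_eq_closure_graph.symm
      rw [hcl] at hg
      exact hg
    · have hcl : (closedOp T).graph = (onSchwartz T).graph := by
        rw [closedOp, LinearPMap.closure_def' hc]
      rw [hcl] at hg
      exact subset_closure hg
  obtain ⟨u, hu, hlim⟩ := mem_closure_iff_seq_limit.1 hmem
  have hex : ∀ n, ∃ ψ, schwartzToL2 Λ ψ = (u n).1 ∧ schwartzToL2 Λ (T ψ) = (u n).2 := by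
    intro n
    obtain ⟨⟨y, hy⟩, h1, h2⟩ := (LinearPMap.mem_graph_iff _).1 (hu n)
    obtain ⟨ψ, rfl⟩ := hy
    exact ⟨ψ, h1, by rw [← onSchwartz_apply T ψ]; exact h2⟩
  choose ψ h1 h2 using hex
  refine ⟨ψ, ?_, ?_⟩
  · simp only [h1]
    exact (continuous_fst.tendsto _).comp hlim
  · simp only [h2]
    exact (continuous_snd.tendsto _).comp hlim

variable [DecidableEq Λ]

/-- The Weyl operators act on Schwartz functions by the explicit formula, unless the closed
field operator generates no unitary group and the default value `1` is taken. -/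
theorem weyl_schwartz (f : Λ → ℂ) :
    (∀ ψ, weyl f (schwartzToL2 Λ ψ) =
      schwartzToL2 Λ (schwartzWeyl (fun x => (f x).re) (fun x => (f x).im) ψ)) ∨ weyl f = 1 := by
  set T : SchwartzOp Λ := ∑ x, (((f x).re : ℂ) • position x + ((f x).im : ℂ) • momentum x) with hT
  by_cases hex : ∃ U, IsUnitaryGroupOf (closedOp T) U
  · left
    set a : Λ → ℝ := fun x => (f x).re
    set b : Λ → ℝ := fun x => (f x).im
    have hw : weyl f = hex.choose 1 := by
      simp only [weyl, expI]
      rw [dif_pos hex]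
    have hU := hex.choose_spec
    have hW := weylSystem_schwartz Λ
    have hTf : ∀ ψ, T ψ = fieldOp (fun x => (position x).toLinearMap)
        (fun x => (momentum x).toLinearMap) a b ψ := by
      intro ψ
      rw [fieldOp_apply, hT]
      simp [a, b]
    intro ψ
    -- With `V` the explicit Weyl operators, the curve `y(s) = V(-sa, -sb) V(a, b) ψ` solves `y' =
    -- -iTy` exactly, so `e^{isT} y(s)` is constant. Comparing `s = 0` with `s = 1`, where `y(1) =
    -- ψ`, gives `e^{iT}ψ = V(a, b)ψ`.
    have hy : ∀ s : ℝ, HasDerivAt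
        (fun s : ℝ => schwartzToL2 Λ (schwartzWeyl ((-s) • a) ((-s) • b) (schwartzWeyl a b ψ)))
        (-(Complex.I • schwartzToL2 Λ (schwartzWeyl ((-s) • a) ((-s) • b)
          (T (schwartzWeyl a b ψ))))) s := by
      intro s
      have := (hW.hasDerivAt_V_smul a b (schwartzWeyl a b ψ) (-s)).scomp s (hasDerivAt_neg s)
      rw [neg_one_smul] at this
      rw [hTf]
      exact this
    have := hU.norm_apply_sub_le hy (fun s => by
      obtain ⟨h1, h2⟩ := closedOp_schwartz T
        (schwartzWeyl ((-s) • a) ((-s) • b) (schwartzWeyl a b ψ))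
      exact ⟨h1, h2⟩) (C := 0) (fun s => by
        rw [hTf, hTf, hW.fieldOp_V_smul, neg_add_cancel, norm_zero]) 1
    rw [zero_mul, norm_le_zero_iff, sub_eq_zero, neg_one_smul, neg_one_smul, hW.V_neg_V,
      neg_zero, zero_smul, zero_smul, hW.V_zero] at this
    rw [hw, this]
  · right
    simp only [weyl, expI]
    rw [dif_neg hex]

end Closures

/-! ### Exact correlations of Weyl operators and their bound. -/

section Correlations

variable {K : Type*} [Fintype K]

/-- The logarithm of the correlation of two Weyl operators in the ground state, as a bilinear
form on phase space. -/
def corrForm (ω A B A' B' : K → ℝ) : ℂ :=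
  ∑ k, (A k - Complex.I * ω k * B k) * (A' k + Complex.I * ω k * B' k) / (2 * ω k)

/-- The real part of `corrForm` is the cross term from polarizing the variance, and its imaginary
part is half the symplectic form, that is, the Weyl phase. -/
theorem exponent_eq {ω : K → ℝ} (hω : ∀ k, 0 < ω k) (A B A' B' : K → ℝ) :
    -(Complex.I / 2) * (symp A B A' B' : ℝ) +
      -(WeylSystem.groundVar ω (A + A') (B + B') / 2 : ℝ) =
    -(WeylSystem.groundVar ω A B / 2 : ℝ) + -(WeylSystem.groundVar ω A' B' / 2 : ℝ) -
      corrForm ω A B A' B' := by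
  simp only [symp, WeylSystem.groundVar, corrForm, Finset.sum_div, Complex.ofReal_sum,
    Finset.mul_sum, ← Finset.sum_neg_distrib, ← Finset.sum_add_distrib, ← Finset.sum_sub_distrib]
  refine Finset.sum_congr rfl fun k _ => ?_
  have hk : (ω k : ℂ) ≠ 0 := Complex.ofReal_ne_zero.2 (hω k).ne'
  simp only [Pi.add_apply]
  push_cast
  field_simp
  linear_combination (-(2 * ω k ^ 2 * B k * B' k : ℂ)) * Complex.I_sq

theorem groundVar_nonneg {ω : K → ℝ} (hω : ∀ k, 0 < ω k) (A B : K → ℝ) :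
    0 ≤ WeylSystem.groundVar ω A B :=
  Finset.sum_nonneg fun k _ => by have := hω k; positivity

theorem groundVar_flow {ω : K → ℝ} (hω : ∀ k, 0 < ω k) (A B : K → ℝ) (t : ℝ) :
    WeylSystem.groundVar ω (flowQ ω A B t) (flowP ω A B t) = WeylSystem.groundVar ω A B := by
  refine Finset.sum_congr rfl fun k _ => ?_
  have hk := (hω k).ne'
  simp only [flowQ, flowP]
  field_simp
  linear_combination (A k ^ 2 + ω k ^ 2 * B k ^ 2) * Real.sin_sq_add_cos_sq (2 * ω k * t)

/-- Along the flow the combination `A' + iωB'` is multiplied by `e^{-2iωt}`, so time enters only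
through one unimodular factor per mode. -/
theorem corrForm_flow {ω : K → ℝ} (hω : ∀ k, 0 < ω k) (A B A' B' : K → ℝ) (t : ℝ) :
    corrForm ω A B (flowQ ω A' B' t) (flowP ω A' B' t) =
      ∑ k, Complex.exp (-(2 * ω k * t : ℝ) * Complex.I) *
        ((A k - Complex.I * ω k * B k) * (A' k + Complex.I * ω k * B' k) / (2 * ω k)) := by
  refine Finset.sum_congr rfl fun k _ => ?_
  have hk : (ω k : ℂ) ≠ 0 := Complex.ofReal_ne_zero.2 (hω k).ne'
  have h1 : Complex.exp (-(2 * ω k * t : ℝ) * Complex.I) =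
      (Real.cos (2 * ω k * t) : ℂ) - Real.sin (2 * ω k * t) * Complex.I := by
    rw [← Complex.ofReal_neg, Complex.exp_mul_I, ← Complex.ofReal_cos, ← Complex.ofReal_sin,
      Real.cos_neg, Real.sin_neg]
    push_cast
    ring
  rw [h1]
  simp only [flowQ, flowP]
  push_cast
  generalize Complex.cos (2 * ω k * t) = c
  generalize Complex.sin (2 * ω k * t) = s
  field_simp
  linear_combination ((A k - Complex.I * ω k * B k) * ω k * B' k * s : ℂ) * Complex.I_sq

/-- The left half-plane is convex and `exp` has derivative of modulus at most `1` there. -/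
theorem norm_exp_sub_exp_le {z w : ℂ} (hz : z.re ≤ 0) (hw : w.re ≤ 0) :
    ‖Complex.exp z - Complex.exp w‖ ≤ ‖z - w‖ := by
  have hc : Convex ℝ {z : ℂ | z.re ≤ 0} := convex_halfSpace_re_le 0
  have := hc.norm_image_sub_le_of_norm_hasDerivWithin_le (f := Complex.exp) (C := 1)
    (fun x _ => (Complex.hasDerivAt_exp x).hasDerivWithinAt)
    (fun x hx => by rw [Complex.norm_exp]; exact Real.exp_le_one_iff.2 hx) hw hz
  simpa using this

theorem norm_exp_sub_exp_le_two {z w : ℂ} (hz : z.re ≤ 0) (hw : w.re ≤ 0) :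
    ‖Complex.exp z - Complex.exp w‖ ≤ 2 := by
  refine (norm_sub_le _ _).trans ?_
  rw [Complex.norm_exp, Complex.norm_exp]
  have := Real.exp_le_one_iff.2 hz
  have := Real.exp_le_one_iff.2 hw
  linarith

variable {S E : Type*} [AddCommGroup S] [Module ℂ S] [NormedAddCommGroup E]
  [InnerProductSpace ℂ E] [DecidableEq K] {ι : S →ₗ[ℂ] E}
  {Q P : K → S →ₗ[ℂ] S} {V : (K → ℝ) → (K → ℝ) → S →ₗ[ℂ] S}

namespace WeylSystem

/-- Expectations of products of Weyl operators in a ground state. -/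
theorem tendsto_inner_V_V (h : WeylSystem ι Q P V) {ω : K → ℝ} (hω : ∀ k, 0 < ω k) {e : ℝ}
    (he : ∀ χ, e * ‖ι χ‖ ^ 2 ≤ (inner ℂ (ι χ) (ι (modeEnergy Q P ω χ))).re)
    {ψ : ℕ → S} {Φ : E} (hΦ : ‖Φ‖ = 1)
    (hψ : Filter.Tendsto (fun n => ι (ψ n)) Filter.atTop (nhds Φ))
    (hHψ : Filter.Tendsto (fun n => ι (modeEnergy Q P ω (ψ n))) Filter.atTop
      (nhds ((e : ℂ) • Φ))) (A B A' B' : K → ℝ) :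
    Filter.Tendsto (fun n => inner ℂ (ι (ψ n)) (ι (V A B (V A' B' (ψ n))))) Filter.atTop
      (nhds (Complex.exp (-(groundVar ω A B / 2 : ℝ) + -(groundVar ω A' B' / 2 : ℝ) -
        corrForm ω A B A' B'))) := by
  have h1 := (h.tendsto_inner_V hω he hψ hHψ (A + A') (B + B')).const_mul
    (Complex.exp (-(Complex.I / 2) * (symp A B A' B' : ℝ)))
  rw [inner_self_eq_norm_sq_to_K, hΦ, RCLike.ofReal_one, one_pow, mul_one, ← Complex.exp_add,
    exponent_eq hω] at h1
  refine h1.congr fun n => ?_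
  rw [h.V_mul, map_smul, inner_smul_right]

variable [CompleteSpace E]

/-- The Heisenberg evolution of coherent states. -/
theorem tendsto_V_flow (h : WeylSystem ι Q P V) {ω : K → ℝ} (hω : ∀ k, 0 < ω k)
    {H : E →ₗ.[ℂ] E} {U : ℝ → E →L[ℂ] E} (hU : IsUnitaryGroupOf H U)
    (hH : ∀ ψ : S, ∃ hψ : ι ψ ∈ H.domain, H ⟨ι ψ, hψ⟩ = ι (modeEnergy Q P ω ψ))
    {e : ℝ} {ψ : ℕ → S} {Φ : E} (hψ : Filter.Tendsto (fun n => ι (ψ n)) Filter.atTop (nhds Φ))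
    (hHψ : Filter.Tendsto (fun n => ι (modeEnergy Q P ω (ψ n))) Filter.atTop
      (nhds ((e : ℂ) • Φ))) {A B : K → ℝ} {W : E →L[ℂ] E} (hW : ∀ ψ, W (ι ψ) = ι (V A B ψ))
    (t : ℝ) :
    Filter.Tendsto (fun n => Complex.exp (-Complex.I * e * t) •
      ι (V (flowQ ω A B t) (flowP ω A B t) (ψ n))) Filter.atTop (nhds (U (-t) (W Φ))) := by
  have h1 : Filter.Tendsto (fun n => U t (Complex.exp (-Complex.I * e * t) •
      ι (V (flowQ ω A B t) (flowP ω A B t) (ψ n))) - ι (V A B (ψ n))) Filter.atTop (nhds 0) := by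
    refine squeeze_zero_norm
      (fun n => h.norm_apply_V_flow_sub_le hω hU hH e A B (ψ n) t) ?_
    have := ((hHψ.sub (hψ.const_smul (e : ℂ))).norm).mul_const |t|
    simpa using this
  have h2 := (((U (-t)).continuous.tendsto _).comp h1).add
    ((((U (-t)).comp W).continuous.tendsto Φ).comp hψ)
  simp only [map_zero, zero_add] at h2
  refine h2.congr fun n => ?_
  simp only [Function.comp, map_sub, hU.neg_apply_apply, ContinuousLinearMap.comp_apply, hW,
    sub_add_cancel]

/-- The dynamical ground state correlation of two Weyl operators is controlled by a bilinear
form in their arguments. -/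
theorem norm_correlation_le (h : WeylSystem ι Q P V) {ω : K → ℝ} (hω : ∀ k, 0 < ω k)
    {H : E →ₗ.[ℂ] E} (hH : ∀ ψ : S, ∃ hψ : ι ψ ∈ H.domain, H ⟨ι ψ, hψ⟩ = ι (modeEnergy Q P ω ψ))
    {e : ℝ} (he : ∀ χ, e * ‖ι χ‖ ^ 2 ≤ (inner ℂ (ι χ) (ι (modeEnergy Q P ω χ))).re)
    {ψ : ℕ → S} {Φ : E} (hΦ : ‖Φ‖ = 1)
    (hψ : Filter.Tendsto (fun n => ι (ψ n)) Filter.atTop (nhds Φ))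
    (hHψ : Filter.Tendsto (fun n => ι (modeEnergy Q P ω (ψ n))) Filter.atTop
      (nhds ((e : ℂ) • Φ))) {A B A' B' : K → ℝ} {W W' : E →L[ℂ] E}
    (hW : ∀ ψ, W (ι ψ) = ι (V A B ψ)) (hW' : ∀ ψ, W' (ι ψ) = ι (V A' B' ψ)) (t : ℝ) :
    ∃ s, ‖inner ℂ Φ ((heisenberg H t W * W') Φ) - inner ℂ Φ (W Φ) * inner ℂ Φ (W' Φ)‖ ≤
      min 2 ‖corrForm ω A B (flowQ ω A' B' s) (flowP ω A' B' s)‖ := by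
  have hexp : ∀ {A B : K → ℝ} {W : E →L[ℂ] E}, (∀ ψ, W (ι ψ) = ι (V A B ψ)) →
      inner ℂ Φ (W Φ) = Complex.exp (-(groundVar ω A B / 2 : ℝ)) := by
    intro A B W hW
    have h1 := h.tendsto_inner_V hω he hψ hHψ A B
    rw [inner_self_eq_norm_sq_to_K, hΦ, RCLike.ofReal_one, one_pow, mul_one] at h1
    refine tendsto_nhds_unique (hψ.inner ((W.continuous.tendsto Φ).comp hψ)) ?_
    refine h1.congr fun n => ?_
    simp only [Function.comp, hW]
  suffices hs : ∃ s, inner ℂ Φ ((heisenberg H t W * W') Φ) =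
      Complex.exp (-(groundVar ω A B / 2 : ℝ) + -(groundVar ω A' B' / 2 : ℝ) -
        corrForm ω A B (flowQ ω A' B' s) (flowP ω A' B' s)) by
    obtain ⟨s, hs⟩ := hs
    refine ⟨s, ?_⟩
    rw [hexp hW, hexp hW', hs, ← Complex.exp_add]
    have hw : (-((groundVar ω A B / 2 : ℝ) : ℂ) + -((groundVar ω A' B' / 2 : ℝ) : ℂ)).re ≤ 0 := by
      have := groundVar_nonneg hω A B
      have := groundVar_nonneg hω A' B'
      simp only [Complex.add_re, Complex.neg_re, Complex.ofReal_re]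
      linarith
    -- The real part of `corrForm` can have either sign, but by `exponent_eq` the whole exponent is
    -- a phase minus half the variance of the summed arguments.
    have hz : (-((groundVar ω A B / 2 : ℝ) : ℂ) + -((groundVar ω A' B' / 2 : ℝ) : ℂ) -
        corrForm ω A B (flowQ ω A' B' s) (flowP ω A' B' s)).re ≤ 0 := by
      have h1 := exponent_eq hω A B (flowQ ω A' B' s) (flowP ω A' B' s)
      rw [groundVar_flow hω] at h1
      rw [← h1]
      have := groundVar_nonneg hω (A + flowQ ω A' B' s) (B + flowP ω A' B' s)
      simp
      linarith
    refine le_min (norm_exp_sub_exp_le_two hz hw) ((norm_exp_sub_exp_le hz hw).trans_eq ?_)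
    rw [sub_sub_cancel_left, norm_neg]
  have hstat : ∀ s, Filter.Tendsto (fun n => inner ℂ (ι (ψ n))
      (W (ι (V (flowQ ω A' B' s) (flowP ω A' B' s) (ψ n))))) Filter.atTop
      (nhds (Complex.exp (-(groundVar ω A B / 2 : ℝ) + -(groundVar ω A' B' / 2 : ℝ) -
        corrForm ω A B (flowQ ω A' B' s) (flowP ω A' B' s)))) := by
    intro s
    have := h.tendsto_inner_V_V hω he hΦ hψ hHψ A B (flowQ ω A' B' s) (flowP ω A' B' s)
    rw [groundVar_flow hω] at this
    simpa only [hW] using this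
  by_cases hex : ∃ U, IsUnitaryGroupOf H U
  · refine ⟨t, ?_⟩
    have hU := hex.choose_spec
    set U := hex.choose
    have hheis : inner ℂ Φ ((heisenberg H t W * W') Φ) =
        inner ℂ (U (-t) ((1 : E →L[ℂ] E) Φ)) (W (U (-t) (W' Φ))) := by
      rw [heisenberg, expI, dif_pos hex]
      exact hU.inner_apply t _ _
    rw [hheis]
    have h1 := h.tendsto_V_flow hω hU hH hψ hHψ hW' t
    -- The trivial Weyl operator gives the evolution of `Φ` itself with the same phase `e^{-iet}`,
    -- which cancels in the inner product.
    have h2 := h.tendsto_V_flow hω hU hH hψ hHψ (A := 0) (B := 0) (W := 1)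
      (fun ψ => by rw [h.V_zero]; rfl) t
    have h00 : flowQ ω (0 : K → ℝ) 0 t = 0 := by funext k; simp [flowQ]
    have h01 : flowP ω (0 : K → ℝ) 0 t = 0 := by funext k; simp [flowP]
    simp only [h00, h01, h.V_zero] at h2
    refine tendsto_nhds_unique (h2.inner ((W.continuous.tendsto _).comp h1)) ?_
    refine (hstat t).congr fun n => ?_
    simp only [Function.comp, map_smul, inner_smul_left, inner_smul_right]
    have hn : (starRingEnd ℂ) (Complex.exp (-Complex.I * e * t)) *
        Complex.exp (-Complex.I * e * t) = 1 := by
      rw [← Complex.exp_conj, ← Complex.exp_add]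
      simp
    rw [← mul_assoc, mul_comm _ ((starRingEnd ℂ) _), hn, one_mul]
  -- If `H` generates no group, `expI` is constantly `1`, and the correlation equals the one at time
  -- `0`.
  · refine ⟨0, ?_⟩
    have hheis : inner ℂ Φ ((heisenberg H t W * W') Φ) = inner ℂ Φ (W (W' Φ)) := by
      rw [heisenberg, expI, dif_neg hex]
      rfl
    rw [hheis]
    have h00 : flowQ ω A' B' 0 = A' := by funext k; simp [flowQ]
    have h01 : flowP ω A' B' 0 = B' := by funext k; simp [flowP]
    have h1 := hstat 0
    rw [h00, h01] at h1 ⊢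
    refine tendsto_nhds_unique (hψ.inner ((W.comp W').continuous.tendsto Φ |>.comp hψ)) ?_
    refine h1.congr fun n => ?_
    simp only [Function.comp, ContinuousLinearMap.comp_apply, hW']

end WeylSystem

end Correlations

/-! ### Spectral decomposition of real symmetric matrices, entrywise. -/

section Eigenvectors

variable {n : Type*} [Fintype n] [DecidableEq n] {A : Matrix n n ℝ} (hA : A.IsHermitian)

theorem sum_eigenvectorBasis_mul (k l : n) :
    ∑ x, hA.eigenvectorBasis k x * hA.eigenvectorBasis l x = if k = l then 1 else 0 := by
  have := orthonormal_iff_ite.1 hA.eigenvectorBasis.orthonormal k l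
  rw [← this, PiLp.inner_apply]
  exact Finset.sum_congr rfl fun x _ => by simp [mul_comm]

theorem sum_eigenvectorBasis_mul' (x y : n) :
    ∑ k, hA.eigenvectorBasis k x * hA.eigenvectorBasis k y = if x = y then 1 else 0 := by
  have h := hA.eigenvectorBasis.sum_inner_mul_inner (EuclideanSpace.single x (1 : ℝ))
    (EuclideanSpace.single y 1)
  simp only [EuclideanSpace.inner_single_left, EuclideanSpace.inner_single_right] at h
  simpa [Pi.single_apply, eq_comm (a := y)] using h

theorem apply_eq_sum_eigenvalues (x y : n) :
    A x y = ∑ k, hA.eigenvalues k * hA.eigenvectorBasis k x * hA.eigenvectorBasis k y := by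
  have h : ∀ k, hA.eigenvalues k * hA.eigenvectorBasis k x =
      ∑ z, A x z * hA.eigenvectorBasis k z := by
    intro k
    have := congrFun (hA.mulVec_eigenvectorBasis k) x
    simp only [Matrix.mulVec, dotProduct, Pi.smul_apply, smul_eq_mul] at this
    exact this.symm
  simp only [h, Finset.sum_mul]
  rw [Finset.sum_comm]
  simp only [mul_assoc, ← Finset.mul_sum, sum_eigenvectorBasis_mul']
  simp

end Eigenvectors

/-- A combination of squares of linear combinations, expanded. -/
theorem sum_smul_combination {S K Λ : Type*} [AddCommGroup S] [Module ℂ S] [Fintype K] [Fintype Λ]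
    (w : K → ℝ) (c : K → Λ → ℝ) (T : Λ → S →ₗ[ℂ] S) (ψ : S) :
    ∑ k, (w k : ℂ) • (∑ x, (c k x : ℂ) • T x) ((∑ x, (c k x : ℂ) • T x) ψ) =
      ∑ x, ∑ y, ((∑ k, w k * (c k x * c k y) : ℝ) : ℂ) • T x (T y ψ) := by
  simp only [LinearMap.sum_apply, LinearMap.smul_apply, map_sum, map_smul, Finset.smul_sum,
    smul_smul, Complex.ofReal_sum, Complex.ofReal_mul, Finset.sum_smul]
  conv_rhs => rw [Finset.sum_comm]
  rw [Finset.sum_comm]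
  refine Finset.sum_congr rfl fun x _ => ?_
  rw [Finset.sum_comm]
  refine Finset.sum_congr rfl fun y _ => Finset.sum_congr rfl fun k _ => ?_
  rw [mul_comm (c k x : ℂ)]

/-! ### Normal modes of the oscillator Hamiltonian. -/

namespace Params

variable {d : ℕ} (p : Params d) (L : ℕ)

/-- The coupling of two sites of the box, zero unless they are nearest neighbours. -/
def bond (x y : Box d L) : ℝ :=
  if dist1 (x : Fin d → ℤ) y = 1 then p.coupling s((x : Fin d → ℤ), (y : Fin d → ℤ)) else 0

theorem dist1_comm {d : ℕ} (x y : Fin d → ℤ) : dist1 x y = dist1 y x := by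
  simp [dist1, abs_sub_comm]

theorem bond_comm (x y : Box d L) : p.bond L x y = p.bond L y x := by
  simp only [bond, dist1_comm (y : Fin d → ℤ) x, Sym2.eq_swap]

/-- One formula serves on and off the diagonal because `bond` vanishes at equal sites. -/
theorem h0_apply (x y : Box d L) :
    p.h0 L x y = (if x = y then p.spring x / 2 + ∑ u, p.bond L x u else 0) - p.bond L x y := by
  by_cases hxy : x = y
  · subst hxy
    have : dist1 (x : Fin d → ℤ) x ≠ 1 := by simp [dist1]
    simp [h0, bond, this]
  · by_cases h1 : dist1 (x : Fin d → ℤ) y = 1 <;> simp [h0, bond, hxy, h1]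

/-- The potential energy as a quadratic form. -/
theorem sum_h0_mul (q : Box d L → ℝ) :
    ∑ x, ∑ y, p.h0 L x y * (q x * q y) =
      ∑ x : Box d L, p.spring x / 2 * q x ^ 2 + 1 / 2 * ∑ x, ∑ y, p.bond L x y * (q x - q y) ^ 2 := by
  have e1 : ∑ x, ∑ y, p.bond L x y * q y ^ 2 = ∑ x, ∑ y, p.bond L x y * q x ^ 2 := by
    rw [Finset.sum_comm]
    exact Finset.sum_congr rfl fun x _ => Finset.sum_congr rfl fun y _ => by rw [bond_comm]
  have e2 : ∑ x, ∑ y, p.bond L x y * (q x - q y) ^ 2 =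
      2 * ∑ x, ∑ y, p.bond L x y * q x ^ 2 - 2 * ∑ x, ∑ y, p.bond L x y * (q x * q y) := by
    calc ∑ x, ∑ y, p.bond L x y * (q x - q y) ^ 2 =
        ∑ x, ∑ y, (p.bond L x y * q x ^ 2 + p.bond L x y * q y ^ 2 -
          2 * (p.bond L x y * (q x * q y))) :=
          Finset.sum_congr rfl fun x _ => Finset.sum_congr rfl fun y _ => by ring
      _ = _ := by
        simp only [Finset.sum_add_distrib, Finset.sum_sub_distrib, ← Finset.mul_sum, e1]
        ring
  rw [e2]
  simp only [h0_apply, sub_mul, ite_mul, zero_mul, Finset.sum_sub_distrib, Finset.sum_ite_eq,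
    Finset.mem_univ, if_true, add_mul, Finset.sum_add_distrib, Finset.sum_mul]
  simp only [← pow_two]
  ring

variable {p L}

theorem sqrtMu_pos (hm : ∀ x, 0 < p.mass x) (x : Fin d → ℤ) :
    0 < Real.sqrt (1 / (2 * p.mass x)) := by
  have := hm x
  positivity

theorem h_apply (x y : Box d L) :
    p.h L x y = Real.sqrt (1 / (2 * p.mass x)) * p.h0 L x y * Real.sqrt (1 / (2 * p.mass y)) := by
  simp [h, sqrtMu, Matrix.mul_diagonal, Matrix.diagonal_mul]

theorem h_posDef (hm : ∀ x, 0 < p.mass x) (hpos : (p.h0 L).PosDef) : (p.h L).PosDef := by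
  have hs : (p.sqrtMu L).conjTranspose = p.sqrtMu L := by simp [sqrtMu]
  have hinj : Function.Injective (p.sqrtMu L).mulVec := by
    intro u v huv
    funext x
    have := congrFun huv x
    simp only [sqrtMu, Matrix.mulVec_diagonal] at this
    exact mul_left_cancel₀ (sqrtMu_pos hm x).ne' this
  have := hpos.conjTranspose_mul_mul_same hinj
  rwa [hs] at this

/-- The frequencies of the normal modes. -/
def freq (p : Params d) (L : ℕ) (k : Box d L) : ℝ := Real.sqrt ((p.h_isHermitian L).eigenvalues k)

theorem freq_pos (hm : ∀ x, 0 < p.mass x) (hpos : (p.h0 L).PosDef) (k : Box d L) :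
    0 < p.freq L k :=
  Real.sqrt_pos.2 ((h_posDef hm hpos).eigenvalues_pos k)

/-- The normal coordinates are `Qₖ = ∑ₓ modeQ k x qₓ`. -/
def modeQ (p : Params d) (L : ℕ) (k x : Box d L) : ℝ :=
  (p.h_isHermitian L).eigenvectorBasis k x / Real.sqrt (1 / (2 * p.mass x))

/-- The normal momenta are `Pₖ = ∑ₓ modeP k x pₓ`. -/
def modeP (p : Params d) (L : ℕ) (k x : Box d L) : ℝ :=
  (p.h_isHermitian L).eigenvectorBasis k x * Real.sqrt (1 / (2 * p.mass x))

theorem sum_modeQ_modeP (hm : ∀ x, 0 < p.mass x) (k l : Box d L) :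
    ∑ x, p.modeQ L k x * p.modeP L l x = if k = l then 1 else 0 := by
  rw [← sum_eigenvectorBasis_mul (p.h_isHermitian L)]
  refine Finset.sum_congr rfl fun x _ => ?_
  have := (sqrtMu_pos hm x).ne'
  rw [modeQ, modeP]
  field_simp

theorem sum_modeQ_modeP' (hm : ∀ x, 0 < p.mass x) (x y : Box d L) :
    ∑ k, p.modeP L k x * p.modeQ L k y = if x = y then 1 else 0 := by
  have h := sum_eigenvectorBasis_mul' (p.h_isHermitian L) x y
  calc ∑ k, p.modeP L k x * p.modeQ L k y =
      Real.sqrt (1 / (2 * p.mass x)) / Real.sqrt (1 / (2 * p.mass y)) *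
        ∑ k, (p.h_isHermitian L).eigenvectorBasis k x * (p.h_isHermitian L).eigenvectorBasis k y := by
        rw [Finset.mul_sum]
        exact Finset.sum_congr rfl fun k _ => by rw [modeQ, modeP]; ring
    _ = if x = y then 1 else 0 := by
        rw [h]
        split_ifs with hxy
        · subst hxy
          rw [div_self (sqrtMu_pos hm x).ne', mul_one]
        · rw [mul_zero]

theorem sum_modeP_modeP (hm : ∀ x, 0 < p.mass x) (x y : Box d L) :
    ∑ k, p.modeP L k x * p.modeP L k y = if x = y then 1 / (2 * p.mass x) else 0 := by
  have h := sum_eigenvectorBasis_mul' (p.h_isHermitian L) x y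
  calc ∑ k, p.modeP L k x * p.modeP L k y =
      Real.sqrt (1 / (2 * p.mass x)) * Real.sqrt (1 / (2 * p.mass y)) *
        ∑ k, (p.h_isHermitian L).eigenvectorBasis k x * (p.h_isHermitian L).eigenvectorBasis k y := by
        rw [Finset.mul_sum]
        exact Finset.sum_congr rfl fun k _ => by rw [modeP, modeP]; ring
    _ = if x = y then 1 / (2 * p.mass x) else 0 := by
        rw [h]
        split_ifs with hxy
        · subst hxy
          rw [mul_one, Real.mul_self_sqrt]
          have := hm x
          positivity
        · rw [mul_zero]

/-- The division by `μ^{1/2}` in `modeQ` undoes the conjugation that turns `h0` into `h`, so the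
spectral decomposition of `h` becomes one of `h0`. -/
theorem sum_freq_modeQ_modeQ (hm : ∀ x, 0 < p.mass x) (hpos : (p.h0 L).PosDef) (x y : Box d L) :
    ∑ k, p.freq L k ^ 2 * (p.modeQ L k x * p.modeQ L k y) = p.h0 L x y := by
  have hx := (sqrtMu_pos hm x).ne'
  have hy := (sqrtMu_pos hm y).ne'
  have h := apply_eq_sum_eigenvalues (p.h_isHermitian L) x y
  rw [h_apply] at h
  have h2 : p.h0 L x y = (∑ k, (p.h_isHermitian L).eigenvalues k *
      (p.h_isHermitian L).eigenvectorBasis k x * (p.h_isHermitian L).eigenvectorBasis k y) /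
      (Real.sqrt (1 / (2 * p.mass x)) * Real.sqrt (1 / (2 * p.mass y))) := by
    rw [← h]
    field_simp
  rw [h2, Finset.sum_div]
  refine Finset.sum_congr rfl fun k _ => ?_
  rw [freq, Real.sq_sqrt ((h_posDef hm hpos).eigenvalues_pos k).le, modeQ, modeQ]
  field_simp

/-- The normal coordinates, as operators on Schwartz functions. -/
def opQ (p : Params d) (L : ℕ) (k : Box d L) :
    𝓢(EuclideanSpace ℝ (Box d L), ℂ) →ₗ[ℂ] 𝓢(EuclideanSpace ℝ (Box d L), ℂ) :=
  ∑ x, (p.modeQ L k x : ℂ) • (position x).toLinearMap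

/-- The normal momenta, as operators on Schwartz functions. -/
def opP (p : Params d) (L : ℕ) (k : Box d L) :
    𝓢(EuclideanSpace ℝ (Box d L), ℂ) →ₗ[ℂ] 𝓢(EuclideanSpace ℝ (Box d L), ℂ) :=
  ∑ x, (p.modeP L k x : ℂ) • (momentum x).toLinearMap

/-- The Weyl operators in normal coordinates. -/
def opV (p : Params d) (L : ℕ) (A B : Box d L → ℝ) :
    𝓢(EuclideanSpace ℝ (Box d L), ℂ) →ₗ[ℂ] 𝓢(EuclideanSpace ℝ (Box d L), ℂ) :=
  schwartzWeyl (fun x => ∑ k, A k * p.modeQ L k x) (fun x => ∑ k, B k * p.modeP L k x)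

theorem weylSystem_modes (hm : ∀ x, 0 < p.mass x) :
    WeylSystem (schwartzToL2 (Box d L)) (p.opQ L) (p.opP L) (p.opV L) :=
  (weylSystem_schwartz (Box d L)).transform (p.modeQ L) (p.modeP L) (sum_modeQ_modeP hm)

theorem hamiltonianSchwartz_eq_sum (ψ : 𝓢(EuclideanSpace ℝ (Box d L), ℂ)) :
    p.hamiltonianSchwartz L ψ =
      ∑ x : Box d L, ((1 / (2 * p.mass x) : ℝ) : ℂ) • momentum x (momentum x ψ) +
      ∑ x, ∑ y, (p.h0 L x y : ℂ) • position x (position y ψ) := by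
  ext q
  have hpot : (∑ x, ∑ y, (p.h0 L x y : ℂ) • position x (position y ψ)) q =
      ((∑ x, ∑ y, p.h0 L x y * (q x * q y) : ℝ) : ℂ) * ψ q := by
    simp only [sum_apply, smul_apply, position_apply, smul_eq_mul, Complex.ofReal_sum,
      Complex.ofReal_mul, Finset.sum_mul, mul_assoc]
  rw [add_apply, hpot, sum_h0_mul]
  simp only [hamiltonianSchwartz, add_apply, smul_apply, sum_apply, pow_two,
    mul_apply_eq_comp, Finset.sum_add_distrib]
  simp only [position_apply, smul_eq_mul]
  rw [add_assoc]
  congr 1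
  push_cast
  rw [add_mul, Finset.sum_mul, mul_assoc (1 / 2 : ℂ), Finset.sum_mul]
  congr 1
  · exact Finset.sum_congr rfl fun x _ => by ring
  · congr 1
    refine Finset.sum_congr rfl fun x _ => ?_
    rw [Finset.sum_mul]
    refine Finset.sum_congr rfl fun y _ => ?_
    by_cases hxy : dist1 (x : Fin d → ℤ) y = 1
    · simp only [bond, hxy, if_true, smul_apply, mul_apply_eq_comp, sub_apply, position_apply,
        smul_eq_mul]
      ring
    · simp [bond, hxy]

/-- The normal momenta reproduce the kinetic matrix `μ` (`sum_modeP_modeP`) and the weighted normal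
coordinates reproduce `h0` (`sum_freq_modeQ_modeQ`). -/
theorem hamiltonianSchwartz_eq (hm : ∀ x, 0 < p.mass x) (hpos : (p.h0 L).PosDef)
    (ψ : 𝓢(EuclideanSpace ℝ (Box d L), ℂ)) :
    p.hamiltonianSchwartz L ψ = modeEnergy (p.opQ L) (p.opP L) (p.freq L) ψ := by
  have hP := sum_smul_combination (fun _ => 1) (p.modeP L)
    (fun x : Box d L => (momentum x).toLinearMap) ψ
  have hQ := sum_smul_combination (fun k => p.freq L k ^ 2) (p.modeQ L)
    (fun x : Box d L => (position x).toLinearMap) ψ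
  simp only [one_mul, Complex.ofReal_one, one_smul, sum_modeP_modeP hm] at hP
  simp only [Complex.ofReal_pow, sum_freq_modeQ_modeQ hm hpos] at hQ
  rw [modeEnergy_apply, Finset.sum_add_distrib, hamiltonianSchwartz_eq_sum]
  refine congrArg₂ (· + ·) (Eq.trans ?_ hP.symm) hQ.symm
  refine Finset.sum_congr rfl fun x _ => ?_
  rw [Finset.sum_eq_single x]
  · rw [if_pos rfl]; rfl
  · intro y _ hy
    rw [if_neg (Ne.symm hy), Complex.ofReal_zero, zero_smul]
  · simp

end Params

/-! ### Weyl correlations of the model and their wave kernels. -/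

namespace Params

variable {d : ℕ} {p : Params d} {L : ℕ}

/-- The logarithm of the dynamical correlation of two Weyl operators. -/
def corrExponent (p : Params d) (L : ℕ) (f g : Box d L → ℂ) (t : ℝ) : ℂ :=
  ∑ k, Complex.exp (-(2 * p.freq L k * t : ℝ) * Complex.I) *
    ((((∑ x, p.modeP L k x * (f x).re : ℝ) : ℂ) -
        Complex.I * p.freq L k * ((∑ x, p.modeQ L k x * (f x).im : ℝ) : ℂ)) *
      (((∑ x, p.modeP L k x * (g x).re : ℝ) : ℂ) +
        Complex.I * p.freq L k * ((∑ x, p.modeQ L k x * (g x).im : ℝ) : ℂ)) / (2 * p.freq L k))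

/-- Since `modeQ` and `modeP` are dual bases, every site coefficient is recovered from its mode
coefficients; each `W(f)` is thus covered. -/
theorem opV_modes (hm : ∀ x, 0 < p.mass x) (a b : Box d L → ℝ) :
    p.opV L (fun k => ∑ x, p.modeP L k x * a x) (fun k => ∑ x, p.modeQ L k x * b x) =
      schwartzWeyl a b := by
  rw [opV]
  congr 1
  · funext x
    simp only [Finset.sum_mul]
    rw [Finset.sum_comm]
    calc ∑ y, ∑ k, p.modeP L k y * a y * p.modeQ L k x
        = ∑ y, a y * ∑ k, p.modeP L k y * p.modeQ L k x := by
          refine Finset.sum_congr rfl fun y _ => ?_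
          rw [Finset.mul_sum]
          exact Finset.sum_congr rfl fun k _ => by ring
      _ = a x := by
          simp only [sum_modeQ_modeP' hm, mul_ite, mul_one, mul_zero, Finset.sum_ite_eq',
            Finset.mem_univ, if_true]
  · funext x
    simp only [Finset.sum_mul]
    rw [Finset.sum_comm]
    calc ∑ y, ∑ k, p.modeQ L k y * b y * p.modeP L k x
        = ∑ y, b y * ∑ k, p.modeP L k x * p.modeQ L k y := by
          refine Finset.sum_congr rfl fun y _ => ?_
          rw [Finset.mul_sum]
          exact Finset.sum_congr rfl fun k _ => by ring
      _ = b x := by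
          simp only [sum_modeQ_modeP' hm, mul_ite, mul_one, mul_zero, Finset.sum_ite_eq,
            Finset.mem_univ, if_true]

theorem hamiltonian_schwartz (hm : ∀ x, 0 < p.mass x) (hpos : (p.h0 L).PosDef)
    (ψ : 𝓢(EuclideanSpace ℝ (Box d L), ℂ)) :
    ∃ hψ : schwartzToL2 (Box d L) ψ ∈ (p.hamiltonian L).domain,
      p.hamiltonian L ⟨schwartzToL2 (Box d L) ψ, hψ⟩ =
        schwartzToL2 (Box d L) (modeEnergy (p.opQ L) (p.opP L) (p.freq L) ψ) := by
  rw [← hamiltonianSchwartz_eq hm hpos]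
  exact closedOp_schwartz _ ψ

/-- The dynamical correlation of Weyl operators is bounded by its exponent. -/
theorem norm_weylCorrelation_le (hm : ∀ x, 0 < p.mass x) (hpos : (p.h0 L).PosDef)
    (f g : Box d L → ℂ) (t : ℝ) :
    ∃ s, ‖weylCorrelation p L f g t‖ ≤ min 2 ‖p.corrExponent L f g s‖ := by
  by_cases hex : ∃ Φ, IsGroundState (p.hamiltonian L) Φ
  swap
  -- Without a ground state `groundState` is `0`, so the correlation vanishes.
  · refine ⟨0, ?_⟩
    have h0 : groundState (p.hamiltonian L) = 0 := by rw [groundState, dif_neg hex]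
    simp [weylCorrelation, groundExpectation, h0]
  have hΦ := hex.choose_spec
  have hgs : groundState (p.hamiltonian L) = hex.choose := by rw [groundState, dif_pos hex]
  obtain ⟨hnorm, e, ⟨hdom, heig⟩, hmin⟩ := hΦ
  obtain ⟨ψ, hψ, hHψ⟩ := exists_schwartz_approx (p.hamiltonianSchwartz L) ⟨_, hdom⟩
  have hHψ' : Filter.Tendsto (fun n => schwartzToL2 (Box d L)
      (modeEnergy (p.opQ L) (p.opP L) (p.freq L) (ψ n))) Filter.atTop
      (nhds ((e : ℂ) • hex.choose)) := by
    rw [← heig]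
    simp only [← hamiltonianSchwartz_eq hm hpos]
    exact hHψ
  have hW := weylSystem_modes (L := L) hm
  have hω := freq_pos hm hpos
  have hH := hamiltonian_schwartz hm hpos
  have he : ∀ χ, e * ‖schwartzToL2 (Box d L) χ‖ ^ 2 ≤ (inner ℂ (schwartzToL2 (Box d L) χ)
      (schwartzToL2 (Box d L) (modeEnergy (p.opQ L) (p.opP L) (p.freq L) χ))).re := by
    intro χ
    obtain ⟨h1, h2⟩ := hH χ
    rw [← h2]
    exact hmin ⟨_, h1⟩
  -- The default value `1` of `weyl` is the Weyl operator at the origin. The bilinear exponent is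
  -- then `0`, so the correlation vanishes and any bound holds.
  have hone : ∀ χ, (1 : HilbertL2 (Box d L) →L[ℂ] HilbertL2 (Box d L)) (schwartzToL2 (Box d L) χ) =
      schwartzToL2 (Box d L) (p.opV L 0 0 χ) := fun χ => by rw [hW.V_zero]; rfl
  have hweyl : ∀ f : Box d L → ℂ, (∀ χ, weyl f (schwartzToL2 (Box d L) χ) =
      schwartzToL2 (Box d L) (p.opV L (fun k => ∑ x, p.modeP L k x * (f x).re)
        (fun k => ∑ x, p.modeQ L k x * (f x).im) χ)) ∨ weyl f = 1 := by
    intro f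
    rw [opV_modes hm]
    exact weyl_schwartz f
  rw [weylCorrelation, groundExpectation, groundExpectation, groundExpectation, hgs]
  rcases hweyl f with hf | hf
  · rcases hweyl g with hg | hg
    · obtain ⟨s, hs⟩ := hW.norm_correlation_le hω hH he hnorm hψ hHψ' hf hg t
      refine ⟨s, ?_⟩
      rw [corrForm_flow hω] at hs
      exact hs
    · obtain ⟨s, hs⟩ := hW.norm_correlation_le hω hH he hnorm hψ hHψ' hf hone t
      refine ⟨s, ?_⟩
      rw [corrForm_flow hω] at hs
      rw [hg]
      refine hs.trans (min_le_min_left _ ?_)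
      simp
  · have hg : ∃ A B, ∀ χ, weyl g (schwartzToL2 (Box d L) χ) =
        schwartzToL2 (Box d L) (p.opV L A B χ) := by
      rcases hweyl g with hg | hg
      · exact ⟨_, _, hg⟩
      · exact ⟨0, 0, by rw [hg]; exact hone⟩
    obtain ⟨A, B, hg⟩ := hg
    obtain ⟨s, hs⟩ := hW.norm_correlation_le hω hH he hnorm hψ hHψ' hone hg t
    refine ⟨s, ?_⟩
    rw [corrForm_flow hω] at hs
    rw [hf]
    refine hs.trans (min_le_min_left _ ?_)
    simp

/-- The kernel of `h_L^α e^{-2it√h_L}`. -/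
def waveKernel (p : Params d) (L : ℕ) (α t : ℝ) (x y : Box d L) : ℂ :=
  matrixFun (p.h_isHermitian L)
    (fun s => ((s ^ α : ℝ) : ℂ) * Complex.exp (-(2 * Real.sqrt s * t : ℝ) * Complex.I)) x y

/-- Multiplying out, mode `k` carries a factor `1/ωₖ`, `1` or `ωₖ` according to how many imaginary
parts occur. These are the powers `-1/2`, `0`, `1/2` of the eigenvalue `ωₖ²`; the masses stay
outside the kernels. -/
theorem corrExponent_eq (hm : ∀ x, 0 < p.mass x) (hpos : (p.h0 L).PosDef)
    (f g : Box d L → ℂ) (t : ℝ) :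
    p.corrExponent L f g t = ∑ x : Box d L, ∑ y : Box d L, (1 / 2 : ℂ) *
      ((Real.sqrt (1 / (2 * p.mass x)) * (f x).re * (Real.sqrt (1 / (2 * p.mass y)) * (g y).re)) *
          p.waveKernel L (-1 / 2) t x y +
        Complex.I * (Real.sqrt (1 / (2 * p.mass x)) * (f x).re *
          ((g y).im / Real.sqrt (1 / (2 * p.mass y)))) * p.waveKernel L 0 t x y -
        Complex.I * ((f x).im / Real.sqrt (1 / (2 * p.mass x)) *
          (Real.sqrt (1 / (2 * p.mass y)) * (g y).re)) * p.waveKernel L 0 t x y +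
        ((f x).im / Real.sqrt (1 / (2 * p.mass x)) * ((g y).im / Real.sqrt (1 / (2 * p.mass y)))) *
          p.waveKernel L (1 / 2) t x y) := by
  have hexp : ∀ k, Complex.exp (-(2 * p.freq L k * t : ℝ) * Complex.I) *
    ((((∑ x, p.modeP L k x * (f x).re : ℝ) : ℂ) -
        Complex.I * p.freq L k * ((∑ x, p.modeQ L k x * (f x).im : ℝ) : ℂ)) *
      (((∑ x, p.modeP L k x * (g x).re : ℝ) : ℂ) +
        Complex.I * p.freq L k * ((∑ x, p.modeQ L k x * (g x).im : ℝ) : ℂ)) / (2 * p.freq L k)) =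
    ∑ x, ∑ y, Complex.exp (-(2 * p.freq L k * t : ℝ) * Complex.I) *
      ((p.modeP L k x * (f x).re - Complex.I * p.freq L k * (p.modeQ L k x * (f x).im)) *
      (p.modeP L k y * (g y).re + Complex.I * p.freq L k * (p.modeQ L k y * (g y).im)) /
        (2 * p.freq L k)) := by
    intro k
    simp only [← Finset.mul_sum, ← Finset.sum_div]
    rw [← Finset.sum_mul]
    simp only [Finset.sum_sub_distrib, Finset.sum_add_distrib, ← Finset.mul_sum]
    push_cast
    rfl
  rw [corrExponent]
  simp only [hexp]
  rw [Finset.sum_comm]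
  refine Finset.sum_congr rfl fun x _ => ?_
  rw [Finset.sum_comm]
  refine Finset.sum_congr rfl fun y _ => ?_
  simp only [waveKernel, matrixFun, Matrix.of_apply, Finset.mul_sum, ← Finset.sum_add_distrib,
    ← Finset.sum_sub_distrib]
  refine Finset.sum_congr rfl fun k _ => ?_
  have hk := freq_pos hm hpos k
  have hlam := (h_posDef hm hpos).eigenvalues_pos k
  have e1 : ((p.h_isHermitian L).eigenvalues k) ^ (-1 / 2 : ℝ) = 1 / p.freq L k := by
    rw [freq, Real.sqrt_eq_rpow, neg_div, Real.rpow_neg hlam.le, inv_eq_one_div]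
  have e2 : ((p.h_isHermitian L).eigenvalues k) ^ (1 / 2 : ℝ) = p.freq L k := by
    rw [freq, Real.sqrt_eq_rpow]
  have e3 : Real.sqrt ((p.h_isHermitian L).eigenvalues k) = p.freq L k := rfl
  rw [e1, e2, e3, Real.rpow_zero]
  simp only [modeP, modeQ]
  have hx : (Real.sqrt (1 / (2 * p.mass x)) : ℂ) ≠ 0 :=
    Complex.ofReal_ne_zero.2 (sqrtMu_pos hm x).ne'
  have hy : (Real.sqrt (1 / (2 * p.mass y)) : ℂ) ≠ 0 :=
    Complex.ofReal_ne_zero.2 (sqrtMu_pos hm y).ne'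
  have hk' : (p.freq L k : ℂ) ≠ 0 := Complex.ofReal_ne_zero.2 hk.ne'
  generalize Complex.exp (-(2 * p.freq L k * t : ℝ) * Complex.I) = z
  push_cast
  generalize (Real.sqrt (1 / (2 * p.mass x)) : ℂ) = σ at *
  generalize (Real.sqrt (1 / (2 * p.mass y)) : ℂ) = τ at *
  generalize (p.freq L k : ℂ) = w at *
  field_simp
  ring_nf
  simp only [Complex.I_sq]
  ring

end Params

/-! ### Measurability of functions of a random matrix. -/

section Measurability

theorem pow_apply_eq_sum_eigenvalues {n : Type*} [Fintype n] [DecidableEq n] {A : Matrix n n ℝ}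
    (hA : A.IsHermitian) (i : ℕ) (x y : n) :
    (A ^ i) x y = ∑ k, hA.eigenvalues k ^ i * hA.eigenvectorBasis k x * hA.eigenvectorBasis k y := by
  induction i generalizing x with
  | zero => simp [sum_eigenvectorBasis_mul', Matrix.one_apply]
  | succ i ih =>
    rw [pow_succ', Matrix.mul_apply]
    simp only [ih, Finset.mul_sum]
    rw [Finset.sum_comm]
    refine Finset.sum_congr rfl fun k _ => ?_
    have := congrFun (hA.mulVec_eigenvectorBasis k) x
    simp only [Matrix.mulVec, dotProduct, Pi.smul_apply, smul_eq_mul] at this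
    rw [pow_succ, mul_assoc (_ ^ i), ← this, Finset.mul_sum, Finset.sum_mul]
    exact Finset.sum_congr rfl fun z _ => by ring

variable {Ω n : Type*} [MeasurableSpace Ω] [Fintype n] [DecidableEq n]
  {A : Ω → Matrix n n ℝ} (hA : ∀ ω, (A ω).IsHermitian)

/-- The functional calculus of a random matrix is measurable, for continuous real functions. -/
theorem measurable_sum_eigenvalues (hm : ∀ x y, Measurable fun ω => A ω x y) {φ : ℝ → ℝ}
    (hφ : Continuous φ) (x y : n) :
    Measurable fun ω => ∑ k, φ ((hA ω).eigenvalues k) * (hA ω).eigenvectorBasis k x *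
      (hA ω).eigenvectorBasis k y := by
  -- The chosen eigenvectors need not depend measurably on `ω`. Polynomials in the matrix have
  -- measurable entries, and approximation on the growing intervals `[-m, m]` converges at every
  -- eigenvalue.
  have hex : ∀ m : ℕ, ∃ P : Polynomial ℝ, ∀ s ∈ Set.Icc (-(m : ℝ)) m,
      |P.eval s - φ s| < 1 / ((m : ℝ) + 1) := fun m =>
    exists_polynomial_near_of_continuousOn _ _ φ hφ.continuousOn _ (by positivity)
  choose P hP using hex
  have hpow : ∀ (i : ℕ) (x y : n), Measurable fun ω => (A ω ^ i) x y := by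
    intro i
    induction i with
    | zero => intro x y; simp only [pow_zero]; exact measurable_const
    | succ i ih =>
      intro x y
      simp only [pow_succ, Matrix.mul_apply]
      exact Finset.measurable_sum _ fun z _ => (ih x z).mul (hm z y)
  have hpoly : ∀ m, Measurable fun ω => ∑ k, (P m).eval ((hA ω).eigenvalues k) *
      (hA ω).eigenvectorBasis k x * (hA ω).eigenvectorBasis k y := by
    intro m
    have : (fun ω => ∑ k, (P m).eval ((hA ω).eigenvalues k) *
        (hA ω).eigenvectorBasis k x * (hA ω).eigenvectorBasis k y) =
        fun ω => ∑ i ∈ Finset.range ((P m).natDegree + 1), (P m).coeff i * (A ω ^ i) x y := by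
      funext ω
      simp only [pow_apply_eq_sum_eigenvalues (hA ω), Polynomial.eval_eq_sum_range, Finset.sum_mul,
        Finset.mul_sum]
      rw [Finset.sum_comm]
      exact Finset.sum_congr rfl fun i _ => Finset.sum_congr rfl fun k _ => by ring
    rw [this]
    exact Finset.measurable_sum _ fun i _ => (hpow i x y).const_mul _
  refine measurable_of_tendsto_metrizable hpoly (tendsto_pi_nhds.2 fun ω => ?_)
  refine tendsto_finsetSum _ fun k _ => Filter.Tendsto.mul_const _ (Filter.Tendsto.mul_const _ ?_)
  rw [tendsto_iff_dist_tendsto_zero]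
  refine squeeze_zero' (Filter.Eventually.of_forall fun m => dist_nonneg) ?_
    tendsto_one_div_add_atTop_nhds_zero_nat
  filter_upwards [Filter.eventually_ge_atTop ⌈|(hA ω).eigenvalues k|⌉₊] with m hk
  have hk' : |(hA ω).eigenvalues k| ≤ m := (Nat.le_ceil _).trans (by exact_mod_cast hk)
  exact (hP m _ (abs_le.1 hk')).le

/-- The functional calculus of a random matrix is measurable, for continuous functions. -/
theorem measurable_matrixFun (hm : ∀ x y, Measurable fun ω => A ω x y) {φ : ℝ → ℂ}
    (hφ : Continuous φ) (x y : n) : Measurable fun ω => matrixFun (hA ω) φ x y := by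
  have h1 := measurable_sum_eigenvalues hA hm (Complex.continuous_re.comp hφ) x y
  have h2 := measurable_sum_eigenvalues hA hm (Complex.continuous_im.comp hφ) x y
  have : (fun ω => matrixFun (hA ω) φ x y) = fun ω =>
      ((∑ k, (φ ((hA ω).eigenvalues k)).re * (hA ω).eigenvectorBasis k x *
        (hA ω).eigenvectorBasis k y : ℝ) : ℂ) +
      ((∑ k, (φ ((hA ω).eigenvalues k)).im * (hA ω).eigenvectorBasis k x *
        (hA ω).eigenvectorBasis k y : ℝ) : ℂ) * Complex.I := by
    funext ω
    simp only [matrixFun, Matrix.of_apply]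
    push_cast
    rw [Finset.sum_mul, ← Finset.sum_add_distrib]
    refine Finset.sum_congr rfl fun k _ => ?_
    conv_lhs => rw [← Complex.re_add_im (φ ((hA ω).eigenvalues k))]
    ring
  rw [this]
  exact (Complex.measurable_ofReal.comp h1).add
    ((Complex.measurable_ofReal.comp h2).mul_const _)

/-- For almost surely positive definite random matrices continuity on `(0, ∞)` suffices. -/
theorem aemeasurable_matrixFun {P : Measure Ω} (hm : ∀ x y, Measurable fun ω => A ω x y)
    (hpos : ∀ᵐ ω ∂P, ∀ k, 0 < (hA ω).eigenvalues k) {φ : ℝ → ℂ}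
    (hφ : ContinuousOn φ (Set.Ioi (0 : ℝ))) (x y : n) :
    AEMeasurable (fun ω => matrixFun (hA ω) φ x y) P := by
  -- The cutoff removes a possible singularity at `0` and is eventually inactive at each positive
  -- eigenvalue.
  have hcont : ∀ m : ℕ, Continuous fun s => φ (max s (1 / ((m : ℝ) + 1))) := by
    intro m
    refine hφ.comp_continuous (continuous_id.max continuous_const) fun s => ?_
    exact lt_max_of_lt_right (Nat.one_div_pos_of_nat (α := ℝ) (n := m))
  refine aemeasurable_of_tendsto_metrizable_ae Filter.atTop
    (fun m => (measurable_matrixFun hA hm (hcont m) x y).aemeasurable) ?_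
  filter_upwards [hpos] with ω hω
  simp only [matrixFun, Matrix.of_apply]
  refine tendsto_finsetSum _ fun k _ => Filter.Tendsto.mul_const _ (Filter.Tendsto.mul_const _ ?_)
  refine tendsto_const_nhds.congr' ?_
  have := (tendsto_one_div_add_atTop_nhds_zero_nat (𝕜 := ℝ)).eventually_lt_const (hω k)
  filter_upwards [this] with m hmk
  rw [max_eq_left hmk.le]

end Measurability

/-! ### Uniform spectral bound and comparison with the eigenfunction correlators. -/

namespace Params

variable {d : ℕ} {p : Params d} {L : ℕ}

theorem measurable_bond {Ω : Type*} [MeasurableSpace Ω] {p : Ω → Params d}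
    (hcoupling : ∀ x y, dist1 x y = 1 → Measurable fun ω => (p ω).coupling s(x, y))
    (x y : Box d L) : Measurable fun ω => (p ω).bond L x y := by
  by_cases h : dist1 (x : Fin d → ℤ) y = 1
  · simp only [bond, if_pos h]
    exact hcoupling _ _ h
  · simp only [bond, if_neg h]
    exact measurable_const

theorem measurable_h {Ω : Type*} [MeasurableSpace Ω] {p : Ω → Params d}
    (hmass : ∀ x, Measurable fun ω => (p ω).mass x)
    (hspring : ∀ x, Measurable fun ω => (p ω).spring x)
    (hcoupling : ∀ x y, dist1 x y = 1 → Measurable fun ω => (p ω).coupling s(x, y))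
    (x y : Box d L) : Measurable fun ω => (p ω).h L x y := by
  have hs : ∀ x : Box d L, Measurable fun ω => Real.sqrt (1 / (2 * (p ω).mass x)) :=
    fun x => (((hmass x).const_mul 2).const_div 1).sqrt
  have h0 : Measurable fun ω => (p ω).h0 L x y := by
    simp only [h0_apply]
    refine Measurable.sub ?_ (measurable_bond hcoupling x y)
    split_ifs
    · exact ((hspring x).div_const 2).add
        (Finset.measurable_sum _ fun u _ => measurable_bond hcoupling x u)
    · exact measurable_const
  simp only [h_apply]
  exact ((hs x).mul h0).mul (hs y)

/-- The number of nearest neighbours in a box is bounded. -/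
theorem card_neighbours_le (x : Box d L) :
    (Finset.univ.filter fun y : Box d L => dist1 (x : Fin d → ℤ) y = 1).card ≤
      (Finset.Icc (fun _ : Fin d => (-1 : ℤ)) fun _ => 1).card := by
  refine Finset.card_le_card_of_injOn (fun y i => (x : Fin d → ℤ) i - (y : Fin d → ℤ) i) ?_ ?_
  · intro y hy
    have hy' : dist1 (x : Fin d → ℤ) y = 1 := (Finset.mem_filter.1 hy).2
    have hi : ∀ i, |(x : Fin d → ℤ) i - (y : Fin d → ℤ) i| ≤ 1 := by
      intro i
      rw [← hy', dist1]
      exact Finset.single_le_sum (f := fun i => |(x : Fin d → ℤ) i - (y : Fin d → ℤ) i|)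
        (fun j _ => abs_nonneg _) (Finset.mem_univ i)
    exact Finset.mem_coe.2 (Finset.mem_Icc.2 ⟨fun i => (abs_le.1 (hi i)).1,
      fun i => (abs_le.1 (hi i)).2⟩)
  · intro y _ z _ hyz
    refine Subtype.ext (funext fun i => ?_)
    have := congrFun hyz i
    simp only at this
    linarith

theorem bond_nonneg {mmin mmax kmax lmax : ℝ} (hb : p.Bounded mmin mmax kmax lmax)
    (x y : Box d L) : 0 ≤ p.bond L x y := by
  rw [bond]
  split_ifs with h
  · exact (hb.coupling _ _ h).1
  · exact le_rfl

theorem sum_bond_le {mmin mmax kmax lmax : ℝ} (hb : p.Bounded mmin mmax kmax lmax)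
    (x : Box d L) : ∑ y, p.bond L x y ≤
      (Finset.Icc (fun _ : Fin d => (-1 : ℤ)) fun _ => 1).card * |lmax| := by
  simp only [bond]
  rw [← Finset.sum_filter]
  refine (Finset.sum_le_card_nsmul _ _ |lmax| fun y hy => ?_).trans ?_
  · exact ((hb.coupling _ _ (Finset.mem_filter.1 hy).2).2).trans (le_abs_self _)
  · rw [nsmul_eq_mul]
    exact mul_le_mul_of_nonneg_right (by exact_mod_cast card_neighbours_le x) (abs_nonneg _)

/-- A uniform bound of the eigenvalues of `h_L`. -/
def eigenBound (d : ℕ) (mmin kmax lmax : ℝ) : ℝ :=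
  (kmax / 2 + 2 * ((Finset.Icc (fun _ : Fin d => (-1 : ℤ)) fun _ => 1).card * |lmax|)) *
    (1 / (2 * mmin))

/-- For a unit eigenvector `v` the eigenvalue is the `h0`-form at `w = μ^{1/2} v`. Use `(a - b)² ≤
2a² + 2b²`, the bounded number of neighbours, and `‖w‖² ≤ 1/(2 mmin)`. None of these depends on `L`.
-/
theorem eigenvalues_le {mmin mmax kmax lmax : ℝ} (hmmin : 0 < mmin)
    (hb : p.Bounded mmin mmax kmax lmax) (k : Box d L) :
    (p.h_isHermitian L).eigenvalues k ≤ eigenBound d mmin kmax lmax := by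
  set D : ℝ := (Finset.Icc (fun _ : Fin d => (-1 : ℤ)) fun _ => 1).card * |lmax| with hD
  set v : Box d L → ℝ := fun x => (p.h_isHermitian L).eigenvectorBasis k x with hv
  have hv1 : ∑ x, v x * v x = 1 := by
    have := sum_eigenvectorBasis_mul (p.h_isHermitian L) k k
    rwa [if_pos rfl] at this
  have hm : ∀ x, 0 < p.mass x := fun x => hmmin.trans_le (hb.mass x).1
  set w : Box d L → ℝ := fun x => Real.sqrt (1 / (2 * p.mass x)) * v x with hw
  have hkmax : 0 ≤ kmax := (hb.spring 0).1.trans (hb.spring 0).2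
  have hlam : (p.h_isHermitian L).eigenvalues k = ∑ x, ∑ y, p.h0 L x y * (w x * w y) := by
    calc (p.h_isHermitian L).eigenvalues k
        = ∑ x, v x * ((p.h_isHermitian L).eigenvalues k * v x) := by
          simp only [mul_left_comm _ ((p.h_isHermitian L).eigenvalues k), ← Finset.mul_sum, hv1,
            mul_one]
      _ = ∑ x, ∑ y, p.h0 L x y * (w x * w y) := by
          refine Finset.sum_congr rfl fun x _ => ?_
          have := congrFun ((p.h_isHermitian L).mulVec_eigenvectorBasis k) x
          simp only [Matrix.mulVec, dotProduct, Pi.smul_apply, smul_eq_mul] at this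
          rw [hv]
          simp only []
          rw [← this, Finset.mul_sum]
          refine Finset.sum_congr rfl fun y _ => ?_
          rw [h_apply]
          simp only [hw, hv]
          ring
  have hbond : ∑ x, ∑ y, p.bond L x y * (w x - w y) ^ 2 ≤ 4 * (D * ∑ x, w x ^ 2) := by
    have e1 : ∑ x, ∑ y, p.bond L x y * w y ^ 2 = ∑ x, ∑ y, p.bond L x y * w x ^ 2 := by
      rw [Finset.sum_comm]
      exact Finset.sum_congr rfl fun x _ => Finset.sum_congr rfl fun y _ => by rw [bond_comm]
    have e2 : ∑ x, ∑ y, p.bond L x y * w x ^ 2 ≤ D * ∑ x, w x ^ 2 := by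
      rw [Finset.mul_sum]
      refine Finset.sum_le_sum fun x _ => ?_
      rw [← Finset.sum_mul]
      exact mul_le_mul_of_nonneg_right (sum_bond_le hb x) (sq_nonneg _)
    calc ∑ x, ∑ y, p.bond L x y * (w x - w y) ^ 2
        ≤ ∑ x, ∑ y, (2 * (p.bond L x y * w x ^ 2) + 2 * (p.bond L x y * w y ^ 2)) := by
          refine Finset.sum_le_sum fun x _ => Finset.sum_le_sum fun y _ => ?_
          have := mul_nonneg (bond_nonneg hb x y) (sq_nonneg (w x + w y))
          nlinarith
      _ = 4 * ∑ x, ∑ y, p.bond L x y * w x ^ 2 := by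
          simp only [Finset.sum_add_distrib, ← Finset.mul_sum, e1]
          ring
      _ ≤ 4 * (D * ∑ x, w x ^ 2) := by linarith
  have hspring : ∑ x : Box d L, p.spring x / 2 * w x ^ 2 ≤ kmax / 2 * ∑ x, w x ^ 2 := by
    rw [Finset.mul_sum]
    refine Finset.sum_le_sum fun x _ => mul_le_mul_of_nonneg_right ?_ (sq_nonneg _)
    have := (hb.spring x).2
    linarith
  have hw2 : ∑ x, w x ^ 2 ≤ 1 / (2 * mmin) := by
    calc ∑ x, w x ^ 2 ≤ ∑ x, 1 / (2 * mmin) * (v x * v x) := by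
          refine Finset.sum_le_sum fun x _ => ?_
          have hx := hm x
          rw [hw]
          simp only []
          rw [mul_pow, Real.sq_sqrt (by positivity), pow_two (v x)]
          refine mul_le_mul_of_nonneg_right ?_ (mul_self_nonneg _)
          have := (hb.mass x).1
          gcongr
      _ = 1 / (2 * mmin) := by rw [← Finset.mul_sum, hv1, mul_one]
  rw [hlam, sum_h0_mul]
  have hD0 : 0 ≤ D := by positivity
  calc _ ≤ kmax / 2 * ∑ x, w x ^ 2 + 1 / 2 * (4 * (D * ∑ x, w x ^ 2)) := by linarith
    _ = (kmax / 2 + 2 * D) * ∑ x, w x ^ 2 := by ring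
    _ ≤ (kmax / 2 + 2 * D) * (1 / (2 * mmin)) := mul_le_mul_of_nonneg_left hw2 (by linarith)
    _ = eigenBound d mmin kmax lmax := rfl

/-- The wave kernels are controlled by the eigenfunction correlators. -/
theorem enorm_waveKernel_rpow_le {M : ℝ} (hM : 1 ≤ M)
    (hpos : ∀ k, 0 < (p.h_isHermitian L).eigenvalues k)
    (hle : ∀ k, (p.h_isHermitian L).eigenvalues k ≤ M) {α r : ℝ} (hα : -1 / 2 ≤ α)
    (hα' : α ≤ 1 / 2) (hr : 0 < r) (t : ℝ) (x y : Box d L) :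
    ‖p.waveKernel L α t x y‖ₑ ^ r ≤
      ENNReal.ofReal (M ^ r) * correlator p L (-1 / 2) r x y := by
  have hM0 : 0 < M := one_pos.trans_le hM
  -- This `u` satisfies `s^α e^{-2i√s t} = M s^{-1/2} u(s)` on the spectrum. Since `0 ≤ α + 1/2 ≤ 1`
  -- and `M ≥ 1`, `s^{α + 1/2} ≤ M` there; elsewhere `u` is cut off.
  set u : ℝ → ℂ := fun s => if 0 < s ∧ s ≤ M then
    ((s ^ (α + 1 / 2) / M : ℝ) : ℂ) * Complex.exp (-(2 * Real.sqrt s * t : ℝ) * Complex.I)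
    else 0 with hu
  have hu1 : ∀ s, ‖u s‖ ≤ 1 := by
    intro s
    simp only [hu]
    split_ifs with hs
    · have he : ‖Complex.exp (-(2 * Real.sqrt s * t : ℝ) * Complex.I)‖ = 1 := by
        rw [← Complex.ofReal_neg, Complex.norm_exp_ofReal_mul_I]
      rw [norm_mul, he, mul_one, Complex.norm_real, Real.norm_of_nonneg
        (div_nonneg (Real.rpow_nonneg hs.1.le _) hM0.le), div_le_one hM0]
      calc s ^ (α + 1 / 2) ≤ M ^ (α + 1 / 2) :=
            Real.rpow_le_rpow hs.1.le hs.2 (by linarith)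
        _ ≤ M ^ (1 : ℝ) := Real.rpow_le_rpow_of_exponent_le hM (by linarith)
        _ = M := Real.rpow_one M
    · simp
  have hK : p.waveKernel L α t x y =
      (M : ℂ) * matrixFun (p.h_isHermitian L) (fun s => ((s ^ (-1 / 2 : ℝ) : ℝ) : ℂ) * u s) x y := by
    simp only [waveKernel, matrixFun, Matrix.of_apply, Finset.mul_sum]
    refine Finset.sum_congr rfl fun k _ => ?_
    have hk := hpos k
    simp only [hu]
    have hpow : (p.h_isHermitian L).eigenvalues k ^ α =
        (p.h_isHermitian L).eigenvalues k ^ (-1 / 2 : ℝ) *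
          (p.h_isHermitian L).eigenvalues k ^ (α + 1 / 2) := by
      rw [← Real.rpow_add hk]
      congr 1
      ring
    rw [if_pos ⟨hk, hle k⟩, hpow]
    have hMc : (M : ℂ) ≠ 0 := Complex.ofReal_ne_zero.2 hM0.ne'
    push_cast
    field_simp
  have hcorr : ENNReal.ofReal (‖matrixFun (p.h_isHermitian L)
      (fun s => ((s ^ (-1 / 2 : ℝ) : ℝ) : ℂ) * u s) x y‖ ^ r) ≤ correlator p L (-1 / 2) r x y :=
    le_iSup₂_of_le u hu1 le_rfl
  refine le_trans (le_of_eq ?_) (mul_le_mul_right hcorr _)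
  rw [hK, ← ofReal_norm, ENNReal.ofReal_rpow_of_nonneg (norm_nonneg _) hr.le, norm_mul,
    Complex.norm_real, Real.norm_of_nonneg hM0.le, Real.mul_rpow hM0.le (norm_nonneg _),
    ENNReal.ofReal_mul (Real.rpow_nonneg hM0.le _)]

end Params

/-! ### Fractional powers and time-uniform bounds by kernels. -/

theorem sum_rpow_le_sum_rpow {J : Type*} (s : Finset J) (a : J → ℝ≥0∞) {r : ℝ} (hr0 : 0 < r)
    (hr1 : r ≤ 1) : (∑ i ∈ s, a i) ^ r ≤ ∑ i ∈ s, a i ^ r := by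
  classical
  induction s using Finset.induction_on with
  | empty => simp [hr0]
  | insert i s hi ih =>
    rw [Finset.sum_insert hi, Finset.sum_insert hi]
    exact (ENNReal.rpow_add_le_add_rpow _ _ hr0.le hr1).trans (add_le_add le_rfl ih)

/-- Interpolates between the two bounds: `b ≤ b^r` when `b ≤ 1`, and `2 ≤ 2 b^r` otherwise. -/
theorem le_two_mul_rpow {a b r : ℝ} (hb : 0 ≤ b) (hr0 : 0 < r) (hr1 : r ≤ 1)
    (h : a ≤ min 2 b) : a ≤ 2 * b ^ r := by
  rcases le_total b 1 with hb1 | hb1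
  · have h1 : b ≤ b ^ r := by
      rcases hb.eq_or_lt with h0 | h0
      · rw [← h0]; exact Real.rpow_nonneg le_rfl r
      · simpa using Real.rpow_le_rpow_of_exponent_ge h0 hb1 hr1
    have := h.trans (min_le_right _ _)
    linarith
  · have h1 : 1 ≤ b ^ r := Real.one_le_rpow hb1 hr0.le
    have := h.trans (min_le_left _ _)
    linarith

namespace Params

variable {d : ℕ} {p : Params d} {L : ℕ}

/-- The constant `c` dominates the entries of both `μ^{1/2}` and `μ^{-1/2}`. The prefactor `1/2`
absorbs the two occurrences of the kernel with exponent `0`. -/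
theorem norm_corrExponent_le (hm : ∀ x, 0 < p.mass x) (hpos : (p.h0 L).PosDef) {c : ℝ}
    (hc : ∀ x, Real.sqrt (1 / (2 * p.mass x)) ≤ c)
    (hc' : ∀ x, 1 / Real.sqrt (1 / (2 * p.mass x)) ≤ c) (f g : Box d L → ℂ) (t : ℝ) :
    ‖p.corrExponent L f g t‖ ≤ ∑ x, ∑ y, c ^ 2 * ‖f x‖ * ‖g y‖ *
      (‖p.waveKernel L (-1 / 2) t x y‖ + ‖p.waveKernel L 0 t x y‖ +
        ‖p.waveKernel L (1 / 2) t x y‖) := by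
  rw [corrExponent_eq hm hpos]
  refine (norm_sum_le _ _).trans (Finset.sum_le_sum fun x _ => ?_)
  refine (norm_sum_le _ _).trans (Finset.sum_le_sum fun y _ => ?_)
  have hre : ∀ (f : Box d L → ℂ) (x : Box d L),
      ‖(Real.sqrt (1 / (2 * p.mass x)) * (f x).re : ℂ)‖ ≤ c * ‖f x‖ := by
    intro f x
    rw [norm_mul, Complex.norm_real, Complex.norm_real,
      Real.norm_of_nonneg (Real.sqrt_nonneg _)]
    exact mul_le_mul (hc x) (Complex.abs_re_le_norm _) (norm_nonneg _)
      ((sqrtMu_pos hm x).le.trans (hc x))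
  have him : ∀ (f : Box d L → ℂ) (x : Box d L),
      ‖((f x).im / Real.sqrt (1 / (2 * p.mass x)) : ℂ)‖ ≤ c * ‖f x‖ := by
    intro f x
    rw [norm_div, Complex.norm_real, Complex.norm_real,
      Real.norm_of_nonneg (Real.sqrt_nonneg _), div_eq_mul_one_div, mul_comm]
    exact mul_le_mul (hc' x) (Complex.abs_im_le_norm _) (norm_nonneg _)
      ((sqrtMu_pos hm x).le.trans (hc x))
  have hc0 : 0 ≤ c := (sqrtMu_pos hm 0).le.trans (hc 0)
  have hmul : ∀ {u v : ℂ}, ‖u‖ ≤ c * ‖f x‖ → ‖v‖ ≤ c * ‖g y‖ →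
      ‖u * v‖ ≤ c ^ 2 * ‖f x‖ * ‖g y‖ := by
    intro u v hu hv
    rw [norm_mul]
    calc ‖u‖ * ‖v‖ ≤ (c * ‖f x‖) * (c * ‖g y‖) :=
          mul_le_mul hu hv (norm_nonneg _) (by positivity)
      _ = c ^ 2 * ‖f x‖ * ‖g y‖ := by ring
  have h1 := mul_le_mul_of_nonneg_right (hmul (hre f x) (hre g y))
    (norm_nonneg (p.waveKernel L (-1 / 2) t x y))
  have h2 := mul_le_mul_of_nonneg_right (hmul (hre f x) (him g y))
    (norm_nonneg (p.waveKernel L 0 t x y))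
  have h3 := mul_le_mul_of_nonneg_right (hmul (him f x) (hre g y))
    (norm_nonneg (p.waveKernel L 0 t x y))
  have h4 := mul_le_mul_of_nonneg_right (hmul (him f x) (him g y))
    (norm_nonneg (p.waveKernel L (1 / 2) t x y))
  have n1 : 0 ≤ c ^ 2 * ‖f x‖ * ‖g y‖ * ‖p.waveKernel L (-1 / 2) t x y‖ := by positivity
  have n4 : 0 ≤ c ^ 2 * ‖f x‖ * ‖g y‖ * ‖p.waveKernel L (1 / 2) t x y‖ := by positivity
  rw [norm_mul, norm_div, norm_one, Complex.norm_ofNat]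
  have hsum : ∀ {z₁ z₂ z₃ z₄ : ℂ}, ‖z₁ + z₂ - z₃ + z₄‖ ≤ ‖z₁‖ + ‖z₂‖ + ‖z₃‖ + ‖z₄‖ := by
    intro z₁ z₂ z₃ z₄
    refine (norm_add_le _ _).trans (add_le_add ?_ le_rfl)
    refine (norm_sub_le _ _).trans (add_le_add ?_ le_rfl)
    exact norm_add_le _ _
  refine (mul_le_mul_of_nonneg_left hsum (by norm_num)).trans ?_
  rw [norm_mul _ (p.waveKernel L (-1 / 2) t x y), norm_mul _ (p.waveKernel L 0 t x y),
    norm_mul _ (p.waveKernel L 0 t x y), norm_mul _ (p.waveKernel L (1 / 2) t x y),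
    norm_mul Complex.I, norm_mul Complex.I, Complex.norm_I, one_mul, one_mul]
  linarith

/-- The maximal wave kernel, over rational times. -/
def maxKernel (p : Params d) (L : ℕ) (α r : ℝ) (x y : Box d L) : ℝ≥0∞ :=
  ⨆ q : ℚ, ‖p.waveKernel L α q x y‖ₑ ^ r

/-- The kernels are continuous in time and the rationals are dense; restricting to a countable
supremum is what keeps `maxKernel` measurable in the disorder. -/
theorem enorm_waveKernel_le_maxKernel (α r : ℝ) (x y : Box d L) (t : ℝ) :
    ‖p.waveKernel L α t x y‖ₑ ^ r ≤ p.maxKernel L α r x y := by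
  have hcont : Continuous fun t : ℝ => ‖p.waveKernel L α t x y‖ₑ ^ r := by
    refine ENNReal.continuous_rpow_const.comp (continuous_enorm.comp ?_)
    simp only [waveKernel, matrixFun, Matrix.of_apply]
    refine continuous_finsetSum _ fun k _ => ?_
    refine (Continuous.mul (continuous_const.mul ?_) continuous_const).mul continuous_const
    refine Complex.continuous_exp.comp (Continuous.mul (Continuous.neg ?_) continuous_const)
    exact Complex.continuous_ofReal.comp (continuous_const.mul continuous_id)
  refine Rat.denseRange_cast.induction_on (p := fun t : ℝ =>
    ‖p.waveKernel L α t x y‖ₑ ^ r ≤ p.maxKernel L α r x y) t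
    (isClosed_le hcont continuous_const) fun q => ?_
  exact le_iSup (fun q : ℚ => ‖p.waveKernel L α q x y‖ₑ ^ r) q

/-- Subadditivity of the `r`-th power separates the deterministic weights of `f` and `g` from the
random kernels, leaving a bound without time. -/
theorem iSup_enorm_weylCorrelation_le (hm : ∀ x, 0 < p.mass x) (hpos : (p.h0 L).PosDef) {c r : ℝ}
    (hc : ∀ x, Real.sqrt (1 / (2 * p.mass x)) ≤ c)
    (hc' : ∀ x, 1 / Real.sqrt (1 / (2 * p.mass x)) ≤ c) (hr0 : 0 < r) (hr1 : r ≤ 1)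
    (f g : Box d L → ℂ) :
    ⨆ t, ‖weylCorrelation p L f g t‖ₑ ≤ ∑ x, ∑ y, ENNReal.ofReal (2 * (c ^ 2 * ‖f x‖ * ‖g y‖) ^ r) *
      (p.maxKernel L (-1 / 2) r x y + p.maxKernel L 0 r x y + p.maxKernel L (1 / 2) r x y) := by
  refine iSup_le fun t => ?_
  obtain ⟨s, hs⟩ := norm_weylCorrelation_le hm hpos f g t
  have h1 := le_two_mul_rpow (norm_nonneg _) hr0 hr1 hs
  have h2 : ENNReal.ofReal ‖p.corrExponent L f g s‖ ≤ ∑ x, ∑ y,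
      ENNReal.ofReal (c ^ 2 * ‖f x‖ * ‖g y‖) *
      (‖p.waveKernel L (-1 / 2) s x y‖ₑ + ‖p.waveKernel L 0 s x y‖ₑ +
        ‖p.waveKernel L (1 / 2) s x y‖ₑ) := by
    refine (ENNReal.ofReal_le_ofReal (norm_corrExponent_le hm hpos hc hc' f g s)).trans_eq ?_
    rw [ENNReal.ofReal_sum_of_nonneg fun x _ => Finset.sum_nonneg fun y _ => by positivity]
    refine Finset.sum_congr rfl fun x _ => ?_
    rw [ENNReal.ofReal_sum_of_nonneg fun y _ => by positivity]
    refine Finset.sum_congr rfl fun y _ => ?_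
    rw [ENNReal.ofReal_mul (by positivity), ENNReal.ofReal_add (by positivity) (by positivity),
      ENNReal.ofReal_add (by positivity) (by positivity), ofReal_norm, ofReal_norm, ofReal_norm]
  calc ‖weylCorrelation p L f g t‖ₑ = ENNReal.ofReal ‖weylCorrelation p L f g t‖ :=
        (ofReal_norm _).symm
    _ ≤ ENNReal.ofReal (2 * ‖p.corrExponent L f g s‖ ^ r) := ENNReal.ofReal_le_ofReal h1
    _ = ENNReal.ofReal 2 * (ENNReal.ofReal ‖p.corrExponent L f g s‖) ^ r := by
        rw [ENNReal.ofReal_mul zero_le_two, ENNReal.ofReal_rpow_of_nonneg (norm_nonneg _) hr0.le]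
    _ ≤ ENNReal.ofReal 2 * ∑ x, ∑ y, (ENNReal.ofReal (c ^ 2 * ‖f x‖ * ‖g y‖) *
      (‖p.waveKernel L (-1 / 2) s x y‖ₑ + ‖p.waveKernel L 0 s x y‖ₑ +
        ‖p.waveKernel L (1 / 2) s x y‖ₑ)) ^ r := by
        gcongr
        refine (ENNReal.rpow_le_rpow h2 hr0.le).trans ?_
        refine (sum_rpow_le_sum_rpow _ _ hr0 hr1).trans (Finset.sum_le_sum fun x _ => ?_)
        exact sum_rpow_le_sum_rpow _ _ hr0 hr1
    _ ≤ _ := by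
        rw [Finset.mul_sum]
        refine Finset.sum_le_sum fun x _ => ?_
        rw [Finset.mul_sum]
        refine Finset.sum_le_sum fun y _ => ?_
        rw [ENNReal.mul_rpow_of_nonneg _ _ hr0.le, ← mul_assoc,
          ENNReal.ofReal_rpow_of_nonneg (by positivity) hr0.le, ← ENNReal.ofReal_mul zero_le_two]
        gcongr
        refine (ENNReal.rpow_add_le_add_rpow _ _ hr0.le hr1).trans
          (add_le_add ((ENNReal.rpow_add_le_add_rpow _ _ hr0.le hr1).trans (add_le_add ?_ ?_)) ?_)
          <;> exact enorm_waveKernel_le_maxKernel _ _ _ _ _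

theorem aemeasurable_maxKernel {Ω : Type*} [MeasurableSpace Ω] {P : Measure Ω} {p : Ω → Params d}
    (hmass : ∀ x, Measurable fun ω => (p ω).mass x)
    (hspring : ∀ x, Measurable fun ω => (p ω).spring x)
    (hcoupling : ∀ x y, dist1 x y = 1 → Measurable fun ω => (p ω).coupling s(x, y))
    (hpos : ∀ᵐ ω ∂P, ∀ k, 0 < ((p ω).h_isHermitian L).eigenvalues k) (α r : ℝ) (x y : Box d L) :
    AEMeasurable (fun ω => (p ω).maxKernel L α r x y) P := by
  refine AEMeasurable.iSup fun q => ?_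
  refine (AEMeasurable.enorm ?_).pow_const r
  refine aemeasurable_matrixFun (fun ω => (p ω).h_isHermitian L)
    (measurable_h hmass hspring hcoupling) hpos ?_ x y
  refine ContinuousOn.mul ?_ (Continuous.continuousOn ?_)
  · refine Complex.continuous_ofReal.comp_continuousOn ?_
    exact ContinuousOn.rpow_const continuousOn_id fun s hs => Or.inl (ne_of_gt hs)
  · refine Complex.continuous_exp.comp (Continuous.mul (Continuous.neg ?_) continuous_const)
    exact Complex.continuous_ofReal.comp
      ((continuous_const.mul Real.continuous_sqrt).mul continuous_const)

end Params

end Oscillator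

end

/-! ### Averaging over the disorder. -/

theorem theorem4p1 {d : ℕ} (hd : 1 ≤ d) {Ω : Type*} [MeasurableSpace Ω]
    (P : MeasureTheory.Measure Ω) [MeasureTheory.IsProbabilityMeasure P]
    (p : Ω → Oscillator.Params d)
    (hmass : ∀ x, Measurable fun ω => (p ω).mass x)
    (hspring : ∀ x, Measurable fun ω => (p ω).spring x)
    (hcoupling : ∀ x y, Oscillator.dist1 x y = 1 → Measurable fun ω => (p ω).coupling s(x, y))
    (mmin mmax kmax lmax : ℝ) (hmmin : 0 < mmin)
    (hbounded : ∀ᵐ ω ∂P, (p ω).Bounded mmin mmax kmax lmax)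
    (hposdef : ∀ᵐ ω ∂P, ∀ L : ℕ, 1 ≤ L → ((p ω).h0 L).PosDef)
    (r : ℝ) (hr0 : 0 < r) (hr1 : r ≤ 1)
    (hdecay : Oscillator.HasDecayingCorrelators P p (-1 / 2) r) :
    ∃ C' μ' : ℝ, 0 ≤ C' ∧ 0 < μ' ∧ ∀ L : ℕ, 1 ≤ L → ∀ f g : Oscillator.Box d L → ℂ,
      ∫⁻ ω, ⨆ t : ℝ, ‖Oscillator.weylCorrelation (p ω) L f g t‖ₑ ∂P ≤
        ENNReal.ofReal (C' * ∑ x : Oscillator.Box d L, ∑ y : Oscillator.Box d L,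
          ‖f x‖ ^ r * ‖g y‖ ^ r *
            Real.exp (-μ' * (Oscillator.dist1 (x : Fin d → ℤ) y : ℝ))) := by
  obtain ⟨C, ν, hC, hν, hcorr⟩ := hdecay
  -- `M` bounds the spectrum and is at least `1`, as the kernel comparison requires; `c` bounds
  -- `μ^{1/2}` through `mmin` and `μ^{-1/2}` through `mmax`.
  set M : ℝ := max 1 (Oscillator.Params.eigenBound d mmin kmax lmax) with hM
  set c : ℝ := max (Real.sqrt (1 / (2 * mmin))) (Real.sqrt (2 * mmax)) with hc
  have hM1 : 1 ≤ M := le_max_left _ _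
  have hc0 : 0 ≤ c := (Real.sqrt_nonneg _).trans (le_max_left _ _)
  -- The `6` is the `2` of `le_two_mul_rpow` times three kernels. The decay rate is that of the
  -- correlators.
  refine ⟨6 * (c ^ 2) ^ r * M ^ r * C, ν, by positivity, hν, fun L hL f g => ?_⟩
  have hgood : ∀ᵐ ω ∂P, ⨆ t : ℝ, ‖Oscillator.weylCorrelation (p ω) L f g t‖ₑ ≤
      ∑ x, ∑ y, ENNReal.ofReal (2 * (c ^ 2 * ‖f x‖ * ‖g y‖) ^ r) *
      ((p ω).maxKernel L (-1 / 2) r x y + (p ω).maxKernel L 0 r x y +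
        (p ω).maxKernel L (1 / 2) r x y) := by
    filter_upwards [hbounded, hposdef] with ω hb hp
    have hm : ∀ x, 0 < (p ω).mass x := fun x => hmmin.trans_le (hb.mass x).1
    refine Oscillator.Params.iSup_enorm_weylCorrelation_le hm (hp L hL) (fun x => ?_)
      (fun x => ?_) hr0 hr1 f g
    · refine le_trans (Real.sqrt_le_sqrt ?_) (le_max_left _ _)
      have := (hb.mass x).1
      gcongr
    · rw [one_div, ← Real.sqrt_inv, one_div, inv_inv]
      refine le_trans (Real.sqrt_le_sqrt ?_) (le_max_right _ _)
      have := (hb.mass x).2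
      linarith
  have hpos : ∀ᵐ ω ∂P, ∀ k, 0 < ((p ω).h_isHermitian L).eigenvalues k := by
    filter_upwards [hbounded, hposdef] with ω hb hp k
    exact (Oscillator.Params.h_posDef (fun x => hmmin.trans_le (hb.mass x).1)
      (hp L hL)).eigenvalues_pos k
  have hmeas := fun α => Oscillator.Params.aemeasurable_maxKernel (P := P) (L := L) hmass hspring
    hcoupling hpos α r
  have hker : ∀ α : ℝ, -1 / 2 ≤ α → α ≤ 1 / 2 → ∀ x y : Oscillator.Box d L,
      ∫⁻ ω, (p ω).maxKernel L α r x y ∂P ≤ ENNReal.ofReal (M ^ r * (C *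
        Real.exp (-ν * (Oscillator.dist1 (x : Fin d → ℤ) y : ℝ)))) := by
    intro α hα hα' x y
    calc ∫⁻ ω, (p ω).maxKernel L α r x y ∂P
        ≤ ∫⁻ ω, ENNReal.ofReal (M ^ r) * Oscillator.correlator (p ω) L (-1 / 2) r x y ∂P := by
          refine MeasureTheory.lintegral_mono_ae ?_
          filter_upwards [hbounded, hpos] with ω hb hp
          refine iSup_le fun q => ?_
          exact Oscillator.Params.enorm_waveKernel_rpow_le hM1 hp (fun k =>
            (Oscillator.Params.eigenvalues_le hmmin hb k).trans (le_max_right _ _)) hα hα' hr0 _ x y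
      _ ≤ _ := by
          rw [MeasureTheory.lintegral_const_mul' _ _ ENNReal.ofReal_ne_top,
            ENNReal.ofReal_mul (by positivity)]
          gcongr
          exact hcorr L hL x y
  calc ∫⁻ ω, ⨆ t : ℝ, ‖Oscillator.weylCorrelation (p ω) L f g t‖ₑ ∂P
      ≤ ∫⁻ ω, ∑ x, ∑ y, ENNReal.ofReal (2 * (c ^ 2 * ‖f x‖ * ‖g y‖) ^ r) *
        ((p ω).maxKernel L (-1 / 2) r x y + (p ω).maxKernel L 0 r x y +
        (p ω).maxKernel L (1 / 2) r x y) ∂P := MeasureTheory.lintegral_mono_ae hgood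
    _ = ∑ x, ∑ y, ENNReal.ofReal (2 * (c ^ 2 * ‖f x‖ * ‖g y‖) ^ r) *
        (∫⁻ ω, (p ω).maxKernel L (-1 / 2) r x y ∂P + ∫⁻ ω, (p ω).maxKernel L 0 r x y ∂P +
        ∫⁻ ω, (p ω).maxKernel L (1 / 2) r x y ∂P) := by
        -- Only this majorant has to be measurable for splitting the integral; the correlation
        -- itself and the correlators enter through monotonicity and constant factors alone.
        have hterm : ∀ x y : Oscillator.Box d L, AEMeasurable (fun ω =>
            ENNReal.ofReal (2 * (c ^ 2 * ‖f x‖ * ‖g y‖) ^ r) *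
            ((p ω).maxKernel L (-1 / 2) r x y + (p ω).maxKernel L 0 r x y +
            (p ω).maxKernel L (1 / 2) r x y)) P := fun x y =>
          (((hmeas _ x y).add (hmeas _ x y)).add (hmeas _ x y)).const_mul _
        rw [MeasureTheory.lintegral_finsetSum' _ fun x _ =>
          Finset.aemeasurable_fun_sum _ fun y _ => hterm x y]
        refine Finset.sum_congr rfl fun x _ => ?_
        rw [MeasureTheory.lintegral_finsetSum' _ fun y _ => hterm x y]
        refine Finset.sum_congr rfl fun y _ => ?_
        rw [MeasureTheory.lintegral_const_mul' _ _ ENNReal.ofReal_ne_top,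
          MeasureTheory.lintegral_add_right' _ (hmeas _ x y),
          MeasureTheory.lintegral_add_right' _ (hmeas _ x y)]
    _ ≤ ∑ x, ∑ y, ENNReal.ofReal (6 * (c ^ 2) ^ r * M ^ r * C * (‖f x‖ ^ r * ‖g y‖ ^ r *
            Real.exp (-ν * (Oscillator.dist1 (x : Fin d → ℤ) y : ℝ)))) := by
        refine Finset.sum_le_sum fun x _ => Finset.sum_le_sum fun y _ => ?_
        refine (mul_le_mul_right (add_le_add (add_le_add
          (hker (-1 / 2) le_rfl (by norm_num) x y) (hker 0 (by norm_num) (by norm_num) x y))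
          (hker (1 / 2) (by norm_num) le_rfl x y)) _).trans_eq ?_
        rw [← ENNReal.ofReal_add (by positivity) (by positivity),
          ← ENNReal.ofReal_add (by positivity) (by positivity),
          ← ENNReal.ofReal_mul (by positivity),
          Real.mul_rpow (by positivity) (norm_nonneg _), Real.mul_rpow (by positivity)
            (norm_nonneg _)]
        congr 1
        ring
    _ = _ := by
        rw [Finset.mul_sum, ENNReal.ofReal_sum_of_nonneg fun x _ => by positivity]
        refine Finset.sum_congr rfl fun x _ => ?_
        rw [Finset.mul_sum, ENNReal.ofReal_sum_of_nonneg fun y _ => by positivity]
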